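/- Let $k$ be a field, $n\ge 0$, $S=k[x_1,\dots,x_n]$ with its $\mathbb Z^n$-grading, ${}^*\mathrm{Mod}$ the category of $\mathbb Z^n$-graded $S$-modules and degree-preserving $S$-linear maps, and $\operatorname{supp}_+(a)=\{i\mid a_i>0\}$ for $a\in\mathbb Z^n$. A $\mathbb Z^n$-graded $S$-module $M$ is squarefree if $M_a=0$ for $a\notin\mathbb N^n$, $\dim_k M_a<\infty$ for $a\in\mathbb N^n$, and multiplication by $x^b$ is a bijection $M_a\to M_{a+b}$ for all $a,b\in\mathbb N^n$ with $\operatorname{supp}_+(a+b)=\operatorname{supp}_+(a)$. Let $\mathbf{Sq}\subset{}^*\mathrm{Mod}$ be the full subcategory of squarefree modules, $\mathrm{Com}^b(\mathbf{Sq})$ the category of bounded cochain complexes in $\mathbf{Sq}$, and $D^b(\mathbf{Sq})$ its localization at the quasi-isomorphisms, with translation functor $\mathbf T\colon M^\bullet\mapsto M^\bullet[1]$. The Alexander duality functor $\mathbf A$ is the contravariant functor on $\mathbf{Sq}$ for which $\mathbf A(M)_a=\operatorname{Hom}_k(M_{[n]\setminus\operatorname{supp}_+(a)},k)$ for $a\in\mathbb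 N^n$ (a subset of $[n]=\{1,\dots,n\}$ being identified with its $0/1$-vector), the multiplication maps of $\mathbf A(M)$ being the $k$-duals of those of $M$; on complexes, $\mathbf A(M^\bullet)^i=\mathbf A(M^{-i})$. Let $\omega^\bullet$ be the minimal injective resolution of $\omega_S[n]$ in ${}^*\mathrm{Mod}$, $\omega_S=S(-1,\dots,-1)$; explicitly $\omega^i=\bigoplus_{F\subset[n],\,|F|=-i}{}^*E(S/P_F)$, where $P_F=(x_i\mid i\notin F)$ and ${}^*E$ denotes the injective envelope in ${}^*\mathrm{Mod}$, with differential composed of $(-1)^{\#\{i\in F\mid i<j\}}$ times the natural map ${}^*E(S/P_F)\to{}^*E(S/P_{F\setminus\{j\}})$ for $j\in F$. Let $\mathbf D(M^\bullet)=\mathcal N({}^*\mathrm{Hom}_S^\bullet(M^\bullet,\omega^\bullet))$ for $M^\bullet\in\mathrm{Com}^b(\mathbf{Sq})$, where $\mathcal N$ denotes the $\mathbb N^n$-graded part; this is again a bounded complex of squarefree modules (and $H^i(\mathbf D(M^\bullet))=\operatorname{Ext}_S^{n+i}(M^\bullet,\omega_S)$). Then $\mathbf A$ and $\mathbf D$ preserve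 quasi-isomorphisms, hence induce contravariant functors from $D^b(\mathbf{Sq})$ to itself, and there is a natural isomorphism $$\mathbf D\circ\mathbf A\circ\mathbf D\circ\mathbf A\circ\mathbf D\circ\mathbf A\;\cong\;\mathbf T^{2n}$$ of functors from $D^b(\mathbf{Sq})$ to itself, where $\mathbf T^{2n}\colon M^\bullet\mapsto M^\bullet[2n]$. -/

import Mathlib

open CategoryTheory

universe u

noncomputable section

namespace SquarefreeModules

/-- The degrees `a ∈ ℤⁿ`, ordered componentwise. -/
def Deg (n : ℕ) : Type := Fin n → ℤ

instance (n : ℕ) : AddCommGroup (Deg n) := inferInstanceAs (AddCommGroup (Fin n → ℤ))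
instance (n : ℕ) : PartialOrder (Deg n) := inferInstanceAs (PartialOrder (Fin n → ℤ))
instance (n : ℕ) : DecidableEq (Deg n) := inferInstanceAs (DecidableEq (Fin n → ℤ))

/-- The exponent vector `b ∈ ℕⁿ`, viewed in `ℤⁿ`. -/
def toDeg {n : ℕ} (b : Fin n →₀ ℕ) : Deg n := fun i => (b i : ℤ)

/-- The exponent vector `b - a ∈ ℕⁿ` (used for `a ≤ b` in `ℤⁿ`). -/
def expo {n : ℕ} (a b : Deg n) : Fin n →₀ ℕ :=
  Finsupp.equivFunOnFinite.symm fun i => (b i - a i).toNat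

/-- The `i`-th coordinate of `a ∈ ℤⁿ`. -/
def coord {n : ℕ} (a : Deg n) (i : Fin n) : ℤ := a i

/-- `supp₊(a) = {i | a_i > 0}`. -/
def supp {n : ℕ} (a : Deg n) : Finset (Fin n) := 
  (Finset.univ : Finset (Fin n)).filter fun i => 0 < coord a i

/-- The squarefree vector in `ℤⁿ` with support `F ⊆ [n]`. -/
def sqf {n : ℕ} (F : Finset (Fin n)) : Deg n := fun i => if i ∈ F then 1 else 0

/-- The monomial `x^b`. -/
abbrev mon (k : Type u) [Field k] {n : ℕ} (b : Fin n →₀ ℕ) : MvPolynomial (Fin n) k :=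
  MvPolynomial.monomial b 1

lemma add_toDeg_expo {n : ℕ} {a b : Deg n} (h : a ≤ b) : a + toDeg (expo a b) = b := by
  funext i
  have : a i ≤ b i := h i
  change a i + (((b i - a i).toNat : ℕ) : ℤ) = b i
  omega

lemma expo_self {n : ℕ} (a : Deg n) : expo a a = 0 := by
  ext i; simp [expo]

lemma expo_add_expo {n : ℕ} {a b c : Deg n} (h : a ≤ b) (h' : b ≤ c) :
    expo a b + expo b c = expo a c := by
  ext i
  have h1 : a i ≤ b i := h i
  have h2 : b i ≤ c i := h' i
  change (b i - a i).toNat + (c i - b i).toNat = (c i - a i).toNat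
  omega

lemma le_add_toDeg {n : ℕ} (a : Deg n) (b : Fin n →₀ ℕ) : a ≤ a + toDeg b := by
  intro i
  change a i ≤ a i + (b i : ℤ)
  omega

lemma toDeg_add {n : ℕ} (b c : Fin n →₀ ℕ) : toDeg (b + c) = toDeg b + toDeg c := by
  funext i; exact Nat.cast_add _ _

lemma toDeg_zero {n : ℕ} : toDeg (0 : Fin n →₀ ℕ) = 0 := rfl

lemma supp_mono {n : ℕ} {a b : Deg n} (h : a ≤ b) : supp a ⊆ supp b := by
  intro i hi
  simp only [supp, Finset.mem_filter, Finset.mem_univ, true_and] at hi ⊢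
  exact lt_of_lt_of_le hi (h i)

lemma sqf_mono {n : ℕ} {F G : Finset (Fin n)} (h : F ⊆ G) : sqf F ≤ sqf G := by
  intro i
  by_cases hF : i ∈ F
  · simp [sqf, hF, h hF]
  · simp only [sqf, hF, if_false]; split_ifs <;> simp

lemma sqf_nonneg {n : ℕ} (F : Finset (Fin n)) : (0 : Deg n) ≤ sqf F := by
  intro i
  change (0 : ℤ) ≤ if i ∈ F then 1 else 0
  split_ifs <;> simp

lemma supp_sqf {n : ℕ} (F : Finset (Fin n)) : supp (sqf F) = F := by
  ext i
  simp only [supp, Finset.mem_filter, Finset.mem_univ, true_and]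
  change (0 : ℤ) < (if i ∈ F then 1 else 0) ↔ i ∈ F
  split_ifs with h <;> simp [h]

lemma sqf_supp_le {n : ℕ} {a : Deg n} (ha : 0 ≤ a) : sqf (supp a) ≤ a := by
  intro i
  have h0 : 0 ≤ coord a i := ha i
  change (if i ∈ supp a then (1 : ℤ) else 0) ≤ coord a i
  split_ifs with h
  · simp only [supp, Finset.mem_filter, Finset.mem_univ, true_and] at h
    exact h
  · exact h0

/-- A `ℤⁿ`-graded module over `S = k[x₁, …, xₙ]`: an `S`-module `M` with a decomposition
`M = ⨁_{a ∈ ℤⁿ} M_a` into `k`-subspaces such that `x^b M_a ⊆ M_{a+b}` for all `b ∈ ℕⁿ`. -/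
structure GrMod (k : Type u) [Field k] (n : ℕ) where
  /-- the underlying set -/
  carrier : Type u
  [addCommGroup : AddCommGroup carrier]
  [module : Module (MvPolynomial (Fin n) k) carrier]
  [moduleK : Module k carrier]
  [isScalarTower : IsScalarTower k (MvPolynomial (Fin n) k) carrier]
  /-- the homogeneous components -/
  gr : (Deg n) → Submodule k carrier
  isInternal : DirectSum.IsInternal gr
  smul_mem : ∀ (b : Fin n →₀ ℕ) (a : Deg n) (y : carrier),
    y ∈ gr a → mon k b • y ∈ gr (a + toDeg b)

attribute [instance] GrMod.addCommGroup GrMod.module GrMod.moduleK GrMod.isScalarTower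

namespace GrMod

variable {k : Type u} [Field k] {n : ℕ}

/-- The degree preserving `S`-linear maps `M → N`. -/
def homSubmodule (M N : GrMod k n) :
    Submodule k (M.carrier →ₗ[MvPolynomial (Fin n) k] N.carrier) where
  carrier := {f | ∀ (a : Deg n) (y : M.carrier), y ∈ M.gr a → f y ∈ N.gr a}
  add_mem' hf hg a y hy := add_mem (hf a y hy) (hg a y hy)
  zero_mem' _ _ _ := zero_mem _
  smul_mem' c _ hf a y hy := Submodule.smul_mem _ c (hf a y hy)

/-- The category `*Mod` of `ℤⁿ`-graded `S`-modules and degree preserving `S`-linear maps. -/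
instance : Category (GrMod k n) where
  Hom M N := homSubmodule M N
  id M := ⟨LinearMap.id, fun _ _ h => h⟩
  comp f g := ⟨g.1.comp f.1, fun a y hy => g.2 a _ (f.2 a y hy)⟩

/-- The `S`-linear map underlying a morphism of `*Mod`. -/
def lin {M N : GrMod k n} (f : M ⟶ N) : M.carrier →ₗ[MvPolynomial (Fin n) k] N.carrier := f.1

/-- A degree preserving `S`-linear map, as a morphism of `*Mod`. -/
def mkHom {M N : GrMod k n} (f : M.carrier →ₗ[MvPolynomial (Fin n) k] N.carrier)
    (hf : ∀ a y, y ∈ M.gr a → f y ∈ N.gr a) : M ⟶ N := ⟨f, hf⟩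

lemma lin_mem {M N : GrMod k n} (f : M ⟶ N) {a : Deg n} {y : M.carrier} (hy : y ∈ M.gr a) :
    lin f y ∈ N.gr a := f.2 a y hy

lemma hom_ext {M N : GrMod k n} {f g : M ⟶ N} (h : ∀ y, lin f y = lin g y) : f = g :=
  Subtype.ext (LinearMap.ext h)

@[simp] lemma lin_mkHom {M N : GrMod k n}
    (f : M.carrier →ₗ[MvPolynomial (Fin n) k] N.carrier) (hf) : 
    lin (mkHom (M := M) (N := N) f hf) = f := rfl

@[simp] lemma lin_id (M : GrMod k n) : lin (𝟙 M) = LinearMap.id := rfl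

@[simp] lemma lin_comp {M N L : GrMod k n} (f : M ⟶ N) (g : N ⟶ L) :
    lin (f ≫ g) = (lin g).comp (lin f) := rfl

instance : Preadditive (GrMod k n) where
  homGroup M N := inferInstanceAs (AddCommGroup (homSubmodule M N))
  add_comp _ _ _ f f' g := hom_ext fun y => map_add (lin g) (lin f y) (lin f' y)
  comp_add _ _ _ _ _ _ := rfl

instance : Linear k (GrMod k n) where
  homModule M N := inferInstanceAs (Module k (homSubmodule M N))
  smul_comp _ _ _ r f g := hom_ext fun y =>
    ((lin g).restrictScalars k).map_smul r (lin f y)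
  comp_smul _ _ _ _ _ _ := rfl

@[simp] lemma lin_add {M N : GrMod k n} (f g : M ⟶ N) : lin (f + g) = lin f + lin g := rfl
@[simp] lemma lin_zero {M N : GrMod k n} : lin (0 : M ⟶ N) = 0 := rfl
@[simp] lemma lin_smul {M N : GrMod k n} (c : k) (f : M ⟶ N) : lin (c • f) = c • lin f := rfl

lemma smul_mem' (M : GrMod k n) {a b : Deg n} (h : a ≤ b) {y : M.carrier} (hy : y ∈ M.gr a) :
    mon k (expo a b) • y ∈ M.gr b := by
  have := M.smul_mem (expo a b) a y hy
  rwa [add_toDeg_expo h] at this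

lemma hom_ext_gr {M N : GrMod k n} {f g : M ⟶ N}
    (h : ∀ a, ∀ y ∈ M.gr a, lin f y = lin g y) : f = g := by
  refine hom_ext fun y => ?_
  have hy : y ∈ ⨆ a, M.gr a := by
    rw [M.isInternal.submodule_iSup_eq_top]; trivial
  induction hy using Submodule.iSup_induction' with
  | mem a y hy => exact h a y hy
  | zero => simp
  | add x y _ _ hx hy => rw [map_add, map_add, hx, hy]

lemma exists_hom {M N : GrMod k n} (φ : ∀ c : Deg n, M.gr c →ₗ[k] N.gr c)
    (hφ : ∀ (c : Deg n) (b : Fin n →₀ ℕ) (y : M.gr c),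
      (φ (c + toDeg b) ⟨mon k b • y.1, M.smul_mem b c y.1 y.2⟩).1 = mon k b • (φ c y).1) :
    ∃ f : M ⟶ N, ∀ (c : Deg n) (y : M.gr c), lin f y.1 = (φ c y).1 := by
  let e := LinearEquiv.ofBijective (DirectSum.coeLinearMap M.gr) M.isInternal
  let F : M.carrier →ₗ[k] N.carrier :=
    ((DirectSum.toModule k (Deg n) N.carrier fun c => (N.gr c).subtype.comp (φ c))).comp
      e.symm.toLinearMap
  have hF (c : Deg n) (y : M.gr c) : F y.1 = (φ c y).1 := by
    have : e.symm y.1 = DirectSum.lof k (Deg n) (fun c => M.gr c) c y := by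
      rw [LinearEquiv.symm_apply_eq]
      exact (DirectSum.coeLinearMap_lof M.gr c y).symm
    change DirectSum.toModule k (Deg n) N.carrier _ (e.symm y.1) = _
    rw [this, DirectSum.toModule_lof]
    rfl
  have hmon (b : Fin n →₀ ℕ) (y : M.carrier) : F (mon k b • y) = mon k b • F y := by
    have hy : y ∈ ⨆ a, M.gr a := by
      rw [M.isInternal.submodule_iSup_eq_top]; trivial
    induction hy using Submodule.iSup_induction' with
    | mem c y hy => exact (hF _ ⟨_, M.smul_mem b c y hy⟩).trans ((hφ c b ⟨y, hy⟩).trans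
        (congr_arg _ (hF c ⟨y, hy⟩).symm))
    | zero => simp
    | add x y _ _ hx hy => rw [smul_add, map_add, hx, hy, map_add, smul_add]
  have hsmul (s : MvPolynomial (Fin n) k) (y : M.carrier) : F (s • y) = s • F y := by
    induction s using MvPolynomial.induction_on' with
    | add p q hp hq => rw [add_smul, map_add, hp, hq, add_smul]
    | monomial b c =>
      have hb : MvPolynomial.monomial b c = c • mon k b := by
        rw [MvPolynomial.smul_monomial, smul_eq_mul, mul_one]
      rw [hb, smul_assoc, map_smul, smul_assoc, hmon]
  refine ⟨mkHom { toFun := F, map_add' := map_add F, map_smul' := hsmul } fun c y hy => ?_, hF⟩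
  change F y ∈ N.gr c
  rw [hF c ⟨y, hy⟩]
  exact (φ c ⟨y, hy⟩).2

/-- The shifted module `M(a)`, with `M(a)_b = M_{a+b}`. -/
def twist (a : Deg n) (M : GrMod k n) : GrMod k n where
  carrier := M.carrier
  gr b := M.gr (a + b)
  isInternal := by
    have h := DirectSum.isInternal_submodule_iff_iSupIndep_and_iSup_eq_top M.gr |>.1 M.isInternal
    refine (DirectSum.isInternal_submodule_iff_iSupIndep_and_iSup_eq_top _).2 ⟨?_, ?_⟩
    · exact h.1.comp (add_right_injective a)
    · rw [← h.2]
      exact (Equiv.addLeft a).iSup_comp (g := M.gr)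
  smul_mem b c y hy := by
    have := M.smul_mem b (a + c) y hy
    rwa [add_assoc] at this

/-- The functor `M ↦ M(a)`. -/
def twistFunctor (a : Deg n) : GrMod k n ⥤ GrMod k n where
  obj M := M.twist a
  map {M N} f := mkHom (M := M.twist a) (N := N.twist a) f.1 fun b _ hy => f.2 (a + b) _ hy

instance (a : Deg n) : (twistFunctor (k := k) a).Additive where
  map_add := rfl

/-- For `a ≤ b`, the multiplication `x^{b-a} : M(a) → M(b)`. -/
def twistMul {a b : Deg n} (h : a ≤ b) :
    twistFunctor (k := k) a ⟶ twistFunctor (k := k) b where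
  app M := mkHom (M := M.twist a) (N := M.twist b)
    (LinearMap.lsmul (MvPolynomial (Fin n) k) M.carrier (mon k (expo a b))) fun c y hy => by
      have := M.smul_mem (expo a b) (a + c) y hy
      rwa [add_right_comm, add_toDeg_expo h] at this
  naturality M N f := hom_ext (M := M.twist a) (N := N.twist b) fun y =>
    ((lin f).map_smul (mon k (expo a b)) y).symm

/-- The family of the homogeneous components `M_a` of a graded module, together with
the multiplication maps `x^{b-a} : M_a → M_b` for `a ≤ b`. -/
def components : GrMod k n ⥤ ((Deg n) ⥤ ModuleCat.{u} k) where
  obj M :=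
    { obj a := ModuleCat.of k (M.gr a)
      map {a b} h := ModuleCat.ofHom
        (((Algebra.lsmul k k M.carrier (mon k (expo a b))).restrict
          fun _ hy => M.smul_mem' (leOfHom h) hy : M.gr a →ₗ[k] M.gr b))
      map_id a := by
        ext y
        change mon k (expo a a) • (y : M.carrier) = y
        rw [expo_self]
        exact one_smul _ _
      map_comp {a b c} h h' := by
        ext y
        change mon k (expo a c) • (y : M.carrier) = mon k (expo b c) • mon k (expo a b) • (y : M.carrier)
        rw [smul_smul, MvPolynomial.monomial_mul, add_comm, one_mul,
          expo_add_expo (leOfHom h) (leOfHom h')] }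
  map {M N} f :=
    { app a := ModuleCat.ofHom (((lin f).restrictScalars k).restrict fun _ hy => lin_mem f hy)
      naturality a b h := by
        ext y
        exact (lin f).map_smul (mon k (expo a b)) (y : M.carrier) }

instance : (components (k := k) (n := n)).Additive where
  map_add := rfl

end GrMod

/-- A family of `k`-vector spaces `X_a`, `a ∈ ℤⁿ`, with functorial maps `X_a → X_b` for `a ≤ b`.
These are the data from which graded `S`-modules are assembled by `total`. -/
abbrev Fam (k : Type u) [Field k] (n : ℕ) := Deg n ⥤ ModuleCat.{u} k

namespace Fam

variable {k : Type u} [Field k] {n : ℕ}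

/-- Restriction to the degrees in `ℕⁿ`: `X_a` if `a ∈ ℕⁿ`, and `0` otherwise. -/
def truncSubmodule (X : Fam k n) (a : Deg n) : Submodule k (X.obj a) where
  carrier := {x | 0 ≤ a ∨ x = 0}
  add_mem' := by
    rintro x y (h | rfl) (h' | rfl)
    · exact Or.inl h
    · exact Or.inl h
    · exact Or.inl h'
    · exact Or.inr (add_zero _)
  zero_mem' := Or.inr rfl
  smul_mem' := by
    rintro c x (h | rfl)
    · exact Or.inl h
    · exact Or.inr (smul_zero _)

/-- The `ℕⁿ`-graded part of a family. -/
def trunc : Fam k n ⥤ Fam k n where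
  obj X :=
    { obj a := ModuleCat.of k (X.truncSubmodule a)
      map {a b} h := ModuleCat.ofHom ((X.map h).hom.restrict (p := X.truncSubmodule a)
        (q := X.truncSubmodule b) (by
          rintro x (h' | rfl)
          · exact Or.inl (h'.trans (leOfHom h))
          · exact Or.inr (map_zero _)))
      map_id a := by
        ext x
        change X.map (𝟙 a) x.1 = x.1
        simp
      map_comp f g := by
        ext x
        change X.map (f ≫ g) x.1 = X.map g (X.map f x.1)
        simp }
  map {X Y} f :=
    { app a := ModuleCat.ofHom ((f.app a).hom.restrict (p := X.truncSubmodule a)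
        (q := Y.truncSubmodule a) (by
          rintro x (h' | rfl)
          · exact Or.inl h'
          · exact Or.inr (map_zero _)))
      naturality a b h := by
        ext x
        exact congr($(f.naturality h) x.1) }

instance : (trunc (k := k) (n := n)).Additive where
  map_add := rfl

/-- The underlying space `⨁_a X_a`. -/
abbrev Sum (X : Fam k n) : Type u := DirectSum (Deg n) fun a => X.obj a

/-- The inclusion `X_a → ⨁_a X_a`. -/
abbrev incl (X : Fam k n) (a : Deg n) : X.obj a →ₗ[k] X.Sum :=
  DirectSum.lof k (Deg n) (fun a => X.obj a) a

lemma incl_congr (X : Fam k n) {a b b' : Deg n} (e : b = b') (h : a ⟶ b) (h' : a ⟶ b')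
    (x : X.obj a) : X.incl b (X.map h x) = X.incl b' (X.map h' x) := by
  subst e; rw [Subsingleton.elim h h']

/-- Multiplication by `x^b` on `⨁_a X_a`, given by the maps `X_a → X_{a+b}`. -/
def mulMon (X : Fam k n) (b : Fin n →₀ ℕ) : Module.End k X.Sum :=
  DirectSum.toModule k (Deg n) X.Sum fun a =>
    (X.incl (a + toDeg b)).comp (X.map (homOfLE (le_add_toDeg a b))).hom

lemma mulMon_incl (X : Fam k n) (b : Fin n →₀ ℕ) {a c : Deg n} (e : a + toDeg b = c)
    (h : a ⟶ c) (x : X.obj a) : X.mulMon b (X.incl a x) = X.incl c (X.map h x) := by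
  rw [mulMon, DirectSum.toModule_lof]
  exact X.incl_congr e _ _ x

/-- The action of the monomials on `⨁_a X_a`. -/
def mulMonHom (X : Fam k n) : Multiplicative (Fin n →₀ ℕ) →* Module.End k X.Sum where
  toFun b := X.mulMon b.toAdd
  map_one' := by
    refine DirectSum.linearMap_ext k fun a => LinearMap.ext fun x => ?_
    change X.mulMon 0 (X.incl a x) = X.incl a x
    rw [X.mulMon_incl 0 (by rw [toDeg_zero, add_zero]) (𝟙 a)]
    simp
  map_mul' b c := by
    refine DirectSum.linearMap_ext k fun a => LinearMap.ext fun x => ?_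
    change X.mulMon (b.toAdd + c.toAdd) (X.incl a x) =
      X.mulMon b.toAdd (X.mulMon c.toAdd (X.incl a x))
    have e : a + toDeg (b.toAdd + c.toAdd) = a + toDeg c.toAdd + toDeg b.toAdd := by
      rw [toDeg_add, add_comm (toDeg _), add_assoc]
    rw [X.mulMon_incl c.toAdd rfl (homOfLE (le_add_toDeg a _)),
      X.mulMon_incl b.toAdd rfl (homOfLE (le_add_toDeg _ _)),
      X.mulMon_incl _ e (homOfLE (le_add_toDeg a _) ≫ homOfLE (le_add_toDeg _ _)),
      Functor.map_comp]
    rfl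

/-- The algebra map `S → End_k (⨁_a X_a)`. -/
def action (X : Fam k n) : MvPolynomial (Fin n) k →ₐ[k] Module.End k X.Sum :=
  AddMonoidAlgebra.lift k _ (Fin n →₀ ℕ) X.mulMonHom

lemma action_mon (X : Fam k n) (b : Fin n →₀ ℕ) : X.action (mon k b) = X.mulMon b := by
  have := AddMonoidAlgebra.lift_single (R := k) X.mulMonHom b 1
  rw [one_smul] at this
  exact this

instance (X : Fam k n) : Module (MvPolynomial (Fin n) k) X.Sum :=
  Module.compHom X.Sum X.action.toRingHom

lemma smul_def (X : Fam k n) (s : MvPolynomial (Fin n) k) (y : X.Sum) :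
    s • y = X.action s y := rfl

instance (X : Fam k n) : IsScalarTower k (MvPolynomial (Fin n) k) X.Sum where
  smul_assoc c s y := by
    rw [smul_def, smul_def, map_smul]; rfl

lemma incl_injective (X : Fam k n) (a : Deg n) : Function.Injective (X.incl a) :=
  DirectSum.of_injective (β := fun a => X.obj a) a

lemma mon_smul_incl (X : Fam k n) (b : Fin n →₀ ℕ) {a c : Deg n} (e : a + toDeg b = c)
    (h : a ⟶ c) (x : X.obj a) : mon k b • X.incl a x = X.incl c (X.map h x) := by
  rw [smul_def, action_mon, mulMon_incl X b e h]

/-- The graded `S`-module `⨁_a X_a` with `x^b : X_a → X_{a+b}` the given map. -/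
def totalObj (X : Fam k n) : GrMod k n where
  carrier := X.Sum
  gr a := LinearMap.range (X.incl a)
  isInternal := by
    let e (a : Deg n) : X.obj a ≃ₗ[k] LinearMap.range (X.incl a) :=
      LinearEquiv.ofInjective _ (X.incl_injective a)
    have h : (DirectSum.coeLinearMap fun a => LinearMap.range (X.incl a)).comp
        (DFinsupp.mapRange.linearEquiv e).toLinearMap = LinearMap.id := by
      refine DirectSum.linearMap_ext k fun a => LinearMap.ext fun x => ?_
      change DirectSum.coeLinearMap _ (DFinsupp.mapRange.linearEquiv e (DFinsupp.single a x)) = _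
      rw [DFinsupp.mapRange.linearEquiv_apply, DFinsupp.mapRange_single]
      exact DirectSum.coeLinearMap_lof (fun a => LinearMap.range (X.incl a)) a (e a x)
    have h' : Function.Bijective ((DirectSum.coeLinearMap fun a => LinearMap.range (X.incl a)) ∘
        (DFinsupp.mapRange.linearEquiv e)) := by
      have : ((DirectSum.coeLinearMap fun a => LinearMap.range (X.incl a)) ∘
        (DFinsupp.mapRange.linearEquiv e)) = id := funext fun y => LinearMap.congr_fun h y
      rw [this]
      exact Function.bijective_id
    exact (Function.Bijective.of_comp_iff _ (DFinsupp.mapRange.linearEquiv e).bijective).1 h'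
  smul_mem := by
    rintro b a _ ⟨x, rfl⟩
    rw [X.mon_smul_incl b rfl (homOfLE (le_add_toDeg a b))]
    exact ⟨_, rfl⟩

/-- `totalObj` on morphisms, as a `k`-linear map. -/
def sumMap {X Y : Fam k n} (f : X ⟶ Y) : X.Sum →ₗ[k] Y.Sum :=
  DirectSum.lmap fun a => (f.app a).hom

@[simp] lemma sumMap_incl {X Y : Fam k n} (f : X ⟶ Y) (a : Deg n) (x : X.obj a) :
    sumMap f (X.incl a x) = Y.incl a (f.app a x) :=
  DirectSum.lmap_lof _ _ _

lemma sumMap_smul {X Y : Fam k n} (f : X ⟶ Y) (s : MvPolynomial (Fin n) k) (y : X.Sum) :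
    sumMap f (s • y) = s • sumMap f y := by
  induction s using MvPolynomial.induction_on' with
  | add p q hp hq => rw [add_smul, map_add, hp, hq, add_smul]
  | monomial b c =>
    have hb : MvPolynomial.monomial b c = c • mon k b := by
      rw [MvPolynomial.smul_monomial, smul_eq_mul, mul_one]
    rw [hb, smul_assoc, map_smul, smul_assoc]
    congr 1
    have h : (sumMap f).comp (X.mulMon b) = (Y.mulMon b).comp (sumMap f) := by
      refine DirectSum.linearMap_ext k fun a => LinearMap.ext fun x => ?_
      change sumMap f (X.mulMon b (X.incl a x)) = Y.mulMon b (sumMap f (X.incl a x))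
      rw [X.mulMon_incl b rfl (homOfLE (le_add_toDeg a b)), sumMap_incl, sumMap_incl,
        Y.mulMon_incl b rfl (homOfLE (le_add_toDeg a b))]
      exact congr(Y.incl _ ($(f.naturality (homOfLE (le_add_toDeg a b))) x))
    rw [smul_def, smul_def, action_mon, action_mon]
    exact LinearMap.congr_fun h y

/-- The functor taking a family to the graded `S`-module that it defines. -/
def total : Fam k n ⥤ GrMod k n where
  obj X := X.totalObj
  map {X Y} f := GrMod.mkHom (M := X.totalObj) (N := Y.totalObj)
    { toFun := sumMap f, map_add' := map_add _, map_smul' := sumMap_smul f } (by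
      rintro a _ ⟨x, rfl⟩
      exact ⟨f.app a x, (sumMap_incl f a x).symm⟩)
  map_id X := by
    refine GrMod.hom_ext_gr ?_
    rintro a _ ⟨x, rfl⟩
    exact sumMap_incl _ _ _
  map_comp {X Y Z} f g := by
    refine GrMod.hom_ext_gr ?_
    rintro a _ ⟨x, rfl⟩
    change sumMap (f ≫ g) (X.incl a x) = sumMap g (sumMap f (X.incl a x))
    rw [sumMap_incl, sumMap_incl, sumMap_incl]
    rfl

instance : (total (k := k) (n := n)).Additive where
  map_add {X Y f g} := by
    refine GrMod.hom_ext_gr ?_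
    rintro a _ ⟨x, rfl⟩
    change sumMap (f + g) (X.incl a x) = sumMap f (X.incl a x) + sumMap g (X.incl a x)
    rw [sumMap_incl, sumMap_incl, sumMap_incl, ← map_add]
    rfl

end Fam

section Squarefree

variable (k : Type u) [Field k] (n : ℕ)

/-- A `ℤⁿ`-graded `S`-module `M` is squarefree if `M_a = 0` for `a ∉ ℕⁿ`, `dim_k M_a < ∞` for
`a ∈ ℕⁿ`, and `x^b : M_a → M_{a+b}` is bijective for all `a, b ∈ ℕⁿ` with
`supp₊(a + b) = supp₊(a)`. -/
structure IsSquarefree (M : GrMod k n) : Prop where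
  eq_bot : ∀ a : Deg n, ¬ 0 ≤ a → M.gr a = ⊥
  finite : ∀ a : Deg n, 0 ≤ a → Module.Finite k (M.gr a)
  bijOn : ∀ (a : Deg n) (b : Fin n →₀ ℕ), 0 ≤ a → supp (a + toDeg b) = supp a →
    Set.BijOn (fun y : M.carrier => mon k b • y) (M.gr a) (M.gr (a + toDeg b))

/-- Squarefreeness, as a property of the objects of `*Mod`. -/
def squarefree : ObjectProperty (GrMod k n) := IsSquarefree k n

/-- The category `Sq` of squarefree `S`-modules, a full subcategory of `*Mod`. -/
abbrev Sq : Type (u + 1) := (squarefree k n).FullSubcategory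

end Squarefree

section

variable {k : Type u} [Field k] {n : ℕ}

lemma isSquarefree_total_trunc (X : Fam k n) (hfin : ∀ a, 0 ≤ a → Module.Finite k (X.obj a))
    (hbij : ∀ (a b : Deg n) (h : a ⟶ b), 0 ≤ a → supp b = supp a →
      Function.Bijective (X.map h).hom) :
    IsSquarefree k n ((Fam.trunc ⋙ Fam.total).obj X) where
  eq_bot a ha := by
    rw [eq_bot_iff]
    rintro _ ⟨⟨x, hx⟩, rfl⟩
    obtain rfl : x = 0 := hx.resolve_left ha
    exact map_zero ((Fam.trunc.obj X).incl a)
  finite a ha := by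
    have := hfin a ha
    have : Module.Finite k ((Fam.trunc.obj X).obj a) :=
      inferInstanceAs (Module.Finite k (X.truncSubmodule a))
    exact Module.Finite.range ((Fam.trunc.obj X).incl a)
  bijOn a b ha hab := by
    have hb := hbij a (a + toDeg b) (homOfLE (le_add_toDeg a b)) ha hab
    refine ⟨fun y hy => (Fam.total.obj (Fam.trunc.obj X)).smul_mem b a y hy, ?_, ?_⟩
    · rintro _ ⟨x, rfl⟩ _ ⟨y, rfl⟩ hxy
      have hxy' := hxy
      change mon k b • (Fam.trunc.obj X).incl a x = mon k b • (Fam.trunc.obj X).incl a y at hxy'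
      rw [Fam.mon_smul_incl _ b rfl (homOfLE (le_add_toDeg a b)),
        Fam.mon_smul_incl _ b rfl (homOfLE (le_add_toDeg a b))] at hxy'
      have := congr_arg Subtype.val (Fam.incl_injective _ _ hxy')
      rw [Subtype.ext (hb.1 this)]
    · rintro _ ⟨⟨x, hx⟩, rfl⟩
      obtain ⟨y, rfl⟩ := hb.2 x
      exact ⟨_, ⟨⟨y, Or.inl ha⟩, rfl⟩,
        Fam.mon_smul_incl _ b rfl (homOfLE (le_add_toDeg a b)) _⟩

lemma isZero_total_trunc (X : Fam k n) (h : ∀ a, Subsingleton (X.obj a)) :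
    Limits.IsZero ((Fam.trunc ⋙ Fam.total).obj X) := by
  rw [Limits.IsZero.iff_id_eq_zero]
  refine GrMod.hom_ext_gr ?_
  rintro a _ ⟨⟨x, hx⟩, rfl⟩
  have := h a
  obtain rfl : x = 0 := Subsingleton.elim _ _
  exact map_zero ((Fam.trunc.obj X).incl a)

/-! ### The Alexander duality functor -/

/-- The family `a ↦ Hom_k(X_{[n] ∖ supp₊(a)}, k)`, where `[n] ∖ supp₊(a)` is regarded as a
squarefree vector, with the maps dual to those of `X`. -/
def alexFam : (Fam k n)ᵒᵖ ⥤ Fam k n where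
  obj X :=
    { obj a := ModuleCat.of k (Module.Dual k (X.unop.obj (sqf (supp a)ᶜ)))
      map {a b} h := ModuleCat.ofHom (X.unop.map (homOfLE (sqf_mono
        (Finset.compl_subset_compl.2 (supp_mono (leOfHom h)))))).hom.dualMap
      map_id a := by
        have : homOfLE (sqf_mono (Finset.compl_subset_compl.2 (supp_mono (leOfHom (𝟙 a))))) =
          𝟙 (sqf (supp a)ᶜ : Deg n) := Subsingleton.elim _ _
        rw [this, CategoryTheory.Functor.map_id]
        rfl
      map_comp {a b c} f g := by
        have : homOfLE (sqf_mono (Finset.compl_subset_compl.2 (supp_mono (leOfHom (f ≫ g))))) =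
          homOfLE (sqf_mono (Finset.compl_subset_compl.2 (supp_mono (leOfHom g)))) ≫
          homOfLE (sqf_mono (Finset.compl_subset_compl.2 (supp_mono (leOfHom f)))) :=
            Subsingleton.elim _ _
        rw [this, Functor.map_comp]
        rfl }
  map {X Y} φ :=
    { app a := ModuleCat.ofHom (φ.unop.app (sqf (supp a)ᶜ)).hom.dualMap
      naturality a b h := by
        have := φ.unop.naturality (homOfLE (sqf_mono
          (Finset.compl_subset_compl.2 (supp_mono (leOfHom h)))))
        exact congr(ModuleCat.ofHom (ModuleCat.Hom.hom $this).dualMap).symm }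

instance : (alexFam (k := k) (n := n)).Additive where
  map_add {X Y f g} := by
    ext a φ
    exact LinearMap.ext fun y =>
      map_add (show Module.Dual k (X.unop.obj (sqf (supp a)ᶜ)) from φ) _ _

lemma isSquarefree_alex (M : GrMod k n) (hM : IsSquarefree k n M) :
    IsSquarefree k n ((Fam.trunc ⋙ Fam.total).obj
      (alexFam.obj (Opposite.op (GrMod.components.obj M)))) := by
  refine isSquarefree_total_trunc _ (fun a _ => ?_) (fun a b h _ hab => ?_)
  · have : (0 : Deg n) ≤ sqf (supp a)ᶜ := by
      intro i
      change (0 : ℤ) ≤ if i ∈ (supp a)ᶜ then 1 else 0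
      split_ifs <;> simp
    have := hM.finite _ this
    exact inferInstanceAs (Module.Finite k (Module.Dual k (M.gr (sqf (supp a)ᶜ))))
  · have h1 : sqf (supp a)ᶜ ≤ sqf (supp b)ᶜ := sqf_mono (by rw [hab])
    have h2 : sqf (supp b)ᶜ ≤ sqf (supp a)ᶜ := sqf_mono (by rw [hab])
    let e : (sqf (supp b)ᶜ : Deg n) ≅ sqf (supp a)ᶜ :=
      { hom := homOfLE h2, inv := homOfLE h1 }
    exact (((GrMod.components.obj M).mapIso e).toLinearEquiv.dualMap).bijective

/-- The Alexander duality functor `A : Sq → Sq` (contravariant): `A(M)_a` is the dual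
space of `M_{[n] ∖ supp₊(a)}` for `a ∈ ℕⁿ`, and the multiplication maps of `A(M)` are the
duals of those of `M`. -/
def alex : (Sq k n)ᵒᵖ ⥤ Sq k n :=
  (squarefree k n).lift
    ((squarefree k n).ι.op ⋙ GrMod.components.op ⋙ alexFam ⋙ Fam.trunc ⋙ Fam.total)
    (fun M => isSquarefree_alex M.unop.obj M.unop.property)

lemma alex_map_zero (M N : Sq k n) : (alex (k := k)).map (0 : M ⟶ N).op = 0 := by
  refine InducedCategory.hom_ext ?_
  change (Fam.trunc ⋙ Fam.total).map
    (alexFam.map ((GrMod.components.map (0 : M.obj ⟶ N.obj)).op)) = 0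
  rw [Functor.map_zero]
  change (Fam.trunc ⋙ Fam.total).map (alexFam.map (0 : Opposite.op _ ⟶ Opposite.op _)) = 0
  rw [Functor.map_zero, Functor.map_zero]

end

section Dualizing

variable (k : Type u) [Field k] {n : ℕ}

/-- `α(j, F) = #{i ∈ F | i < j}`. -/
def alpha (j : Fin n) (F : Finset (Fin n)) : ℕ := (F.filter fun i => i < j).card

/-- The sets `F` with `#F = -i` for which `*E(S/P_F)` is nonzero in degree `a`; these are the
`F ⊇ supp₊(a)`. -/
abbrev OmegaIdx (i : ℤ) (a : Deg n) : Type :=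
  {F : Finset (Fin n) // (F.card : ℤ) = -i ∧ supp a ⊆ F}

/-- The homogeneous components of `ω^i = ⨁_{#F = -i} *E(S/P_F)`. The injective hull `*E(S/P_F)` of
`S/P_F` in `*Mod` is `k` in the degrees `a` with `supp₊(a) ⊆ F` and `0` in all others, and
`x^b : *E(S/P_F)_a → *E(S/P_F)_{a+b}` is the identity of `k` whenever both are nonzero. -/
def omegaFam (i : ℤ) : Fam k n where
  obj a := ModuleCat.of k (OmegaIdx i a → k)
  map {a b} h := ModuleCat.ofHom (LinearMap.funLeft k k fun F : OmegaIdx i b =>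
    (⟨F.1, F.2.1, (supp_mono (leOfHom h)).trans F.2.2⟩ : OmegaIdx i a))

/-- The index `G ∪ {j}` for `j ∉ G`. -/
def OmegaIdx.insert {i i' : ℤ} (hi : i + 1 = i') {a : Deg n} (G : OmegaIdx i' a)
    (j : {j : Fin n // j ∉ G.1}) : OmegaIdx i a :=
  ⟨Insert.insert j.1 G.1, by
    rw [Finset.card_insert_of_notMem j.2]
    have := G.2.1
    push_cast
    omega, G.2.2.trans (Finset.subset_insert _ _)⟩

/-- The differential `ω^i → ω^{i+1}` in degree `a`, with components
`(-1)^{α(j,F)} nat : *E(S/P_F) → *E(S/P_{F ∖ {j}})` for `j ∈ F`. -/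
def omegaDLin (i i' : ℤ) (hi : i + 1 = i') (a : Deg n) :
    (OmegaIdx i a → k) →ₗ[k] (OmegaIdx i' a → k) where
  toFun φ G := ∑ j : {j : Fin n // j ∉ G.1},
    (-1 : k) ^ alpha j.1 (Insert.insert j.1 G.1) * φ (OmegaIdx.insert hi G j)
  map_add' φ ψ := by
    funext G
    simp only [Pi.add_apply, mul_add, Finset.sum_add_distrib]
  map_smul' c φ := by
    funext G
    simp only [Pi.smul_apply, smul_eq_mul, Finset.mul_sum, RingHom.id_apply, mul_left_comm]

/-- The differential `ω^i → ω^{i+1}`. -/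
def omegaD (i i' : ℤ) (hi : i + 1 = i') : omegaFam k (n := n) i ⟶ omegaFam k i' where
  app a := ModuleCat.ofHom (omegaDLin k i i' hi a)
  naturality _ _ _ := rfl

lemma alpha_insert {j l : Fin n} {G : Finset (Fin n)} (hl : l ∉ G) :
    alpha j (Insert.insert l G) = alpha j G + if l < j then 1 else 0 := by
  unfold alpha
  rw [Finset.filter_insert]
  split_ifs with h
  · rw [Finset.card_insert_of_notMem (by simp [hl])]
  · rfl

lemma omegaDLin_comp (i i' i'' : ℤ) (h : i + 1 = i') (h' : i' + 1 = i'') (a : Deg n)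
    (φ : OmegaIdx i a → k) : omegaDLin k i' i'' h' a (omegaDLin k i i' h a φ) = 0 := by
  funext G
  simp only [omegaDLin, LinearMap.coe_mk, AddHom.coe_mk, Finset.mul_sum, Pi.zero_apply]
  rw [Finset.sum_sigma' Finset.univ (fun _ => Finset.univ)]
  refine Finset.sum_involution (fun x _ => ⟨⟨x.2.1, fun hx => x.2.2 (Finset.mem_insert_of_mem hx)⟩,
    ⟨x.1.1, fun hx => ?_⟩⟩) ?_ ?_ ?_ ?_
  · rcases Finset.mem_insert.1 hx with hx | hx
    · exact x.2.2 (Finset.mem_insert.2 (Or.inl hx.symm))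
    · exact x.1.2 hx
  · rintro ⟨⟨j, hj⟩, ⟨l, hl⟩⟩ -
    have hl' : l ∉ G.1 := fun hx => hl (Finset.mem_insert_of_mem hx)
    have hlj : l ≠ j := fun e => hl (Finset.mem_insert.2 (Or.inl e))
    have hj' : j ∉ Insert.insert l G.1 := fun hx =>
      (Finset.mem_insert.1 hx).elim (fun e => hlj e.symm) hj
    have e : OmegaIdx.insert h (OmegaIdx.insert h' G ⟨j, hj⟩) ⟨l, hl⟩ =
        OmegaIdx.insert h (OmegaIdx.insert h' G ⟨l, hl'⟩) ⟨j, hj'⟩ :=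
      Subtype.ext (Finset.insert_comm _ _ _)
    dsimp only
    rw [e]
    change (-1 : k) ^ alpha j (Insert.insert j G.1) *
        ((-1) ^ alpha l (Insert.insert l (Insert.insert j G.1)) * _) +
      (-1 : k) ^ alpha l (Insert.insert l G.1) *
        ((-1) ^ alpha j (Insert.insert j (Insert.insert l G.1)) * _) = 0
    rw [alpha_insert hj, alpha_insert (j := l) (l := l) (G := Insert.insert j G.1) hl, alpha_insert (j := l) (l := j) hj,
      alpha_insert (j := l) (l := l) hl', alpha_insert (j := j) (l := j) hj',
      alpha_insert (j := j) (l := l) hl']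
    rcases lt_or_gt_of_ne hlj with hh | hh
    · simp only [lt_irrefl, if_false, hh, if_true, not_lt_of_gt hh, pow_add, pow_zero, pow_one]
      ring
    · have hh' : j < l := hh
      simp only [lt_irrefl, if_false, hh', if_true, not_lt_of_gt hh', pow_add, pow_zero, pow_one]
      ring
  · rintro ⟨⟨j, hj⟩, ⟨l, hl⟩⟩ - - e
    have : l = j := congr_arg (fun x => x.1.1) e
    exact hl (Finset.mem_insert.2 (Or.inl this))
  · intros; exact Finset.mem_univ _
  · intros; rfl

lemma omegaD_comp (i i' i'' : ℤ) (h : i + 1 = i') (h' : i' + 1 = i'') :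
    omegaD k (n := n) i i' h ≫ omegaD k i' i'' h' = 0 := by
  ext a φ : 4
  exact omegaDLin_comp k i i' i'' h h' a φ

/-- The complex of families underlying `ω^•`. -/
def omegaFamComplex : CochainComplex (Fam k n) ℤ where
  X i := omegaFam k i
  d i i' := if h : i + 1 = i' then omegaD k i i' h else 0
  shape i i' h := dif_neg h
  d_comp_d' i i' i'' h h' := by
    rw [dif_pos (show i + 1 = i' from h), dif_pos (show i' + 1 = i'' from h'), omegaD_comp]

variable (n) in
/-- The dualizing complex `ω^• : 0 → ω^{-n} → ⋯ → ω^0 → 0`, i.e. the minimal injective resolution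
of `ω_S[n]` in `*Mod`, where `ω_S = S(-1, …, -1)`. -/
def omega : CochainComplex (GrMod k n) ℤ :=
  (Fam.total.mapHomologicalComplex (ComplexShape.up ℤ)).obj (omegaFamComplex k)

end Dualizing

section Duality

open CochainComplex HomComplex

variable {k : Type u} [Field k] {n : ℕ}

/-- The complex `L(a)`. -/
abbrev twistC (L : CochainComplex (GrMod k n) ℤ) (a : Deg n) : CochainComplex (GrMod k n) ℤ :=
  ((GrMod.twistFunctor a).mapHomologicalComplex (ComplexShape.up ℤ)).obj L

/-- The multiplication `x^{b-a} : L(a) → L(b)`, for `a ≤ b`. -/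
abbrev twistCMul (L : CochainComplex (GrMod k n) ℤ) {a b : Deg n} (h : a ≤ b) :
    twistC L a ⟶ twistC L b :=
  (NatTrans.mapHomologicalComplex (GrMod.twistMul h) (ComplexShape.up ℤ)).app L

lemma twistCMul_refl (L : CochainComplex (GrMod k n) ℤ) (a : Deg n) :
    twistCMul L (le_refl a) = 𝟙 _ := by
  ext i
  refine GrMod.hom_ext fun y => ?_
  change mon k (expo a a) • (show (L.X i).carrier from y) = y
  rw [expo_self]
  exact one_smul (MvPolynomial (Fin n) k) (show (L.X i).carrier from y)

lemma twistCMul_trans (L : CochainComplex (GrMod k n) ℤ) {a b c : Deg n} (h : a ≤ b) (h' : b ≤ c) :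
    twistCMul L (h.trans h') = twistCMul L h ≫ twistCMul L h' := by
  ext i
  refine GrMod.hom_ext fun y => ?_
  change mon k (expo a c) • (show (L.X i).carrier from y) =
    mon k (expo b c) • mon k (expo a b) • (show (L.X i).carrier from y)
  rw [smul_smul, MvPolynomial.monomial_mul, add_comm, one_mul, expo_add_expo h h']

/-- The homogeneous components of `*Hom^t_S(K, L) = ∏_j *Hom_S(K^j, L^{j+t})` for complexes of graded
modules: the component of degree `a` is `∏_j Hom_{*Mod}(K^j, L^{j+t}(a))`. -/
def homFam (K L : CochainComplex (GrMod k n) ℤ) (t : ℤ) : Fam k n where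
  obj a := ModuleCat.of k (Cochain K (twistC L a) t)
  map {a b} h := ModuleCat.ofHom
    { toFun z := z.comp (Cochain.ofHom (twistCMul L (leOfHom h))) (add_zero t)
      map_add' z z' := Cochain.add_comp _ _ _ _
      map_smul' c z := Cochain.smul_comp _ _ _ _ }
  map_id a := by
    ext z : 2
    change z.comp (Cochain.ofHom (twistCMul L (le_refl a))) (add_zero t) = z
    rw [twistCMul_refl, Cochain.comp_id]
  map_comp {a b c} h h' := by
    ext z : 2
    change z.comp (Cochain.ofHom (twistCMul L ((leOfHom h).trans (leOfHom h')))) (add_zero t) =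
      (z.comp (Cochain.ofHom (twistCMul L (leOfHom h))) (add_zero t)).comp
        (Cochain.ofHom (twistCMul L (leOfHom h'))) (add_zero t)
    rw [twistCMul_trans, Cochain.ofHom_comp, Cochain.comp_assoc_of_third_is_zero_cochain]

/-- The complex `*Hom^•_S(K, L)`, in terms of homogeneous components. -/
def homComplex (K L : CochainComplex (GrMod k n) ℤ) : CochainComplex (Fam k n) ℤ where
  X t := homFam K L t
  d t t' :=
    { app a := ModuleCat.ofHom (δ_hom k K (twistC L a) t t')
      naturality a b h := by
        ext z : 2
        exact δ_comp_ofHom z (twistCMul L (leOfHom h)) t' }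
  shape t t' h := by
    ext a z : 4
    exact δ_shape t t' h z
  d_comp_d' t t' t'' _ _ := by
    ext a z : 4
    exact δ_δ t t' t'' z

/-- The contravariant functor `K ↦ *Hom^•_S(K, L)`. -/
def homComplexFunctor (L : CochainComplex (GrMod k n) ℤ) :
    (CochainComplex (GrMod k n) ℤ)ᵒᵖ ⥤ CochainComplex (Fam k n) ℤ where
  obj K := homComplex K.unop L
  map {K K'} f :=
    { f t :=
        { app a := ModuleCat.ofHom
            { toFun z := (Cochain.ofHom f.unop).comp z (zero_add t)
              map_add' z z' := Cochain.comp_add _ _ _ _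
              map_smul' c z := Cochain.comp_smul _ _ _ _ }
          naturality a b h := by
            ext z : 2
            exact (Cochain.comp_assoc_of_third_is_zero_cochain (Cochain.ofHom f.unop)
              (show Cochain K.unop (twistC L a) t from z)
              (Cochain.ofHom (twistCMul L (leOfHom h))) (zero_add t)).symm }
      comm' t t' _ := by
        ext a z : 4
        exact δ_ofHom_comp f.unop z t' }
  map_id K := by
    ext t a z : 5
    exact Cochain.id_comp (F := K.unop) (G := twistC L a) (n := t) z
  map_comp f g := by
    ext t a z : 5
    change Cochain _ (twistC L a) t at z
    change (Cochain.ofHom (g.unop ≫ f.unop)).comp z (zero_add t) =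
      (Cochain.ofHom g.unop).comp ((Cochain.ofHom f.unop).comp z (zero_add t)) (zero_add t)
    rw [Cochain.ofHom_comp, Cochain.comp_assoc_of_first_is_zero_cochain]

/-- The contravariant functor `K ↦ 𝒩(*Hom^•_S(K, ω^•))` on complexes of graded modules, where `𝒩`
denotes the `ℕⁿ`-graded part. -/
def dualGr : (CochainComplex (GrMod k n) ℤ)ᵒᵖ ⥤ CochainComplex (GrMod k n) ℤ :=
  homComplexFunctor (omega k n) ⋙
    (Fam.trunc ⋙ Fam.total).mapHomologicalComplex (ComplexShape.up ℤ)

end Duality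

section Derived

open CochainComplex HomComplex Limits

variable (k : Type u) [Field k] (n : ℕ)

/-- Boundedness of a complex of squarefree modules. -/
def bounded : ObjectProperty (CochainComplex (Sq k n) ℤ) :=
  fun K => ∃ p q : ℤ, K.IsStrictlyGE p ∧ K.IsStrictlyLE q

/-- The category `Com^b(Sq)` of bounded cochain complexes of squarefree modules. -/
abbrev ComB : Type (u + 1) := (bounded k n).FullSubcategory

instance : (bounded k n).IsStableUnderShift ℤ where
  isStableUnderShiftBy m :=
    { le_shift := by
        rintro K ⟨p, q, hp, hq⟩
        exact ⟨p - m, q - m, K.isStrictlyGE_shift p m (p - m) (by lia),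
          K.isStrictlyLE_shift q m (q - m) (by lia)⟩ }

/-- The functor `M ↦ M_a` on squarefree modules. -/
def strand (a : Deg n) : Sq k n ⥤ ModuleCat.{u} k :=
  (squarefree k n).ι ⋙ GrMod.components ⋙ (evaluation (Deg n) (ModuleCat.{u} k)).obj a

instance (a : Deg n) : (strand k n a).Additive where
  map_add := rfl

/-- The quasi-isomorphisms of `Com^b(Sq)`: the morphisms `K → L` inducing isomorphisms
`H^i(K)_a = H^i(K_a) → H^i(L_a) = H^i(L)_a` for all `i ∈ ℤ` and all degrees `a ∈ ℤⁿ`. -/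
def qis : MorphismProperty (ComB k n) := fun _ _ f =>
  ∀ a : Deg n, QuasiIso (((strand k n a).mapHomologicalComplex (ComplexShape.up ℤ)).map f.hom)

instance : (qis k n).IsCompatibleWithShift ℤ where
  condition m := by
    ext K L f
    refine forall_congr' fun a => ?_
    let F := (strand k n a).mapHomologicalComplex (ComplexShape.up ℤ)
    let e := ((bounded k n).ι ⋙ F).commShiftIso m
    have e' : Arrow.mk (F.map ((CategoryTheory.shiftFunctor (ComB k n) m).map f).hom) ≅
        Arrow.mk ((CategoryTheory.shiftFunctor (CochainComplex (ModuleCat k) ℤ) m).map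
          (F.map f.hom)) :=
      Arrow.isoMk (e.app K) (e.app L) (e.hom.naturality f).symm
    exact (quasiIso_iff_of_arrow_mk_iso _ _ e').trans (CochainComplex.quasiIso_shift_iff _ _)

/-- The bounded derived category `D^b(Sq)`: the localization of `Com^b(Sq)` with respect to
the quasi-isomorphisms. It carries the translation functors `M ↦ M[p]`. -/
abbrev Db : Type (u + 1) := (qis k n).Localization

variable {k n}

lemma isZero_of_ι {P : ObjectProperty (GrMod k n)} {M : P.FullSubcategory} (h : IsZero M.obj) :
    IsZero M := by
  rw [IsZero.iff_id_eq_zero] at h ⊢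
  exact InducedCategory.hom_ext h

lemma isZero_alex {M : Sq k n} (h : IsZero M) : IsZero (alex.obj (Opposite.op M)) := by
  have h0 : 𝟙 M = 0 := (IsZero.iff_id_eq_zero M).1 h
  refine isZero_of_ι (isZero_total_trunc _ fun a => ?_)
  have : ∀ y : M.obj.gr (sqf (supp a)ᶜ), y = 0 := fun y => by
    have := congr_arg (fun f : M ⟶ M => GrMod.lin f.hom y.1) h0
    exact Subtype.ext this
  refine ⟨fun f g => LinearMap.ext fun y => ?_⟩
  exact (congr_arg (show Module.Dual k (M.obj.gr (sqf (supp a)ᶜ)) from f) (this y)).trans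
    ((map_zero _).trans ((map_zero _).symm.trans
      (congr_arg (show Module.Dual k (M.obj.gr (sqf (supp a)ᶜ)) from g) (this y).symm)))

/-- The Alexander duality functor on complexes of squarefree modules: `A(K)^i = A(K^{-i})`, with
differential `A(K^{-i}) → A(K^{-i-1})` induced by that of `K`. -/
def alexC : (CochainComplex (Sq k n) ℤ)ᵒᵖ ⥤ CochainComplex (Sq k n) ℤ where
  obj K :=
    { X i := alex.obj (Opposite.op (K.unop.X (-i)))
      d i j := alex.map (K.unop.d (-j) (-i)).op
      shape i j h := by
        have : ¬ (ComplexShape.up ℤ).Rel (-j) (-i) := fun h' => h (by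
          have h' : -j + 1 = -i := h'
          change i + 1 = j
          lia)
        rw [K.unop.shape _ _ this]
        exact alex_map_zero _ _
      d_comp_d' i j l _ _ := by
        rw [← Functor.map_comp, ← op_comp, K.unop.d_comp_d]
        exact alex_map_zero _ _ }
  map f :=
    { f i := alex.map (f.unop.f (-i)).op
      comm' i j _ := by
        rw [← Functor.map_comp, ← Functor.map_comp, ← op_comp, ← op_comp, f.unop.comm] }
  map_id K := by
    ext i : 1
    exact alex.map_id _
  map_comp f g := by
    ext i : 1
    exact alex.map_comp _ _

lemma bounded_alexC (K : ComB k n) : bounded k n (alexC.obj (Opposite.op K.obj)) := by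
  obtain ⟨p, q, hp, hq⟩ := K.property
  refine ⟨-q, -p, ?_, ?_⟩
  · rw [isStrictlyGE_iff]
    intro i hi
    exact isZero_alex (K.obj.isZero_of_isStrictlyLE q (-i) (by lia))
  · rw [isStrictlyLE_iff]
    intro i hi
    exact isZero_alex (K.obj.isZero_of_isStrictlyGE p (-i) (by lia))

variable (k n) in
/-- The Alexander duality functor `A` on `Com^b(Sq)`. -/
def alexB : (ComB k n)ᵒᵖ ⥤ ComB k n :=
  (bounded k n).lift ((bounded k n).ι.op ⋙ alexC) fun K => bounded_alexC K.unop

variable (k n) in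
/-- The inclusion of `Com^b(Sq)` into the category of complexes of graded modules. -/
def inclB : ComB k n ⥤ CochainComplex (GrMod k n) ℤ :=
  (bounded k n).ι ⋙ (squarefree k n).ι.mapHomologicalComplex (ComplexShape.up ℤ)

lemma finite_omega_gr (i : ℤ) (b : Deg n) : Module.Finite k (((omega k n).X i).gr b) := by
  have : Module.Finite k ((omegaFam k (n := n) i).obj b) :=
    inferInstanceAs (Module.Finite k (OmegaIdx i b → k))
  exact Module.Finite.range ((omegaFam k i).incl b)

lemma finite_hom {M N : GrMod k n} (hM : IsSquarefree k n M)
    (hN : ∀ b, Module.Finite k (N.gr b)) : Module.Finite k (M ⟶ N) := by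
  let Φ : (M ⟶ N) →ₗ[k] ((F : Finset (Fin n)) → (M.gr (sqf F) →ₗ[k] N.gr (sqf F))) :=
    { toFun f F := ((GrMod.lin f).restrictScalars k).restrict fun _ hy => GrMod.lin_mem f hy
      map_add' _ _ := rfl
      map_smul' _ _ := rfl }
  have (F : Finset (Fin n)) : Module.Finite k (M.gr (sqf F)) := hM.finite _ (sqf_nonneg F)
  refine Module.Finite.of_injective Φ fun f g hfg => GrMod.hom_ext_gr fun a y hy => ?_
  by_cases ha : 0 ≤ a
  · obtain ⟨z, hz, rfl⟩ := (hM.bijOn (sqf (supp a)) (expo (sqf (supp a)) a) (sqf_nonneg _)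
      (by rw [add_toDeg_expo (sqf_supp_le ha), supp_sqf])).2.2
      (show y ∈ M.gr _ by rwa [add_toDeg_expo (sqf_supp_le ha)])
    have := congr_arg (fun h => ((h (supp a)) ⟨z, hz⟩).1) hfg
    change GrMod.lin f z = GrMod.lin g z at this
    dsimp only
    rw [map_smul, map_smul, this]
  · rw [hM.eq_bot a ha] at hy
    rw [(Submodule.mem_bot k).1 hy, map_zero, map_zero]

lemma finite_cochain (K : ComB k n) (L : CochainComplex (GrMod k n) ℤ)
    (hL : ∀ i b, Module.Finite k ((L.X i).gr b)) (t : ℤ) :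
    Module.Finite k (Cochain ((inclB k n).obj K) L t) := by
  obtain ⟨p, q, hp, hq⟩ := K.property
  let Φ : Cochain ((inclB k n).obj K) L t →ₗ[k]
      ((i : Set.Icc p q) → (((inclB k n).obj K).X i.1 ⟶ L.X (i.1 + t))) :=
    { toFun z i := z.v i.1 _ rfl
      map_add' _ _ := rfl
      map_smul' _ _ := rfl }
  have (i : Set.Icc p q) : Module.Finite k (((inclB k n).obj K).X i.1 ⟶ L.X (i.1 + t)) :=
    finite_hom (K.obj.X i.1).property (hL _)
  refine Module.Finite.of_injective Φ fun z z' h => ?_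
  ext i j rfl : 1
  by_cases hi : i ∈ Set.Icc p q
  · exact congr_fun h ⟨i, hi⟩
  · have h0 : IsZero (K.obj.X i) := by
      by_cases hi' : i < p
      · exact K.obj.isZero_of_isStrictlyGE p i hi'
      · exact K.obj.isZero_of_isStrictlyLE q i (by
          by_contra hc
          exact hi ⟨by lia, by lia⟩)
    exact ((squarefree k n).ι.map_isZero h0).eq_of_src _ _

lemma supp_add_right {a b : Deg n} (hab : supp b = supp a) (ha : 0 ≤ a) (hb : a ≤ b) {c : Deg n}
    (hc : 0 ≤ c) : supp (b + c) = supp (a + c) := by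
  ext i
  have h1 := Finset.ext_iff.1 hab i
  simp only [supp, Finset.mem_filter, Finset.mem_univ, true_and] at h1 ⊢
  have h2 : 0 ≤ coord a i := ha i
  have h3 : coord a i ≤ coord b i := hb i
  have h4 : 0 ≤ coord c i := hc i
  change 0 < coord b i + coord c i ↔ 0 < coord a i + coord c i
  lia

lemma expo_add_right {a b : Deg n} (c : Deg n) : expo (a + c) (b + c) = expo a b := by
  ext i
  change ((b i + c i : ℤ) - (a i + c i)).toNat = (b i - a i : ℤ).toNat
  congr 1
  ring

lemma bijOn_omega (q : ℤ) {a b : Deg n} (hab : supp b = supp a) (ha : 0 ≤ a) (hb : a ≤ b)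
    {c : Deg n} (hc : 0 ≤ c) :
    Set.BijOn (fun y : ((omega k n).X q).carrier => mon k (expo a b) • y)
      (((omega k n).X q).gr (a + c)) (((omega k n).X q).gr (b + c)) := by
  have hle : a + c ≤ b + c := fun i => add_le_add_left (hb i) (c i)
  have hs := supp_add_right hab ha hb hc
  have e : a + c + toDeg (expo a b) = b + c := by
    rw [← expo_add_right c, add_toDeg_expo hle]
  have hbij : Function.Bijective ((omegaFam k q).map (homOfLE hle)).hom := by
    let σ : OmegaIdx q (b + c) ≃ OmegaIdx q (a + c) :=
      Equiv.subtypeEquivRight fun F => by rw [hs]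
    exact (LinearEquiv.funCongrLeft k k σ).bijective
  refine ⟨fun y hy => ?_, ?_, ?_⟩
  · have := ((omega k n).X q).smul_mem' hle hy
    rwa [expo_add_right] at this
  · rintro _ ⟨x, rfl⟩ _ ⟨y, rfl⟩ hxy
    have hxy' := (Fam.mon_smul_incl (omegaFam k q) _ e (homOfLE hle) x).symm.trans
      (hxy.trans (Fam.mon_smul_incl (omegaFam k q) _ e (homOfLE hle) y))
    exact congr_arg _ (hbij.1 (Fam.incl_injective _ _ hxy'))
  · rintro _ ⟨x, rfl⟩
    obtain ⟨y, rfl⟩ := hbij.2 x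
    exact ⟨_, ⟨y, rfl⟩, Fam.mon_smul_incl _ _ e (homOfLE hle) y⟩

lemma bijective_comp_mul {M N : GrMod k n} (hM : IsSquarefree k n M) {a b : Deg n} (hb : a ≤ b)
    (hN : ∀ c : Deg n, 0 ≤ c → Set.BijOn (fun y : N.carrier => mon k (expo a b) • y)
      (N.gr (a + c)) (N.gr (b + c))) :
    Function.Bijective (fun f : M ⟶ N.twist a => f ≫ (GrMod.twistMul hb).app N) := by
  constructor
  · intro f g hfg
    refine GrMod.hom_ext_gr fun c y hy => ?_
    by_cases hc : 0 ≤ c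
    · exact (hN c hc).2.1 (GrMod.lin_mem f hy) (GrMod.lin_mem g hy)
        (congr_arg (fun h : M ⟶ N.twist b => GrMod.lin h y) hfg)
    · rw [hM.eq_bot c hc] at hy
      rw [(Submodule.mem_bot k).1 hy, map_zero, map_zero]
  · intro g
    have hex (c : Deg n) (y : M.gr c) : ∃ z : N.gr (a + c),
        mon k (expo a b) • z.1 = (GrMod.lin g y.1 : N.carrier) ∧ (¬ 0 ≤ c → z = 0) := by
      by_cases hc : 0 ≤ c
      · obtain ⟨z, hz, e⟩ := (hN c hc).2.2 (GrMod.lin_mem g y.2)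
        exact ⟨⟨z, hz⟩, e, fun h => absurd hc h⟩
      · refine ⟨0, ?_, fun _ => rfl⟩
        have hy : y.1 = 0 := (Submodule.mem_bot k).1 ((hM.eq_bot c hc).le y.2)
        rw [hy]
        exact (smul_zero _).trans (map_zero (GrMod.lin g)).symm
    choose φ hφ hφ0 using hex
    have huniq (c : Deg n) (z z' : N.carrier) (hz : z ∈ N.gr (a + c)) (hz' : z' ∈ N.gr (a + c))
        (h0 : ¬ 0 ≤ c → z = z')
        (h : mon k (expo a b) • z = mon k (expo a b) • z') : z = z' := by
      by_cases hc : 0 ≤ c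
      · exact (hN c hc).2.1 hz hz' h
      · exact h0 hc
    let Φ (c : Deg n) : M.gr c →ₗ[k] (N.twist a).gr c :=
      { toFun := φ c
        map_add' y z := Subtype.ext (huniq c _ _ (φ c (y + z)).2 (φ c y + φ c z).2
          (fun hc => congr_arg Subtype.val (by rw [hφ0 c _ hc, hφ0 c _ hc, hφ0 c _ hc, add_zero] :
            φ c (y + z) = φ c y + φ c z))
          (by
            change _ = mon k (expo a b) • ((φ c y).1 + (φ c z).1)
            rw [smul_add, hφ, hφ, hφ]
            exact map_add (GrMod.lin g) y.1 z.1))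
        map_smul' r y := Subtype.ext (huniq c _ _ (φ c (r • y)).2 (r • φ c y).2
          (fun hc => congr_arg Subtype.val (by rw [hφ0 c _ hc, hφ0 c _ hc, smul_zero] :
            φ c (r • y) = r • φ c y))
          (by
            change _ = mon k (expo a b) • (r • (φ c y).1)
            rw [smul_comm, hφ, hφ]
            exact ((GrMod.lin g).restrictScalars k).map_smul r y.1)) }
    obtain ⟨f, hf⟩ := GrMod.exists_hom (N := N.twist a) Φ (fun c d y => by
      refine huniq (c + toDeg d) _ _ (φ _ _).2 ?_ (fun hc => ?_) ?_
      · have := N.smul_mem d _ _ (φ c y).2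
        rwa [add_assoc] at this
      · have h2 : ¬ 0 ≤ c := fun h => hc (h.trans (le_add_toDeg c d))
        change ((φ _ _).1 : N.carrier) = mon k d • (φ c y).1
        rw [hφ0 _ _ hc, hφ0 _ _ h2]
        exact (smul_zero (mon k d)).symm
      · change mon k (expo a b) • (φ _ _).1 = mon k (expo a b) • mon k d • (φ c y).1
        rw [hφ, smul_comm, hφ]
        exact (GrMod.lin g).map_smul (mon k d) y.1)
    refine ⟨f, GrMod.hom_ext_gr fun c y hy => ?_⟩
    have := hf c ⟨y, hy⟩
    change mon k (expo a b) • (GrMod.lin f y : N.carrier) = _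
    rw [this]
    exact hφ c ⟨y, hy⟩

lemma bijective_homFam (K : ComB k n) (t : ℤ) {a b : Deg n} (h : a ⟶ b) (ha : 0 ≤ a)
    (hab : supp b = supp a) :
    Function.Bijective ((homFam ((inclB k n).obj K) (omega k n) t).map h).hom := by
  have hbij (p q : ℤ) := bijective_comp_mul (K.obj.X p).property (N := (omega k n).X q) (leOfHom h)
    fun c hc => bijOn_omega q hab ha (leOfHom h) hc
  have hv (z : Cochain ((inclB k n).obj K) (twistC (omega k n) a) t) (p q : ℤ) (hpq : p + t = q) :
      (z.comp (Cochain.ofHom (twistCMul (omega k n) (leOfHom h))) (add_zero t)).v p q hpq =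
        z.v p q hpq ≫ (GrMod.twistMul (leOfHom h)).app ((omega k n).X q) := by
    rw [Cochain.comp_zero_cochain_v, Cochain.ofHom_v]
    rfl
  constructor
  · intro z z' hzz'
    refine Cochain.ext _ _ fun p q hpq => (hbij p q).1 ?_
    have := Cochain.congr_v hzz' p q hpq
    exact (hv z p q hpq).symm.trans (this.trans (hv z' p q hpq))
  · intro w
    change Cochain ((inclB k n).obj K) (twistC (omega k n) b) t at w
    choose f hf using fun p q (hpq : p + t = q) => (hbij p q).2 (w.v p q hpq)
    refine ⟨Cochain.mk f, Cochain.ext _ _ fun p q hpq => ?_⟩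
    exact (hv (Cochain.mk f) p q hpq).trans (hf p q hpq)

lemma isSquarefree_dual (K : ComB k n) (t : ℤ) :
    squarefree k n ((dualGr.obj (Opposite.op ((inclB k n).obj K))).X t) :=
  isSquarefree_total_trunc _
    (fun a _ => finite_cochain K (twistC (omega k n) a) (fun i b => finite_omega_gr i (a + b)) t)
    (fun _ _ h ha hab => bijective_homFam K t h ha hab)

/-- The functor `K ↦ 𝒩(*Hom^•_S(K, ω^•))` from `Com^b(Sq)` to complexes of squarefree modules. -/
def dualC : (ComB k n)ᵒᵖ ⥤ CochainComplex (Sq k n) ℤ :=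
  HomologicalComplex.liftFunctorObjectProperty (squarefree k n) ((inclB k n).op ⋙ dualGr)
    fun K => isSquarefree_dual K.unop

lemma isZero_dualC (K : ComB k n) (t : ℤ)
    (h : ∀ p, IsZero (K.obj.X p) ∨ 0 < p + t ∨ p + t < -n) :
    IsZero ((dualC.obj (Opposite.op K)).X t) := by
  refine isZero_of_ι (isZero_total_trunc _ fun a => ⟨fun z z' => ?_⟩)
  refine Cochain.ext (F := (inclB k n).obj K) (G := twistC (omega k n) a) z z' fun p q hpq => ?_
  rcases h p with h | h
  · exact ((squarefree k n).ι.map_isZero h).eq_of_src _ _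
  · have h0 : ∀ y : ((omega k n).X q).carrier, y = 0 := by
      have (b : Deg n) : Subsingleton ((omegaFam k (n := n) q).obj b) := by
        have : IsEmpty (OmegaIdx q b) := ⟨fun F => by
          have h1 := F.2.1
          have h2 := Finset.card_le_univ F.1
          rw [Fintype.card_fin] at h2
          lia⟩
        exact inferInstanceAs (Subsingleton (OmegaIdx q b → k))
      intro y
      exact DFinsupp.ext fun b => (this b).elim _ _
    exact GrMod.hom_ext fun y => (h0 _).trans (h0 _).symm

lemma bounded_dualC (K : ComB k n) : bounded k n (dualC.obj (Opposite.op K)) := by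
  obtain ⟨p, q, hp, hq⟩ := K.property
  refine ⟨-n - q, -p, ?_, ?_⟩
  · rw [isStrictlyGE_iff]
    refine fun t ht => isZero_dualC K t fun i => ?_
    by_cases hi : q < i
    · exact Or.inl (K.obj.isZero_of_isStrictlyLE q i hi)
    · exact Or.inr (Or.inr (by lia))
  · rw [isStrictlyLE_iff]
    refine fun t ht => isZero_dualC K t fun i => ?_
    by_cases hi : i < p
    · exact Or.inl (K.obj.isZero_of_isStrictlyGE p i hi)
    · exact Or.inr (Or.inl (by lia))

variable (k n) in
/-- The duality functor `D : K ↦ 𝒩(*Hom^•_S(K, ω^•))` on `Com^b(Sq)`. -/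
def dualB : (ComB k n)ᵒᵖ ⥤ ComB k n := (bounded k n).lift dualC fun K => bounded_dualC K.unop

/-- The contravariant functor `F` on `Com^b(Sq)` preserves quasi-isomorphisms. -/
def PreservesQis (F : (ComB k n)ᵒᵖ ⥤ ComB k n) : Prop :=
  ∀ ⦃K L : ComB k n⦄ (f : K ⟶ L), qis k n f → qis k n (F.map f.op)

/-- The contravariant functor on `D^b(Sq)` induced by a contravariant functor on `Com^b(Sq)` that
preserves quasi-isomorphisms. -/
def derive (F : (ComB k n)ᵒᵖ ⥤ ComB k n) (hF : PreservesQis F) : (Db k n)ᵒᵖ ⥤ Db k n :=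
  (Localization.Construction.lift (F.rightOp ⋙ (qis k n).Q.op) fun K L f hf => by
    have := Localization.inverts (qis k n).Q (qis k n) _ (hF f hf)
    exact inferInstanceAs (IsIso ((qis k n).Q.map (F.map f.op)).op)).leftOp

/-- The covariant functor `D ∘ A` on `D^b(Sq)`. -/
def derivedDA (hA : PreservesQis (alexB k n)) (hD : PreservesQis (dualB k n)) : Db k n ⥤ Db k n :=
  (derive (alexB k n) hA).rightOp ⋙ derive (dualB k n) hD

end Derived

end SquarefreeModules

end

/-! A squarefree module is determined by its components M_F, F ⊆ [n], and the multiplications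
between them. So bounded complexes of squarefree modules embed fully faithfully into complexes of
cubes F ↦ X_F of vector spaces (`cubes`), and quasi-isomorphisms are detected at the vertices F
(`qis_iff`).

A degree-preserving map from a squarefree M to *E(S/P_G)(F) is a functional on M_G if F ⊆ G. Hence
D(L)^t_F is the product of the duals of L^p_G over G ⊇ F with p = -t - #G. Alexander duality
replaces the vertex G by its complement and dualizes, and finite dimension removes the double dual.
So D ∘ A becomes the functor `psi` with (psi X)^t_F = ∏ X_H^{t+n-#H} over the sets H disjoint from
F; its differential is the differential of X plus a Koszul sum of the maps X_{H∖j} → X_H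
(`modelIso`).

The threefold iterate is a product of spaces X_{H₁}^q over triples with H₃ ∩ F = H₂ ∩ H₃ = H₁ ∩ H₂ =
∅. Fix H₁ and H₃ ∖ H₁. Then a position outside H₁ ∪ H₃ is free to lie in H₂ or not, and a position
of H₁ ∖ F is free to lie in H₃ or not. The part of the differential that occupies free positions is
a Koszul complex with identity maps, hence acyclic as soon as a free position exists. No position is
free only for H₁ = F, H₃ = Fᶜ, H₂ = ∅, and there q = t + 2n. So only X[2n] survives.

The comparison is the map `eta` from X[2n] to psi³ X, with components ± (X_F → X_K) at the triples
(Kᶜ, ∅, K), K ⊇ F; `d_etaTri` checks its signs. Toggling the smallest free position, the pivot,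
gives a contraction `Tri.σ` onto the surviving component, up to terms of higher `rank`
(`homotopy_step`). Finiteness of the rank filtration then makes `eta` a quasi-isomorphism
(`coneExact_of_filtration`, `quasiIso_eta`).

That A and D preserve quasi-isomorphisms is also proved on mapping cones, by elements
(`quasiIso_iff_coneExact`). For A this is exactness of the k-dual (`ConeExact.exists_dual`). For D
the coordinates are filtered by #G, each layer being dual to the vertices L_G, and a preimage is
built layer by layer (`exists_dual_of_vanishing`). Finally `eta` is pulled back along `cubes` to a
natural map K[2n] → (D ∘ A)³(K), which becomes invertible in the localization. -/

noncomputable section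

namespace SquarefreeModules

/-! ### Exactness of mapping cones in terms of elements -/

section ConeExact

variable {k : Type u} [Field k]

/-- Exactness of the mapping cone of `f : X → Y` in terms of elements. -/
def ConeExact {X Y : ℤ → Type u} [∀ i, AddCommGroup (X i)] [∀ i, Module k (X i)]
    [∀ i, AddCommGroup (Y i)] [∀ i, Module k (Y i)] (dX : ∀ i j, X i →ₗ[k] X j)
    (dY : ∀ i j, Y i →ₗ[k] Y j) (f : ∀ i, X i →ₗ[k] Y i) : Prop :=
  ∀ h i j l : ℤ, h + 1 = i → i + 1 = j → j + 1 = l → ∀ (x : X j) (y : Y i),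
    dX j l x = 0 → f j x = dY i j y → ∃ (x' : X i) (y' : Y h), dX i j x' = x ∧ f i x' + dY h i y' = y

lemma f_d_apply {X Y : CochainComplex (ModuleCat.{u} k) ℤ} (f : X ⟶ Y) (i j : ℤ) (x : X.X i) :
    f.f j (X.d i j x) = Y.d i j (f.f i x) :=
  congr($(f.comm i j) x).symm

/-- The two conditions are injectivity and surjectivity of the map induced on cocycles modulo
coboundaries. -/
lemma quasiIsoAt_iff_elements {X Y : CochainComplex (ModuleCat.{u} k) ℤ} (f : X ⟶ Y) {h i j : ℤ}
    (hi : h + 1 = i) (hj : i + 1 = j) :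
    QuasiIsoAt f i ↔
      (∀ (x : X.X i) (y : Y.X h), X.d i j x = 0 → f.f i x = Y.d h i y → ∃ x', X.d h i x' = x) ∧
      (∀ y : Y.X i, Y.d i j y = 0 → ∃ (x : X.X i) (y' : Y.X h), X.d i j x = 0 ∧
        f.f i x + Y.d h i y' = y) := by
  rw [quasiIsoAt_iff' f h i j (by simp; lia) (by simp; lia)]
  let φ := (HomologicalComplex.shortComplexFunctor' (ModuleCat.{u} k) (ComplexShape.up ℤ) h i j).map f
  let γ : ShortComplex.LeftHomologyMapData φ (X.sc' h i j).moduleCatLeftHomologyData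
    (Y.sc' h i j).moduleCatLeftHomologyData := default
  change ShortComplex.QuasiIso φ ↔ _
  rw [γ.quasiIso_iff, ConcreteCategory.isIso_iff_bijective]
  have hi (x) : ((γ.φK x).1 : Y.X i) = f.f i x.1 := congr($(γ.commi) x)
  have hπ (x) : γ.φH (Submodule.Quotient.mk x) = Submodule.Quotient.mk (γ.φK x) :=
    congr($(γ.commπ) x)
  refine and_congr ?_ ?_
  · refine (injective_iff_map_eq_zero γ.φH.hom).trans ⟨?_, ?_⟩
    · intro H x y hx hy
      have := H (Submodule.Quotient.mk ⟨x, hx⟩) ((hπ _).trans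
        ((Submodule.Quotient.mk_eq_zero _).2 ⟨y, Subtype.ext ((hi _).trans hy).symm⟩))
      obtain ⟨x', hx'⟩ := (Submodule.Quotient.mk_eq_zero _).1 this
      exact ⟨x', congr_arg Subtype.val hx'⟩
    · intro H x hx
      obtain ⟨⟨x, hx0⟩, rfl⟩ := Submodule.Quotient.mk_surjective _ x
      have hx' := (hπ ⟨x, hx0⟩).symm.trans hx
      obtain ⟨y, hy⟩ := (Submodule.Quotient.mk_eq_zero _).1 hx'
      obtain ⟨x', hx'⟩ := H x y hx0 ((hi _).symm.trans (congr_arg Subtype.val hy).symm)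
      exact (Submodule.Quotient.mk_eq_zero _).2 ⟨x', Subtype.ext hx'⟩
  · constructor
    · intro H y hy
      obtain ⟨x, hx⟩ := H (Submodule.Quotient.mk ⟨y, hy⟩)
      obtain ⟨⟨x, hx0⟩, rfl⟩ := Submodule.Quotient.mk_surjective _ x
      have hx' := hx.symm.trans (hπ ⟨x, hx0⟩)
      obtain ⟨y', hy'⟩ := (Submodule.Quotient.eq _).1 hx'
      refine ⟨x, y', hx0, ?_⟩
      have h1 : Y.d h i y' = y - f.f i x :=
        (congr_arg Subtype.val hy').trans (congr_arg (y - ·) (hi ⟨x, hx0⟩))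
      rw [h1, add_sub_cancel]
    · intro H y
      obtain ⟨⟨y, hy0⟩, rfl⟩ := Submodule.Quotient.mk_surjective _ y
      obtain ⟨x, y', hx, hy'⟩ := H y hy0
      refine ⟨Submodule.Quotient.mk ⟨x, hx⟩, (hπ _).trans ?_⟩
      symm
      apply (Submodule.Quotient.eq _).2
      exact ⟨y', Subtype.ext ((eq_sub_of_add_eq' hy').trans
        (congr_arg (y - ·) (hi ⟨x, hx⟩).symm))⟩

/-- Injectivity on cohomology in degree j gives a first choice of x', and surjectivity in degree i
corrects it so that the second equation holds as well. Conversely, forgetting the second equation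
gives injectivity, and taking x = 0 gives surjectivity. -/
lemma quasiIso_iff_coneExact {X Y : CochainComplex (ModuleCat.{u} k) ℤ} (f : X ⟶ Y) :
    QuasiIso f ↔ ConeExact (fun i j => (X.d i j).hom) (fun i j => (Y.d i j).hom)
      (fun i => (f.f i).hom) := by
  rw [quasiIso_iff]
  constructor
  · intro H h i j l hi hj hl x y hx hy
    obtain ⟨x₁, hx₁⟩ := ((quasiIsoAt_iff_elements f hj hl).1 (H j)).1 x y hx hy
    change X.d i j x₁ = x at hx₁
    obtain ⟨x₂, y', hx₂, hy'⟩ := ((quasiIsoAt_iff_elements f hi hj).1 (H i)).2 (y - f.f i x₁) (by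
      rw [map_sub, ← f_d_apply, hx₁]
      exact sub_eq_zero.2 hy.symm)
    refine ⟨x₁ + x₂, y', ?_, ?_⟩
    · change X.d i j (x₁ + x₂) = x
      rw [map_add, hx₁, hx₂, add_zero]
    · change f.f i (x₁ + x₂) + Y.d h i y' = y
      rw [map_add, add_assoc, hy', add_sub_cancel]
  · intro H i
    refine (quasiIsoAt_iff_elements f (sub_add_cancel i 1) rfl).2 ⟨fun x y hx hy => ?_, fun y hy => ?_⟩
    · obtain ⟨x', -, hx', -⟩ := H (i - 1 - 1) (i - 1) i (i + 1) (by lia) (by lia) rfl x y hx hy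
      exact ⟨x', hx'⟩
    · obtain ⟨x', y', hx', hy'⟩ := H (i - 1) i (i + 1) (i + 1 + 1) (by lia) rfl rfl 0 y
        (map_zero _) ((map_zero _).trans hy.symm)
      exact ⟨x', y', hx', hy'⟩

section

variable {X Y X' Y' : ℤ → Type u} [∀ i, AddCommGroup (X i)] [∀ i, Module k (X i)]
  [∀ i, AddCommGroup (Y i)] [∀ i, Module k (Y i)] [∀ i, AddCommGroup (X' i)] [∀ i, Module k (X' i)]
  [∀ i, AddCommGroup (Y' i)] [∀ i, Module k (Y' i)] {dX : ∀ i j, X i →ₗ[k] X j}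
  {dY : ∀ i j, Y i →ₗ[k] Y j} {f : ∀ i, X i →ₗ[k] Y i} {dX' : ∀ i j, X' i →ₗ[k] X' j}
  {dY' : ∀ i j, Y' i →ₗ[k] Y' j} {f' : ∀ i, X' i →ₗ[k] Y' i}

/-- Lets exactness be proved in explicit coordinates and carried back to the complexes. -/
lemma ConeExact.of_equiv (H : ConeExact dX dY f) (e : ∀ i, X' i ≃ₗ[k] X i)
    (e' : ∀ i, Y' i ≃ₗ[k] Y i)
    (he : ∀ i j, i + 1 = j → ∀ x, e j (dX' i j x) = dX i j (e i x))
    (he' : ∀ i j, i + 1 = j → ∀ x, e' j (dY' i j x) = dY i j (e' i x))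
    (hf : ∀ i x, e' i (f' i x) = f i (e i x)) : ConeExact dX' dY' f' := by
  intro h i j l hi hj hl x y hx hy
  obtain ⟨x', y', hx', hy'⟩ := H h i j l hi hj hl (e j x) (e' i y)
    (by rw [← he j l hl, hx, map_zero]) (by rw [← hf, hy, he' i j hj])
  refine ⟨(e i).symm x', (e' h).symm y', (e j).injective ?_, (e' i).injective ?_⟩
  · rw [he i j hj, LinearEquiv.apply_symm_apply, hx']
  · rw [map_add, hf, he' h i hi, LinearEquiv.apply_symm_apply, LinearEquiv.apply_symm_apply, hy']

end

/-- The range of the dual of β is the annihilator of ker β, and ker β lies in the image of α, where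
φ vanishes. -/
lemma exists_dual_of_exact {U V W : Type u} [AddCommGroup U] [Module k U] [AddCommGroup V]
    [Module k V] [AddCommGroup W] [Module k W] (α : U →ₗ[k] V) (β : V →ₗ[k] W)
    (hαβ : ∀ v, β v = 0 → ∃ u, α u = v) (φ : Module.Dual k V) (hφ : φ.comp α = 0) :
    ∃ ψ : Module.Dual k W, ψ.comp β = φ := by
  have : φ ∈ LinearMap.range β.dualMap := by
    rw [LinearMap.range_dualMap_eq_dualAnnihilator_ker, Submodule.mem_dualAnnihilator]
    intro v hv
    obtain ⟨u, rfl⟩ := hαβ v hv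
    exact LinearMap.congr_fun hφ u
  exact this

section

variable {X Y : ℤ → Type u} [∀ i, AddCommGroup (X i)] [∀ i, Module k (X i)]
  [∀ i, AddCommGroup (Y i)] [∀ i, Module k (Y i)] {dX : ∀ i j, X i →ₗ[k] X j}
  {dY : ∀ i j, Y i →ₗ[k] Y j} {f : ∀ i, X i →ₗ[k] Y i}

/-- The dual of an exact mapping cone is exact. -/
lemma ConeExact.exists_dual (H : ConeExact dX dY f) {h i j l : ℤ} (hi : h + 1 = i) (hj : i + 1 = j)
    (hl : j + 1 = l) (ξ : Module.Dual k (Y i)) (ζ : Module.Dual k (X j))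
    (hξ : ξ.comp (dY h i) = 0) (hζ : ξ.comp (f i) = ζ.comp (dX i j)) :
    ∃ (ξ' : Module.Dual k (Y j)) (ζ' : Module.Dual k (X l)),
      ξ'.comp (dY i j) = ξ ∧ ξ'.comp (f j) + ζ'.comp (dX j l) = ζ := by
  -- α and β are consecutive differentials of the cone, with the sign of dY alternating. The
  -- functional to be extended is (ζ, -ξ): its sign cancels the one of dY in β, so the components of
  -- the extension are the required functionals.
  let α : X i × Y h →ₗ[k] X j × Y i :=
    ((dX i j).comp (LinearMap.fst _ _ _)).prod ((f i).coprod (dY h i))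
  let β : X j × Y i →ₗ[k] X l × Y j :=
    ((dX j l).comp (LinearMap.fst _ _ _)).prod ((f j).coprod (-dY i j))
  obtain ⟨ψ, hψ⟩ := exists_dual_of_exact α β (by
    rintro ⟨x, y⟩ hxy
    have h1 : dX j l x = 0 := congr_arg Prod.fst hxy
    have h2 : f j x + -dY i j y = 0 := congr_arg Prod.snd hxy
    obtain ⟨x', y', hx', hy'⟩ := H h i j l hi hj hl x y h1 (by rwa [← sub_eq_add_neg, sub_eq_zero] at h2)
    exact ⟨(x', y'), Prod.ext hx' hy'⟩) (ζ.coprod (-ξ)) (by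
    refine LinearMap.ext fun ⟨x, y⟩ => ?_
    change ζ (dX i j x) + -ξ (f i x + dY h i y) = 0
    have h1 : ξ (dY h i y) = 0 := LinearMap.congr_fun hξ y
    have h2 : ξ (f i x) = ζ (dX i j x) := LinearMap.congr_fun hζ x
    rw [map_add, h1, h2]
    abel)
  refine ⟨ψ.comp (LinearMap.inr _ _ _), ψ.comp (LinearMap.inl _ _ _), ?_, ?_⟩
  · refine LinearMap.ext fun y => ?_
    have h1 : ψ (β (0, y)) = (ζ.coprod (-ξ)) (0, y) := LinearMap.congr_fun hψ (0, y)
    have h2 : β (0, y) = -(0, dY i j y) := by simp [β]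
    rw [h2, map_neg] at h1
    simpa using h1
  · refine LinearMap.ext fun x => ?_
    have h1 : ψ (β (x, 0)) = (ζ.coprod (-ξ)) (x, 0) := LinearMap.congr_fun hψ (x, 0)
    have h2 : β (x, 0) = (0, f j x) + (dX j l x, 0) := by simp [β]
    rw [h2, map_add] at h1
    simpa using h1

end

end ConeExact

/-! ### Squarefree modules as cubes of vector spaces -/

section Cubes

variable {k : Type u} [Field k] {n : ℕ}

lemma expo_add_toDeg (a : Deg n) (b : Fin n →₀ ℕ) : expo a (a + toDeg b) = b := by
  ext i
  change ((a i + (b i : ℤ)) - a i).toNat = b i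
  lia

lemma le_add_sqf (b : Deg n) (G : Finset (Fin n)) : b ≤ b + sqf G := fun i => by
  have : 0 ≤ sqf G i := sqf_nonneg G i
  change b i ≤ b i + sqf G i
  lia

lemma sqf_le_add {b : Deg n} (hb : 0 ≤ b) (G : Finset (Fin n)) : sqf G ≤ b + sqf G := fun i => by
  have : 0 ≤ b i := hb i
  change sqf G i ≤ b i + sqf G i
  lia

lemma add_sqf_mono {b b' : Deg n} (h : b ≤ b') {G G' : Finset (Fin n)} (hG : G ⊆ G') :
    b + sqf G ≤ b' + sqf G' := fun i => add_le_add (h i) (sqf_mono hG i)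

lemma supp_add_sqf {b : Deg n} (hb : 0 ≤ b) (G : Finset (Fin n)) : supp (b + sqf G) = supp b ∪ G := by
  ext i
  have h0 : 0 ≤ coord b i := hb i
  have h1 := Finset.ext_iff.1 (supp_sqf G) i
  have h2 : 0 ≤ coord (sqf G) i := sqf_nonneg G i
  simp only [supp, Finset.mem_filter, Finset.mem_univ, true_and, Finset.mem_union] at h1 ⊢
  rw [← h1]
  change 0 < coord b i + coord (sqf G) i ↔ _
  lia

instance : (GrMod.components (k := k) (n := n)).Faithful where
  map_injective {M _ _ _} h := GrMod.hom_ext_gr fun a y hy =>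
    congr_arg Subtype.val (congr($(congr_app h a) (⟨y, hy⟩ : M.gr a)))

/-- A natural family of maps between components commutes with all monomials, so it assembles to an
S-linear map. -/
instance : (GrMod.components (k := k) (n := n)).Full where
  map_surjective {M N} g := by
    obtain ⟨f, hf⟩ := GrMod.exists_hom (M := M) (N := N) (fun c => (g.app c).hom) fun c b y => by
      have h := congr($(g.naturality (homOfLE (le_add_toDeg c b))) y)
      have h' := congr_arg Subtype.val h
      have e : (GrMod.components.obj M).map (homOfLE (le_add_toDeg c b)) y =
          (⟨mon k b • y.1, M.smul_mem b c y.1 y.2⟩ : M.gr (c + toDeg b)) :=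
        Subtype.ext (congr_arg (fun d => mon k d • y.1) (expo_add_toDeg c b))
      have e' : ((GrMod.components.obj N).map (homOfLE (le_add_toDeg c b)) (g.app c y)).1 =
          mon k b • (g.app c y).1 :=
        congr_arg (fun d => mon k d • (g.app c y).1) (expo_add_toDeg c b)
      refine Eq.trans ?_ (h'.trans e')
      exact congr_arg (fun z => (g.app (c + toDeg b) z).1) e.symm
    refine ⟨f, ?_⟩
    ext a y
    exact Subtype.ext (hf a y)

lemma isIso_components_map {M : GrMod k n} (hM : IsSquarefree k n M) {a b : Deg n} (h : a ⟶ b)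
    (ha : 0 ≤ a) (hab : supp b = supp a) : IsIso ((GrMod.components.obj M).map h) := by
  rw [ConcreteCategory.isIso_iff_bijective]
  have e := add_toDeg_expo (leOfHom h)
  have H := hM.bijOn a (expo a b) ha (by rw [e, hab])
  rw [e] at H
  constructor
  · intro x y hxy
    exact Subtype.ext (H.2.1 x.2 y.2 (congr_arg Subtype.val hxy))
  · intro y
    obtain ⟨x, hx, hxy⟩ := H.2.2 y.2
    exact ⟨⟨x, hx⟩, Subtype.ext hxy⟩

lemma subsingleton_components {M : GrMod k n} (hM : IsSquarefree k n M) {a : Deg n} (ha : ¬ 0 ≤ a) :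
    Subsingleton ((GrMod.components.obj M).obj a) := by
  have : ∀ y : M.gr a, y = 0 := fun y =>
    Subtype.ext ((Submodule.mem_bot k).1 ((hM.eq_bot a ha).le y.2))
  exact ⟨fun x y => (this x).trans (this y).symm⟩

lemma isIso_map_sqf {M : GrMod k n} (hM : IsSquarefree k n M) {b : Deg n} (hb : 0 ≤ b)
    {G : Finset (Fin n)} (hG : supp b ⊆ G) :
    IsIso ((GrMod.components.obj M).map (homOfLE (sqf_le_add hb G))) :=
  isIso_components_map hM _ (sqf_nonneg G)
    (by rw [supp_add_sqf hb, supp_sqf, Finset.union_eq_right.2 hG])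

/-- For a squarefree module `M` and `b ∈ ℕⁿ` with `supp₊(b) ⊆ G`, the natural map
`M_b → M_G`, which is the inverse of a multiplication map followed by a multiplication map. -/
def retr {M : GrMod k n} (hM : IsSquarefree k n M) {b : Deg n} (hb : 0 ≤ b) {G : Finset (Fin n)}
    (hG : supp b ⊆ G) : (GrMod.components.obj M).obj b ⟶ (GrMod.components.obj M).obj (sqf G) :=
  haveI := isIso_map_sqf hM hb hG
  (GrMod.components.obj M).map (homOfLE (le_add_sqf b G)) ≫
    inv ((GrMod.components.obj M).map (homOfLE (sqf_le_add hb G)))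

section

variable {M : GrMod k n} (hM : IsSquarefree k n M) {b : Deg n} (hb : 0 ≤ b) {G : Finset (Fin n)}
  (hG : supp b ⊆ G)

lemma retr_comp_map : retr hM hb hG ≫ (GrMod.components.obj M).map (homOfLE (sqf_le_add hb G)) =
    (GrMod.components.obj M).map (homOfLE (le_add_sqf b G)) := by
  simp [retr]

/-- The multiplication M_G → M_{b+G} is invertible because supp₊(b) ⊆ G, so its composite with a map
determines that map; identities between the maps `retr` are checked after composing with it. -/
lemma eq_retr {f : (GrMod.components.obj M).obj b ⟶ (GrMod.components.obj M).obj (sqf G)}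
    (h : f ≫ (GrMod.components.obj M).map (homOfLE (sqf_le_add hb G)) =
      (GrMod.components.obj M).map (homOfLE (le_add_sqf b G))) : f = retr hM hb hG := by
  have := isIso_map_sqf hM hb hG
  rw [← cancel_mono ((GrMod.components.obj M).map (homOfLE (sqf_le_add hb G))), h, retr_comp_map]

lemma retr_comp_sqf {G' : Finset (Fin n)} (hGG' : G ⊆ G') :
    retr hM hb hG ≫ (GrMod.components.obj M).map (homOfLE (sqf_mono hGG')) =
      retr hM hb (hG.trans hGG') := by
  apply eq_retr
  have h1 : homOfLE (sqf_mono hGG') ≫ homOfLE (sqf_le_add hb G') =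
    homOfLE (sqf_le_add hb G) ≫ homOfLE (add_sqf_mono le_rfl hGG') := rfl
  have h2 : homOfLE (le_add_sqf b G') =
    homOfLE (le_add_sqf b G) ≫ homOfLE (add_sqf_mono le_rfl hGG') := rfl
  rw [Category.assoc, ← Functor.map_comp, h1, Functor.map_comp, ← Category.assoc, retr_comp_map,
    h2, Functor.map_comp]

lemma map_comp_retr {a : Deg n} (ha : 0 ≤ a) (h : a ⟶ b) :
    (GrMod.components.obj M).map h ≫ retr hM hb hG =
      retr hM ha ((supp_mono (leOfHom h)).trans hG) := by
  have := isIso_map_sqf hM hb hG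
  rw [← cancel_mono ((GrMod.components.obj M).map (homOfLE (sqf_le_add hb G))), Category.assoc,
    retr_comp_map]
  have h1 : homOfLE (sqf_le_add hb G) =
    homOfLE (sqf_le_add ha G) ≫ homOfLE (add_sqf_mono (leOfHom h) subset_rfl) := rfl
  have h2 : h ≫ homOfLE (le_add_sqf b G) =
    homOfLE (le_add_sqf a G) ≫ homOfLE (add_sqf_mono (leOfHom h) subset_rfl) := rfl
  rw [h1, Functor.map_comp, ← Category.assoc, retr_comp_map, ← Functor.map_comp, h2,
    Functor.map_comp]

lemma retr_sqf {F : Finset (Fin n)} (h : F ⊆ G) (hG : supp (sqf F) ⊆ G) :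
    retr hM (sqf_nonneg F) hG = (GrMod.components.obj M).map (homOfLE (sqf_mono h)) := by
  symm
  apply eq_retr
  rw [← Functor.map_comp]
  rfl

end

variable (k n) in
/-- Cubes of vector spaces: families `(X_F)` indexed by the subsets of `[n]`, with functorial maps
`X_F → X_G` for `F ⊆ G`. -/
abbrev Cube := Finset (Fin n) ⥤ ModuleCat.{u} k

variable (n) in
/-- The functor `F ↦ sqf F`. -/
def sqfFunctor : Finset (Fin n) ⥤ Deg n where
  obj F := sqf F
  map h := homOfLE (sqf_mono (leOfHom h))

variable (k n) in
/-- The cube `F ↦ M_F` of a squarefree module `M`. -/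
def cube : Sq k n ⥤ Cube k n :=
  (squarefree k n).ι ⋙ GrMod.components ⋙ (Functor.whiskeringLeft _ _ _).obj (sqfFunctor n)

instance : (cube k n).Additive where
  map_add := rfl

lemma cube_map_app {M N : Sq k n} (f : M ⟶ N) (F : Finset (Fin n)) :
    ((cube k n).map f).app F = (GrMod.components.map f.hom).app (sqf F) := rfl

/-- Every M_a with a ∈ ℕⁿ is reached by an isomorphism from the component at supp₊(a), and the other
components vanish. -/
instance : (cube k n).Faithful where
  map_injective {M N f g} h := by
    refine InducedCategory.hom_ext (GrMod.components.map_injective ?_)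
    ext a : 2
    by_cases ha : 0 ≤ a
    · have h1 := congr_app h (supp a)
      rw [cube_map_app, cube_map_app] at h1
      have := isIso_components_map M.property (homOfLE (sqf_supp_le ha)) (sqf_nonneg _)
        (by rw [supp_sqf])
      rw [← cancel_epi ((GrMod.components.obj M.obj).map (homOfLE (sqf_supp_le ha))),
        NatTrans.naturality, NatTrans.naturality, h1]
    · have := subsingleton_components M.property ha
      ext x
      rw [Subsingleton.elim x 0, map_zero, map_zero]

/-- Squarefreeness of the objects of `Sq`. -/
lemma isSquarefree_obj (M : Sq k n) : IsSquarefree k n M.obj := M.property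

/-- The morphism of families extending a morphism of cubes. -/
def extendCube {M N : GrMod k n} (hM : IsSquarefree k n M)
    (g : ∀ F : Finset (Fin n),
      (GrMod.components.obj M).obj (sqf F) ⟶ (GrMod.components.obj N).obj (sqf F))
    (hg : ∀ (F G : Finset (Fin n)) (h : F ⊆ G),
      (GrMod.components.obj M).map (homOfLE (sqf_mono h)) ≫ g G =
        g F ≫ (GrMod.components.obj N).map (homOfLE (sqf_mono h))) :
    GrMod.components.obj M ⟶ GrMod.components.obj N where
  -- In degrees a ∈ ℕⁿ the map is forced to pass through the vertex supp₊(a); elsewhere the source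
  -- is zero, which forces the default value 0.
  app a := open scoped Classical in if ha : 0 ≤ a then
      retr hM ha subset_rfl ≫ g (supp a) ≫
        (GrMod.components.obj N).map (homOfLE (sqf_supp_le ha)) else 0
  naturality a b h := by
    by_cases ha : 0 ≤ a
    · have hb : 0 ≤ b := ha.trans (leOfHom h)
      rw [dif_pos ha, dif_pos hb, ← Category.assoc, map_comp_retr _ _ _ ha,
        ← retr_comp_sqf hM ha subset_rfl (supp_mono (leOfHom h)), Category.assoc, Category.assoc,
        Category.assoc, reassoc_of% (hg _ _ (supp_mono (leOfHom h))), ← Functor.map_comp,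
        ← Functor.map_comp]
      rfl
    · have := subsingleton_components hM ha
      ext x
      rw [Subsingleton.elim x 0, map_zero, map_zero]

lemma extendCube_app_sqf {M N : GrMod k n} (hM : IsSquarefree k n M)
    (g : ∀ F : Finset (Fin n),
      (GrMod.components.obj M).obj (sqf F) ⟶ (GrMod.components.obj N).obj (sqf F)) (hg)
    (F : Finset (Fin n)) : (extendCube hM g hg).app (sqf F) = g F := by
  dsimp only [extendCube]
  rw [dif_pos (sqf_nonneg F)]
  have h1 : retr hM (sqf_nonneg F) (G := supp (sqf F)) subset_rfl =
      (GrMod.components.obj M).map (homOfLE (sqf_mono (supp_sqf F).ge)) :=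
    retr_sqf hM (supp_sqf F).ge _
  rw [h1, reassoc_of% (hg F _ (supp_sqf F).ge), ← Functor.map_comp]
  exact (congr_arg (g F ≫ ·) ((GrMod.components.obj N).map_id (sqf F))).trans (Category.comp_id _)

instance : (cube k n).Full where
  map_surjective {M N} g := by
    obtain ⟨f, hf⟩ := GrMod.components.map_surjective (extendCube (isSquarefree_obj M)
      (N := N.obj) g.app fun F G h => g.naturality (homOfLE h))
    refine ⟨ObjectProperty.homMk f, ?_⟩
    ext F : 2
    exact (congr_app hf (sqf F)).trans (extendCube_app_sqf _ _ _ F)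

variable (k n) in
/-- The complex of cubes of a bounded complex of squarefree modules. -/
def cubes : ComB k n ⥤ CochainComplex (Cube k n) ℤ :=
  (bounded k n).ι ⋙ (cube k n).mapHomologicalComplex (ComplexShape.up ℤ)

instance : (cubes k n).Full := inferInstanceAs
  ((bounded k n).ι ⋙ (cube k n).mapHomologicalComplex (ComplexShape.up ℤ)).Full

instance : (cubes k n).Faithful := inferInstanceAs
  ((bounded k n).ι ⋙ (cube k n).mapHomologicalComplex (ComplexShape.up ℤ)).Faithful

variable (k) in
/-- The complex of vector spaces at the vertex `F` of a complex of cubes. -/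
abbrev vertex (F : Finset (Fin n)) :
    CochainComplex (Cube k n) ℤ ⥤ CochainComplex (ModuleCat.{u} k) ℤ :=
  ((evaluation _ (ModuleCat.{u} k)).obj F).mapHomologicalComplex (ComplexShape.up ℤ)

/-- The strand in degree a ∈ ℕⁿ is naturally isomorphic to the one at the squarefree degree
supp₊(a), and the strands outside ℕⁿ are zero. -/
lemma qis_iff {K L : ComB k n} (f : K ⟶ L) :
    qis k n f ↔ ∀ F : Finset (Fin n), QuasiIso ((vertex k F).map ((cubes k n).map f)) := by
  refine ⟨fun h F => h (sqf F), fun h a => ?_⟩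
  by_cases ha : 0 ≤ a
  · let e : strand k n (sqf (supp a)) ≅ strand k n a := by
      refine @asIso _ _ _ _ (Functor.whiskerLeft ((squarefree k n).ι ⋙ GrMod.components)
        ((evaluation (Deg n) (ModuleCat.{u} k)).map (homOfLE (sqf_supp_le ha)))) ?_
      refine (NatTrans.isIso_iff_isIso_app _).2 fun M => ?_
      exact isIso_components_map M.property (homOfLE (sqf_supp_le ha)) (sqf_nonneg _)
        (by rw [supp_sqf])
    let e' := NatIso.mapHomologicalComplex e (ComplexShape.up ℤ)
    have e'' : Arrow.mk (((strand k n (sqf (supp a))).mapHomologicalComplex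
        (ComplexShape.up ℤ)).map f.hom) ≅
        Arrow.mk (((strand k n a).mapHomologicalComplex (ComplexShape.up ℤ)).map f.hom) :=
      Arrow.isoMk (e'.app K.obj) (e'.app L.obj) (e'.hom.naturality f.hom).symm
    exact (quasiIso_iff_of_arrow_mk_iso _ _ e'').1 (h (supp a))
  · rw [quasiIso_iff_coneExact]
    intro h i j l _ _ _ x y _ _
    have h1 := subsingleton_components (K.obj.X j).property ha
    have h2 := subsingleton_components (L.obj.X i).property ha
    exact ⟨0, 0, h1.elim _ _, h2.elim _ _⟩

end Cubes

/-! ### Signs in k as functions of integer exponents -/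

section Signs

variable (k : Type u) [Field k]

/-- The sign `(-1)^e`, as an element of `k`. -/
def sg (e : ℤ) : k := ((e.negOnePow : ℤ) : k)

variable {k}

lemma sg_add (a b : ℤ) : sg k (a + b) = sg k a * sg k b := by
  simp [sg, Int.negOnePow_add]

@[simp] lemma sg_zero : sg k 0 = 1 := by simp [sg]

@[simp] lemma sg_one : sg k 1 = -1 := by simp [sg]

@[simp] lemma sg_mul_self (a : ℤ) : sg k a * sg k a = 1 := by
  rw [← sg_add, sg, Int.negOnePow_even _ ⟨a, rfl⟩]
  simp

lemma sg_succ (a : ℤ) : sg k (a + 1) = -sg k a := by simp [sg_add]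

/-- With `sg_eq_neg`, this reduces the sign comparisons of the proof to parities of integer
expressions. -/
lemma sg_congr {a b : ℤ} (h : (2 : ℤ) ∣ a - b) : sg k a = sg k b := by
  obtain ⟨m, hm⟩ := h
  obtain rfl : a = b + (m + m) := by lia
  rw [sg_add, sg_add m m, sg_mul_self, mul_one]

lemma sg_eq_neg {a b : ℤ} (h : (2 : ℤ) ∣ a - b + 1) : sg k a = -sg k b := by
  rw [← sg_succ]
  exact sg_congr (by obtain ⟨m, hm⟩ := h; exact ⟨m - 1, by lia⟩)

lemma sg_ne_zero (a : ℤ) : sg k a ≠ 0 := fun h => by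
  have := sg_mul_self (k := k) a
  rw [h, mul_zero] at this
  exact zero_ne_one this

lemma sg_smul_sg_smul {V : Type*} [AddCommGroup V] [Module k V] (a b : ℤ) (v : V) :
    sg k a • sg k b • v = sg k (a + b) • v := by
  rw [smul_smul, sg_add]

lemma sg_smul_self {V : Type*} [AddCommGroup V] [Module k V] (a : ℤ) (v : V) :
    sg k a • sg k a • v = v := by
  rw [smul_smul, sg_mul_self, one_smul]

end Signs

/-! ### The functor psi on complexes of cubes -/

section Psi

variable {k : Type u} [Field k] {n : ℕ}

/-- `β(j, H) = #{i ∉ H | i < j}`. -/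
def beta (j : Fin n) (H : Finset (Fin n)) : ℤ := (alpha j Hᶜ : ℤ)

lemma beta_erase {j l : Fin n} {H : Finset (Fin n)} (hl : l ∈ H) :
    beta j (H.erase l) = beta j H + if l < j then 1 else 0 := by
  rw [beta, beta, Finset.compl_erase, alpha_insert (by simpa using hl)]
  split_ifs <;> simp

lemma card_erase_int {j : Fin n} {H : Finset (Fin n)} (hj : j ∈ H) :
    ((H.erase j).card : ℤ) = H.card - 1 := by
  have := Finset.card_erase_add_one hj
  lia

/-- The pairs `(H, q)` with `H ∩ F = ∅` and `q + #H = t + n`. -/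
abbrev PsiIdx (t : ℤ) (F : Finset (Fin n)) : Type :=
  {p : Finset (Fin n) × ℤ // Disjoint p.1 F ∧ p.2 + p.1.card = t + n}

/-- The component of degree `t` at the vertex `F` of `psi X`. -/
abbrev PsiX (X : CochainComplex (Cube k n) ℤ) (t : ℤ) (F : Finset (Fin n)) : Type u :=
  ∀ p : PsiIdx t F, (X.X p.1.2).obj p.1.1

namespace PsiX

variable {X : CochainComplex (Cube k n) ℤ} {t : ℤ} {F : Finset (Fin n)}

open scoped Classical in
/-- The image in `X_H` of the component with index `K ⊆ H`. -/
def push (x : PsiX X t F) (q : ℤ) (H K : Finset (Fin n)) : (X.X q).obj H :=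
  -- The value 0 at inadmissible indices keeps membership and degree proofs out of the sums in the
  -- differential.
  if h : K ⊆ H ∧ Disjoint K F ∧ q + K.card = t + n then
    (X.X q).map (homOfLE h.1) (x ⟨(K, q), h.2⟩) else 0

lemma push_of (x : PsiX X t F) {q : ℤ} {H K : Finset (Fin n)} (h : K ⊆ H) (hd : Disjoint K F)
    (hq : q + K.card = t + n) :
    x.push q H K = (X.X q).map (homOfLE h) (x ⟨(K, q), hd, hq⟩) := dif_pos ⟨h, hd, hq⟩

lemma push_self (x : PsiX X t F) {q : ℤ} {H : Finset (Fin n)} (hd : Disjoint H F)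
    (hq : q + H.card = t + n) : x.push q H H = x ⟨(H, q), hd, hq⟩ := by
  rw [push_of x subset_rfl hd hq]
  exact congr($((X.X q).map_id H) (x ⟨(H, q), hd, hq⟩))

lemma map_push (x : PsiX X t F) {q : ℤ} {H H' K : Finset (Fin n)} (h : K ⊆ H) (h' : H ⊆ H') :
    (X.X q).map (homOfLE h') (x.push q H K) = x.push q H' K := by
  unfold push
  by_cases hK : Disjoint K F ∧ q + K.card = t + n
  · rw [dif_pos ⟨h, hK⟩, dif_pos ⟨h.trans h', hK⟩]
    exact congr($((X.X q).map_comp (homOfLE h) (homOfLE h')) _).symm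
  · rw [dif_neg fun H => hK H.2, dif_neg fun H => hK H.2, map_zero]

lemma push_add (x y : PsiX X t F) (q : ℤ) (H K : Finset (Fin n)) :
    (x + y).push q H K = x.push q H K + y.push q H K := by
  unfold push
  split_ifs with h
  · exact map_add _ _ _
  · exact (add_zero _).symm

lemma push_smul (c : k) (x : PsiX X t F) (q : ℤ) (H K : Finset (Fin n)) :
    (c • x).push q H K = c • x.push q H K := by
  unfold push
  split_ifs with h
  · exact map_smul ((X.X q).map (homOfLE h.1)).hom c _
  · exact (smul_zero _).symm

/-- The differential of `psi X`. -/
def d {t' : ℤ} (ht : t + 1 = t') : PsiX X t F →ₗ[k] PsiX X t' F where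
  toFun x p := sg k t' • (X.d (p.1.2 - 1) p.1.2).app p.1.1 (x.push (p.1.2 - 1) p.1.1 p.1.1) +
    ∑ j ∈ p.1.1, sg k (beta j p.1.1) • x.push p.1.2 p.1.1 (p.1.1.erase j)
  map_add' x y := by
    funext p
    simp only [push_add, map_add, smul_add, Finset.sum_add_distrib, Pi.add_apply]
    exact add_add_add_comm _ _ _ _
  map_smul' c x := by
    funext p
    simp only [push_smul, map_smul, Pi.smul_apply, smul_add, Finset.smul_sum, RingHom.id_apply]
    simp only [smul_comm c]

lemma d_apply {t' : ℤ} (ht : t + 1 = t') (x : PsiX X t F) (H : Finset (Fin n)) (q : ℤ)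
    (h : Disjoint H F ∧ q + H.card = t' + n) :
    d ht x ⟨(H, q), h⟩ = sg k t' • (X.d (q - 1) q).app H (x.push (q - 1) H H) +
      ∑ j ∈ H, sg k (beta j H) • x.push q H (H.erase j) := rfl

/-- The structure maps of the cubes commute with the differential of X and compose with each other,
so the formula for the component K persists after moving it to the vertex H. -/
lemma push_d {t' : ℤ} (ht : t + 1 = t') (x : PsiX X t F) {H K : Finset (Fin n)} {q : ℤ} (h : K ⊆ H)
    (hd : Disjoint K F) (hq : q + K.card = t' + n) :
    (d ht x).push q H K = sg k t' • (X.d (q - 1) q).app H (x.push (q - 1) H K) +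
      ∑ j ∈ K, sg k (beta j K) • x.push q H (K.erase j) := by
  rw [push_of _ h hd hq, d_apply ht x K q ⟨hd, hq⟩, map_add, map_sum]
  congr 1
  · refine (map_smul ((X.X q).map (homOfLE h)).hom _ _).trans ?_
    congr 1
    rw [← map_push x subset_rfl h]
    exact congr($((X.d (q - 1) q).naturality (homOfLE h)) _).symm
  · refine Finset.sum_congr rfl fun j _ => ?_
    refine (map_smul ((X.X q).map (homOfLE h)).hom _ _).trans ?_
    congr 1
    exact map_push x (Finset.erase_subset _ _) h

/-- Three cancellations: d² = 0 in X; the double deletions of j and l cancel in pairs under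
exchange, since removing l changes β(j, ·) exactly when l < j; the mixed terms cancel because the
sign of the internal differential alternates with the degree. -/
lemma d_d {t' t'' : ℤ} (ht : t + 1 = t') (ht' : t' + 1 = t'') (x : PsiX X t F) :
    d ht' (d ht x) = 0 := by
  funext ⟨⟨H, q⟩, hd, hq⟩
  rw [d_apply, push_d ht x subset_rfl hd (by lia)]
  have h1 : ∑ j ∈ H, sg k (beta j H) • (d ht x).push q H (H.erase j) =
      ∑ j ∈ H, sg k (beta j H) • sg k t' • (X.d (q - 1) q).app H (x.push (q - 1) H (H.erase j)) +
      ∑ j ∈ H, ∑ l ∈ H.erase j, sg k (beta j H) • sg k (beta l (H.erase j)) •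
        x.push q H ((H.erase j).erase l) := by
    rw [← Finset.sum_add_distrib]
    refine Finset.sum_congr rfl fun j hj => ?_
    rw [push_d ht x (Finset.erase_subset _ _) (hd.mono_left (Finset.erase_subset _ _))
      (by rw [card_erase_int hj]; lia), smul_add, Finset.smul_sum]
  have h2 : ∑ j ∈ H, ∑ l ∈ H.erase j, sg k (beta j H) • sg k (beta l (H.erase j)) •
        x.push q H ((H.erase j).erase l) = 0 := by
    rw [Finset.sum_sigma']
    refine Finset.sum_involution (fun p _ => ⟨p.2, p.1⟩) ?_ ?_ ?_ ?_
    · rintro ⟨j, l⟩ hp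
      simp only [Finset.mem_sigma, Finset.mem_erase] at hp
      obtain ⟨hj, hlj, hl⟩ := hp
      dsimp only
      rw [Finset.erase_right_comm (a := l) (b := j), sg_smul_sg_smul, sg_smul_sg_smul, ← add_smul,
        beta_erase hj, beta_erase hl]
      rcases lt_or_gt_of_ne hlj with h | h
      · rw [if_neg (not_lt_of_gt h), if_pos h, sg_eq_neg (k := k) (a := beta j H + (beta l H + 0))
          (b := beta l H + (beta j H + 1)) ⟨0, by ring⟩, neg_add_cancel, zero_smul]
      · have h' : j < l := h
        rw [if_neg (not_lt_of_gt h'), if_pos h', sg_eq_neg (k := k) (b := beta j H + (beta l H + 1))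
          (a := beta l H + (beta j H + 0)) ⟨0, by ring⟩, add_neg_cancel, zero_smul]
    · rintro ⟨j, l⟩ hp - e
      simp only [Finset.mem_sigma, Finset.mem_erase] at hp
      exact hp.2.1 (congr_arg Sigma.fst e)
    · rintro ⟨j, l⟩ hp
      simp only [Finset.mem_sigma, Finset.mem_erase] at hp ⊢
      exact ⟨hp.2.2, hp.2.1.symm, hp.1⟩
    · intros
      rfl
  have h3 : (X.d (q - 1) q).app H ((X.d (q - 1 - 1) (q - 1)).app H (x.push (q - 1 - 1) H H)) = 0 :=
    congr($(congr_app (X.d_comp_d (q - 1 - 1) (q - 1) q) H) _)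
  rw [h1, h2, add_zero, map_add, map_sum, smul_add, Finset.smul_sum]
  have h4 : (X.d (q - 1) q).app H (sg k t' • (X.d (q - 1 - 1) (q - 1)).app H
      (x.push (q - 1 - 1) H H)) = 0 := by
    rw [map_smul, h3, smul_zero]
  rw [h4, smul_zero, zero_add, ← Finset.sum_add_distrib]
  refine Finset.sum_eq_zero fun j _ => ?_
  have h5 : sg k t'' = -sg k t' := by rw [← ht', sg_succ]
  rw [map_smul, h5, smul_comm (sg k (beta j H)), neg_smul]
  exact neg_add_cancel _

/-- Restriction of the components, for `F ⊆ F'`. -/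
def res {F' : Finset (Fin n)} (h : F ⊆ F') : PsiX X t F →ₗ[k] PsiX X t F' where
  toFun x p := x ⟨p.1, p.2.1.mono_right h, p.2.2⟩
  map_add' _ _ := rfl
  map_smul' _ _ := rfl

lemma push_res {F' : Finset (Fin n)} (h : F ⊆ F') (x : PsiX X t F) {q : ℤ} {H K : Finset (Fin n)}
    (hK : Disjoint K F') : (res h x).push q H K = x.push q H K := by
  unfold push
  by_cases hK' : K ⊆ H ∧ q + K.card = t + n
  · rw [dif_pos ⟨hK'.1, hK, hK'.2⟩, dif_pos ⟨hK'.1, hK.mono_right h, hK'.2⟩]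
    rfl
  · rw [dif_neg fun H => hK' ⟨H.1, H.2.2⟩, dif_neg fun H => hK' ⟨H.1, H.2.2⟩]

lemma d_res {t' : ℤ} (ht : t + 1 = t') {F' : Finset (Fin n)} (h : F ⊆ F') (x : PsiX X t F) :
    d ht (res h x) = res h (d ht x) := by
  funext ⟨⟨H, q⟩, hd, hq⟩
  change _ = d ht x ⟨(H, q), hd.mono_right h, hq⟩
  rw [d_apply, d_apply, push_res h x hd]
  congr 1
  refine Finset.sum_congr rfl fun j _ => ?_
  rw [push_res h x (hd.mono_left (Finset.erase_subset _ _))]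

/-- The map induced by a morphism of complexes of cubes. -/
def map {Y : CochainComplex (Cube k n) ℤ} (f : X ⟶ Y) : PsiX X t F →ₗ[k] PsiX Y t F where
  toFun x p := (f.f p.1.2).app p.1.1 (x p)
  map_add' _ _ := by funext p; exact map_add _ _ _
  map_smul' c x := by funext p; exact map_smul ((f.f p.1.2).app p.1.1).hom c _

lemma push_map {Y : CochainComplex (Cube k n) ℤ} (f : X ⟶ Y) (x : PsiX X t F) (q : ℤ)
    (H K : Finset (Fin n)) : (map f x).push q H K = (f.f q).app H (x.push q H K) := by
  unfold push
  split_ifs with h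
  · exact congr($((f.f q).naturality (homOfLE h.1)) _).symm
  · exact (map_zero _).symm

lemma d_map {t' : ℤ} (ht : t + 1 = t') {Y : CochainComplex (Cube k n) ℤ} (f : X ⟶ Y)
    (x : PsiX X t F) : d ht (map f x) = map f (d ht x) := by
  funext ⟨⟨H, q⟩, hd, hq⟩
  change _ = (f.f q).app H (d ht x ⟨(H, q), hd, hq⟩)
  rw [d_apply, d_apply, push_map, map_add, map_sum]
  congr 1
  · rw [map_smul]
    congr 1
    exact congr($(congr_app (f.comm (q - 1) q) H) _)
  · refine Finset.sum_congr rfl fun j _ => ?_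
    rw [push_map, map_smul]

end PsiX

open PsiX

/-- The complex of cubes `psi X` with components `(psi X)^t_F = ∏_{H ∩ F = ∅} X_H^{t + n - #H}`. -/
def psiObj (X : CochainComplex (Cube k n) ℤ) : CochainComplex (Cube k n) ℤ where
  X t :=
    { obj F := ModuleCat.of k (PsiX X t F)
      map h := ModuleCat.ofHom (res (leOfHom h))
      map_id _ := rfl
      map_comp _ _ := rfl }
  d t t' := if ht : t + 1 = t' then
    { app F := ModuleCat.ofHom (PsiX.d ht)
      naturality F F' h := by
        ext x : 2
        exact d_res ht (leOfHom h) x } else 0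
  shape t t' ht := dif_neg ht
  d_comp_d' t t' t'' ht ht' := by
    rw [dif_pos (show t + 1 = t' from ht), dif_pos (show t' + 1 = t'' from ht')]
    ext F x : 4
    exact d_d ht ht' x

lemma psiObj_d_app (X : CochainComplex (Cube k n) ℤ) {t t' : ℤ} (ht : t + 1 = t')
    (F : Finset (Fin n)) : ((psiObj X).d t t').app F = ModuleCat.ofHom (PsiX.d ht) := by
  dsimp only [psiObj]
  rw [dif_pos ht]

variable (k n) in
/-- The functor `X ↦ psi X` on complexes of cubes, a model for `D ∘ A`. -/
def psi : CochainComplex (Cube k n) ℤ ⥤ CochainComplex (Cube k n) ℤ where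
  obj X := psiObj X
  map {X Y} f :=
    { f t :=
        { app F := ModuleCat.ofHom (PsiX.map f)
          naturality F F' h := rfl }
      comm' t t' ht := by
        ext F : 2
        change ModuleCat.ofHom (PsiX.map f) ≫ ((psiObj Y).d t t').app F =
          ((psiObj X).d t t').app F ≫ ModuleCat.ofHom (PsiX.map f)
        rw [psiObj_d_app Y ht, psiObj_d_app X ht]
        ext x : 2
        exact d_map ht f x }
  map_id _ := rfl
  map_comp _ _ := rfl

end Psi

/-! ### The threefold iterate of psi as a single product -/

section Tri

variable {k : Type u} [Field k] {n : ℕ}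

/-- With the membership proofs attached, every term is an actual value of x, and can be evaluated
again when X is itself of the form psi. -/
lemma PsiX.d_apply_attach {X : CochainComplex (Cube k n) ℤ} {t t' : ℤ} {F : Finset (Fin n)}
    (ht : t + 1 = t') (x : PsiX X t F) (H : Finset (Fin n)) (q : ℤ)
    (h : Disjoint H F ∧ q + H.card = t' + n) :
    PsiX.d ht x ⟨(H, q), h⟩ = sg k t' • (X.d (q - 1) q).app H (x ⟨(H, q - 1), h.1, by lia⟩) +
      ∑ j ∈ H.attach, sg k (beta j.1 H) • (X.X q).map (homOfLE (Finset.erase_subset j.1 H))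
        (x ⟨(H.erase j.1, q), h.1.mono_left (Finset.erase_subset _ _), by
          dsimp only
          rw [card_erase_int j.2]; lia⟩) := by
  rw [PsiX.d_apply, PsiX.push_self x h.1 (by lia), ← Finset.sum_attach H]
  congr 1
  refine Finset.sum_congr rfl fun j _ => ?_
  rw [PsiX.push_of x (Finset.erase_subset _ _) (h.1.mono_left (Finset.erase_subset _ _))
    (by rw [card_erase_int j.2]; lia)]

lemma PsiX.d_psiObj_apply {X : CochainComplex (Cube k n) ℤ} {t t' : ℤ} {F : Finset (Fin n)}
    (ht : t + 1 = t') (x : PsiX (psiObj X) t F) (H : Finset (Fin n)) (q : ℤ)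
    (h : Disjoint H F ∧ q + H.card = t' + n) (r : PsiIdx q H) :
    (show PsiX X q H from PsiX.d ht x ⟨(H, q), h⟩) r =
      sg k t' • PsiX.d (sub_add_cancel q 1)
        (show PsiX X (q - 1) H from x ⟨(H, q - 1), h.1, by lia⟩) r +
      ∑ j ∈ H.attach, sg k (beta j.1 H) • (show PsiX X q (H.erase j.1) from
        x ⟨(H.erase j.1, q), h.1.mono_left (Finset.erase_subset _ _), by
          dsimp only
          rw [card_erase_int j.2]; lia⟩) ⟨r.1, r.2.1.mono_right (Finset.erase_subset _ _), r.2.2⟩ := by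
  rw [PsiX.d_apply_attach, psiObj_d_app X (sub_add_cancel q 1)]
  refine (Pi.add_apply (M := fun p : PsiIdx q H => (X.X p.1.2).obj p.1.1) _ _ r).trans ?_
  congr 1
  exact Finset.sum_apply (M := fun p : PsiIdx q H => (X.X p.1.2).obj p.1.1) r _ _

/-- The indices `(H₃, H₂, H₁, q)` of the components of the threefold iterate of `psi`. -/
structure TriIdx (n : ℕ) (t : ℤ) (F : Finset (Fin n)) where
  /-- the index set of the outermost functor -/
  H₃ : Finset (Fin n)
  /-- the index set of the middle functor -/
  H₂ : Finset (Fin n)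
  /-- the index set of the innermost functor -/
  H₁ : Finset (Fin n)
  /-- the degree -/
  q : ℤ
  disj₃ : Disjoint H₃ F
  disj₂ : Disjoint H₂ H₃
  disj₁ : Disjoint H₁ H₂
  deg : q + H₁.card + H₂.card + H₃.card = t + n + n + n

/-- The threefold iterate of `psi`, with its components arranged in a single product. -/
abbrev Tri (X : CochainComplex (Cube k n) ℤ) (t : ℤ) (F : Finset (Fin n)) : Type u :=
  ∀ p : TriIdx n t F, (X.X p.q).obj p.H₁

variable {X : CochainComplex (Cube k n) ℤ} {t : ℤ} {F : Finset (Fin n)}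

/-- The component of an element of the threefold iterate of `psi`. -/
def triComp (y : PsiX (psiObj (psiObj X)) t F) {H₃ H₂ H₁ : Finset (Fin n)} {q₃ q₂ q : ℤ}
    (h₃ : Disjoint H₃ F ∧ q₃ + H₃.card = t + n) (h₂ : Disjoint H₂ H₃ ∧ q₂ + H₂.card = q₃ + n)
    (h₁ : Disjoint H₁ H₂ ∧ q + H₁.card = q₂ + n) : (X.X q).obj H₁ :=
  (show PsiX X q₂ H₂ from (show PsiX (psiObj X) q₃ H₃ from y ⟨(H₃, q₃), h₃⟩) ⟨(H₂, q₂), h₂⟩)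
    ⟨(H₁, q), h₁⟩

/-- Rearranging the components. -/
def tri : PsiX (psiObj (psiObj X)) t F ≃ₗ[k] Tri X t F where
  -- The intermediate degrees q₃ and q₂ are determined by t and the cardinalities, which is why
  -- `TriIdx` does not record them.
  toFun y p := triComp y (q₃ := t + n - p.H₃.card) (q₂ := t + n + n - p.H₃.card - p.H₂.card)
    ⟨p.disj₃, by lia⟩ ⟨p.disj₂, by lia⟩ ⟨p.disj₁, by have := p.deg; lia⟩
  invFun z := fun p₃ => (fun p₂ => (fun p₁ => z
      ⟨p₃.1.1, p₂.1.1, p₁.1.1, p₁.1.2, p₃.2.1, p₂.2.1, p₁.2.1, by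
        have h1 := p₁.2.2
        have h2 := p₂.2.2
        have h3 := p₃.2.2
        lia⟩ : PsiX X p₂.1.2 p₂.1.1) : PsiX (psiObj X) p₃.1.2 p₃.1.1)
  left_inv y := by
    refine funext fun ⟨⟨H₃, q₃⟩, h₃⟩ => ?_
    refine funext fun (⟨⟨H₂, q₂⟩, h₂⟩ : PsiIdx q₃ H₃) => ?_
    have e3 : q₃ = t + n - H₃.card := by have := h₃.2; lia
    subst e3
    have e2 : q₂ = t + n + n - H₃.card - H₂.card := by have := h₂.2; lia
    subst e2
    rfl
  right_inv z := rfl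
  map_add' _ _ := rfl
  map_smul' _ _ := rfl

lemma triComp_eq (y : PsiX (psiObj (psiObj X)) t F) {H₃ H₂ H₁ : Finset (Fin n)} {q₃ q₂ q : ℤ}
    (h₃ : Disjoint H₃ F ∧ q₃ + H₃.card = t + n) (h₂ : Disjoint H₂ H₃ ∧ q₂ + H₂.card = q₃ + n)
    (h₁ : Disjoint H₁ H₂ ∧ q + H₁.card = q₂ + n) :
    triComp y h₃ h₂ h₁ = tri y ⟨H₃, H₂, H₁, q, h₃.1, h₂.1, h₁.1, by lia⟩ := by
  have e3 : q₃ = t + n - H₃.card := by have := h₃.2; lia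
  subst e3
  have e2 : q₂ = t + n + n - H₃.card - H₂.card := by have := h₂.2; lia
  subst e2
  rfl

open scoped Classical in
/-- The components of an element of `Tri X t F`, extended by zero to all indices. -/
def Tri.c (y : Tri X t F) (H₃ H₂ H₁ : Finset (Fin n)) (q : ℤ) : (X.X q).obj H₁ :=
  if h : Disjoint H₃ F ∧ Disjoint H₂ H₃ ∧ Disjoint H₁ H₂ ∧
      q + H₁.card + H₂.card + H₃.card = t + n + n + n then
    y ⟨H₃, H₂, H₁, q, h.1, h.2.1, h.2.2.1, h.2.2.2⟩ else 0

lemma Tri.c_of (y : Tri X t F) {H₃ H₂ H₁ : Finset (Fin n)} {q : ℤ} (h₃ : Disjoint H₃ F)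
    (h₂ : Disjoint H₂ H₃) (h₁ : Disjoint H₁ H₂)
    (h : q + H₁.card + H₂.card + H₃.card = t + n + n + n) :
    y.c H₃ H₂ H₁ q = y ⟨H₃, H₂, H₁, q, h₃, h₂, h₁, h⟩ := dif_pos ⟨h₃, h₂, h₁, h⟩

lemma Tri.c_add (x y : Tri X t F) (H₃ H₂ H₁ : Finset (Fin n)) (q : ℤ) :
    (x + y).c H₃ H₂ H₁ q = x.c H₃ H₂ H₁ q + y.c H₃ H₂ H₁ q := by
  unfold Tri.c
  split_ifs
  · rfl
  · exact (add_zero _).symm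

lemma Tri.c_smul (a : k) (x : Tri X t F) (H₃ H₂ H₁ : Finset (Fin n)) (q : ℤ) :
    (a • x).c H₃ H₂ H₁ q = a • x.c H₃ H₂ H₁ q := by
  unfold Tri.c
  split_ifs
  · rfl
  · exact (smul_zero _).symm

/-- The differential, in terms of the components. -/
def Tri.d {t' : ℤ} (_ : t + 1 = t') : Tri X t F →ₗ[k] Tri X t' F where
  toFun y p := sg k (t' + n + p.H₂.card) •
      (X.d (p.q - 1) p.q).app p.H₁ (y.c p.H₃ p.H₂ p.H₁ (p.q - 1)) +
    ∑ j ∈ p.H₁, sg k (n + p.H₃.card + beta j p.H₁) •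
      (X.X p.q).map (homOfLE (Finset.erase_subset j p.H₁)) (y.c p.H₃ p.H₂ (p.H₁.erase j) p.q) +
    ∑ j ∈ p.H₂, sg k (t' + beta j p.H₂) • y.c p.H₃ (p.H₂.erase j) p.H₁ p.q +
    ∑ j ∈ p.H₃, sg k (beta j p.H₃) • y.c (p.H₃.erase j) p.H₂ p.H₁ p.q
  map_add' x y := by
    funext p
    simp only [Tri.c_add, map_add, smul_add, Finset.sum_add_distrib, Pi.add_apply]
    abel
  map_smul' a x := by
    funext p
    simp only [Tri.c_smul, map_smul, Pi.smul_apply, smul_add, Finset.smul_sum, RingHom.id_apply]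
    simp only [smul_comm a]

lemma disjoint_erase_left {A B : Finset (Fin n)} (h : Disjoint A B) (j : Fin n) :
    Disjoint (A.erase j) B := h.mono_left (Finset.erase_subset _ _)

lemma disjoint_erase_right {A B : Finset (Fin n)} (h : Disjoint A B) (j : Fin n) :
    Disjoint A (B.erase j) := h.mono_right (Finset.erase_subset _ _)

lemma triComp_d {t' : ℤ} (ht : t + 1 = t') (y : PsiX (psiObj (psiObj X)) t F)
    {H₃ H₂ H₁ : Finset (Fin n)} {q₃ q₂ q : ℤ}
    (h₃ : Disjoint H₃ F ∧ q₃ + H₃.card = t' + n) (h₂ : Disjoint H₂ H₃ ∧ q₂ + H₂.card = q₃ + n)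
    (h₁ : Disjoint H₁ H₂ ∧ q + H₁.card = q₂ + n) :
    triComp (PsiX.d ht y) h₃ h₂ h₁ =
      sg k t' • (sg k q₃ • (sg k q₂ • (X.d (q - 1) q).app H₁
          (triComp y (q₃ := q₃ - 1) (q₂ := q₂ - 1) (q := q - 1) ⟨h₃.1, by lia⟩ ⟨h₂.1, by lia⟩
            ⟨h₁.1, by lia⟩) +
        ∑ j ∈ H₁.attach, sg k (beta j.1 H₁) • (X.X q).map (homOfLE (Finset.erase_subset j.1 H₁))
          (triComp y (q₃ := q₃ - 1) (q₂ := q₂ - 1) (q := q) ⟨h₃.1, by lia⟩ ⟨h₂.1, by lia⟩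
            ⟨disjoint_erase_left h₁.1 j.1, by rw [card_erase_int j.2]; lia⟩)) +
        ∑ j ∈ H₂.attach, sg k (beta j.1 H₂) •
          triComp y (q₃ := q₃ - 1) (q₂ := q₂) (q := q) ⟨h₃.1, by lia⟩
            ⟨disjoint_erase_left h₂.1 j.1, by rw [card_erase_int j.2]; lia⟩
            ⟨disjoint_erase_right h₁.1 j.1, h₁.2⟩) +
      ∑ j ∈ H₃.attach, sg k (beta j.1 H₃) •
        triComp y (q₃ := q₃) (q₂ := q₂) (q := q)
          ⟨disjoint_erase_left h₃.1 j.1, by rw [card_erase_int j.2]; lia⟩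
          ⟨disjoint_erase_right h₂.1 j.1, h₂.2⟩ h₁ := by
  have ev_sum {ι : Type} (s : Finset ι) (f : ι → PsiX X q₂ H₂) :
    (∑ j ∈ s, f j) ⟨(H₁, q), h₁⟩ = ∑ j ∈ s, f j ⟨(H₁, q), h₁⟩ := Finset.sum_apply _ _ _
  have e1 := congr_arg (fun z : PsiX X q₂ H₂ => z ⟨(H₁, q), h₁⟩)
    (PsiX.d_psiObj_apply ht y H₃ _ h₃ ⟨(H₂, q₂), h₂⟩)
  refine e1.trans ?_
  refine (Pi.add_apply (M := fun p : PsiIdx q₂ H₂ => (X.X p.1.2).obj p.1.1) _ _ _).trans ?_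
  refine congr_arg₂ (· + ·) ?_ (ev_sum _ _)
  refine congr_arg (fun z : (X.X q).obj H₁ => sg k t' • z) ?_
  let y₃ : PsiX (psiObj X) (q₃ - 1) H₃ := y ⟨(H₃, q₃ - 1), h₃.1, by have := h₃.2; dsimp only; lia⟩
  have e2 := PsiX.d_psiObj_apply (sub_add_cancel q₃ 1) y₃ H₂ _ h₂ ⟨(H₁, q), h₁⟩
  refine e2.trans ?_
  refine congr_arg₂ (· + ·) (congr_arg (fun z : (X.X q).obj H₁ => sg k q₃ • z) ?_) rfl
  exact PsiX.d_apply_attach _ _ _ _ _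

/-- The nested differentials contribute the signs with exponents t', q₃ and q₂, multiplied according
to depth. Substituting q₃ = t' + n - #H₃ and q₂ = q₃ + n - #H₂ and reducing modulo 2 gives the signs
of `Tri.d`. -/
lemma tri_d {t' : ℤ} (ht : t + 1 = t') (y : PsiX (psiObj (psiObj X)) t F) :
    tri (PsiX.d ht y) = Tri.d ht (tri y) := by
  funext ⟨H₃, H₂, H₁, q, h₃, h₂, h₁, h⟩
  refine (triComp_d ht y (q₃ := t' + n - H₃.card) (q₂ := t' + n + n - H₃.card - H₂.card)
    ⟨h₃, by lia⟩ ⟨h₂, by lia⟩ ⟨h₁, by lia⟩).trans ?_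
  simp only [triComp_eq, smul_add, Finset.smul_sum, sg_smul_sg_smul]
  refine congr_arg₂ (· + ·) (congr_arg₂ (· + ·) (congr_arg₂ (· + ·) ?_ ?_) ?_) ?_
  · rw [Tri.c_of _ h₃ h₂ h₁ (by lia)]
    congr 1
    exact sg_congr ⟨t' + n - H₃.card - H₂.card, by ring⟩
  · rw [← Finset.sum_attach H₁]
    refine Finset.sum_congr rfl fun j _ => ?_
    rw [Tri.c_of _ h₃ h₂ (disjoint_erase_left h₁ _) (by rw [card_erase_int j.2]; lia)]
    congr 1
    exact sg_congr ⟨t' - H₃.card, by ring⟩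
  · rw [← Finset.sum_attach H₂]
    refine Finset.sum_congr rfl fun j _ => ?_
    rw [Tri.c_of _ h₃ (disjoint_erase_left h₂ _) (disjoint_erase_right h₁ _)
      (by rw [card_erase_int j.2]; lia)]
  · rw [← Finset.sum_attach H₃]
    refine Finset.sum_congr rfl fun j _ => ?_
    rw [Tri.c_of _ (disjoint_erase_left h₃ _) (disjoint_erase_right h₂ _) h₁
      (by rw [card_erase_int j.2]; lia)]

lemma Tri.d_d {t' t'' : ℤ} (ht : t + 1 = t') (ht' : t' + 1 = t'') (y : Tri X t F) :
    Tri.d ht' (Tri.d ht y) = 0 := by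
  obtain ⟨y, rfl⟩ := tri.surjective y
  rw [← tri_d, ← tri_d, PsiX.d_d, map_zero]

end Tri

/-! ### The comparison map from the shift by 2n -/

section Eta

variable {k : Type u} [Field k] {n : ℕ}

/-- The triangular number `x (x + 1) / 2`. -/
def triangular (x : ℤ) : ℤ := x * (x + 1) / 2

lemma triangular_succ (x : ℤ) : triangular (x + 1) = triangular x + (x + 1) := by
  have h : (x + 1) * (x + 1 + 1) = x * (x + 1) + (x + 1) * 2 := by ring
  rw [triangular, triangular, h, Int.add_mul_ediv_right _ _ (by norm_num)]

/-- The exponent of the sign of the component of `eta` with index `K`, in degree `t`. -/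
def etaExp (t : ℤ) (K : Finset (Fin n)) : ℤ :=
  ∑ i ∈ K, (i.1 : ℤ) + triangular K.card + triangular (t + n)

/-- The triangular number of t + n is there for this: its increment is the exponent of the internal
differential of `Tri` into degree t + 1 when H₂ = ∅. -/
lemma etaExp_succ (t : ℤ) (K : Finset (Fin n)) : etaExp (t + 1) K = etaExp t K + (t + n + 1) := by
  have h : t + 1 + n = (t + n) + 1 := by ring
  rw [etaExp, etaExp, h, triangular_succ]
  ring

/-- The increment j + #K is what makes the two terms at an index with H₁ ∩ H₃ = {j} and H₁ ∪ H₃ =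
[n] cancel in `d_etaTri`: in one j was added to H₁, in the other to H₃. -/
lemma etaExp_erase (t : ℤ) {K : Finset (Fin n)} {j : Fin n} (hj : j ∈ K) :
    etaExp t K = etaExp t (K.erase j) + j.1 + K.card := by
  have h : (K.card : ℤ) = (K.erase j).card + 1 := by rw [card_erase_int hj]; ring
  rw [etaExp, etaExp, ← Finset.add_sum_erase K _ hj, h, triangular_succ]
  ring

lemma alpha_add_beta (j : Fin n) (H : Finset (Fin n)) : (alpha j H : ℤ) + beta j H = j.1 := by
  have h : alpha j H + alpha j Hᶜ = j.1 := by
    unfold alpha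
    rw [← Finset.card_union_of_disjoint, ← Finset.filter_union, Finset.union_compl]
    · have : Finset.univ.filter (fun i => i < j) = Finset.Iio j := by ext; simp
      rw [this, Fin.card_Iio]
    · exact Finset.disjoint_filter_filter disjoint_compl_right
  rw [beta]
  exact_mod_cast h

lemma alpha_erase_self (j : Fin n) (H : Finset (Fin n)) : alpha j (H.erase j) = alpha j H := by
  unfold alpha
  congr 1
  ext i
  simp only [Finset.mem_filter, Finset.mem_erase]
  exact ⟨fun h => ⟨h.1.2, h.2⟩, fun h => ⟨⟨h.2.ne, h.1⟩, h.2⟩⟩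

variable {X : CochainComplex (Cube k n) ℤ} {t : ℤ} {F : Finset (Fin n)}

open scoped Classical in
/-- The image in `X^q_H` of an element of `X^s_F`, for `q = s` and `F ⊆ H`. -/
def pushTo {s : ℤ} (m : (X.X s).obj F) (q : ℤ) (H : Finset (Fin n)) : (X.X q).obj H :=
  if h : F ⊆ H ∧ s = q then (X.XIsoOfEq h.2).hom.app H ((X.X s).map (homOfLE h.1) m) else 0

lemma pushTo_of {s : ℤ} (m : (X.X s).obj F) {H : Finset (Fin n)} (h : F ⊆ H) :
    pushTo m s H = (X.X s).map (homOfLE h) m := dif_pos ⟨h, rfl⟩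

lemma pushTo_self {s : ℤ} (m : (X.X s).obj F) : pushTo m s F = m := by
  rw [pushTo_of m subset_rfl]
  exact congr($((X.X s).map_id F) m)

lemma pushTo_of_ne {s : ℤ} (m : (X.X s).obj F) {q : ℤ} (h : s ≠ q) (H : Finset (Fin n)) :
    pushTo m q H = 0 := dif_neg fun h' => h h'.2

lemma pushTo_of_not_subset {s : ℤ} (m : (X.X s).obj F) (q : ℤ) {H : Finset (Fin n)} (h : ¬ F ⊆ H) :
    pushTo m q H = 0 := dif_neg fun h' => h h'.1

lemma pushTo_add {s : ℤ} (m m' : (X.X s).obj F) (q : ℤ) (H : Finset (Fin n)) :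
    pushTo (m + m') q H = pushTo m q H + pushTo m' q H := by
  unfold pushTo
  split_ifs
  · rw [map_add, map_add]
  · exact (add_zero _).symm

lemma pushTo_smul {s : ℤ} (a : k) (m : (X.X s).obj F) (q : ℤ) (H : Finset (Fin n)) :
    pushTo (a • m) q H = a • pushTo m q H := by
  unfold pushTo
  split_ifs
  · rw [map_smul, map_smul]
  · exact (smul_zero _).symm

lemma map_pushTo {s : ℤ} (m : (X.X s).obj F) (q : ℤ) {H H' : Finset (Fin n)} (h : F ⊆ H)
    (h' : H ⊆ H') : (X.X q).map (homOfLE h') (pushTo m q H) = pushTo m q H' := by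
  by_cases hs : s = q
  · subst hs
    rw [pushTo_of m h, pushTo_of m (h.trans h')]
    exact congr($((X.X s).map_comp (homOfLE h) (homOfLE h')) m).symm
  · rw [pushTo_of_ne m hs, pushTo_of_ne m hs, map_zero]

lemma pushTo_map {s : ℤ} {F' : Finset (Fin n)} (h : F ⊆ F') (m : (X.X s).obj F) (q : ℤ)
    {H : Finset (Fin n)} (h' : F' ⊆ H) :
    pushTo ((X.X s).map (homOfLE h) m) q H = pushTo m q H := by
  by_cases hs : s = q
  · subst hs
    rw [pushTo_of _ h', pushTo_of m (h.trans h')]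
    exact congr($((X.X s).map_comp (homOfLE h) (homOfLE h')) m).symm
  · rw [pushTo_of_ne _ hs, pushTo_of_ne m hs]

lemma d_pushTo {s s' : ℤ} (m : (X.X s).obj F) {q q' : ℤ} (hs : s + 1 = s') (hq : q + 1 = q')
    (H : Finset (Fin n)) :
    (X.d q q').app H (pushTo m q H) = pushTo ((X.d s s').app F m) q' H := by
  by_cases hF : F ⊆ H
  · by_cases h : s = q
    · subst h
      obtain rfl : s' = q' := hs.symm.trans hq
      rw [pushTo_of _ hF, pushTo_of _ hF]
      exact congr($((X.d s s').naturality (homOfLE hF)) m)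
    · rw [pushTo_of_ne _ h, pushTo_of_ne _ (by lia), map_zero]
  · rw [pushTo_of_not_subset _ _ hF, pushTo_of_not_subset _ _ hF, map_zero]

lemma map_f_pushTo {Y : CochainComplex (Cube k n) ℤ} (f : X ⟶ Y) {s : ℤ} (m : (X.X s).obj F)
    (q : ℤ) (H : Finset (Fin n)) :
    (f.f q).app H (pushTo m q H) = pushTo ((f.f s).app F m) q H := by
  by_cases hF : F ⊆ H
  · by_cases h : s = q
    · subst h
      rw [pushTo_of _ hF, pushTo_of _ hF]
      exact congr($((f.f s).naturality (homOfLE hF)) m)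
    · rw [pushTo_of_ne _ h, pushTo_of_ne _ h, map_zero]
  · rw [pushTo_of_not_subset _ _ hF, pushTo_of_not_subset _ _ hF, map_zero]

/-- The map `X^{t + 2n}_F → Tri X t F` with components `± x^{K ∖ F}` at the indices
`(H₃, H₂, H₁) = ([n] ∖ K, ∅, K)`. -/
def etaTri : (X.X (t + 2 * n)).obj F →ₗ[k] Tri X t F where
  toFun m p := if p.H₂ = ∅ ∧ p.H₃ = p.H₁ᶜ then sg k (etaExp t p.H₁) • pushTo m p.q p.H₁ else 0
  map_add' m m' := by
    funext p
    rw [Pi.add_apply]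
    split_ifs
    · rw [pushTo_add, smul_add]
    · exact (add_zero _).symm
  map_smul' a m := by
    funext p
    rw [Pi.smul_apply]
    split_ifs
    · rw [pushTo_smul, smul_comm]
      rfl
    · exact (smul_zero _).symm

lemma etaTri_apply (m : (X.X (t + 2 * n)).obj F) (p : TriIdx n t F) : etaTri m p =
    if p.H₂ = ∅ ∧ p.H₃ = p.H₁ᶜ then sg k (etaExp t p.H₁) • pushTo m p.q p.H₁ else 0 := rfl

lemma card_compl_int (H : Finset (Fin n)) : ((Hᶜ).card : ℤ) = n - H.card := by
  have h := Finset.card_add_card_compl H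
  rw [Fintype.card_fin] at h
  lia

/-- The formula also holds at inadmissible indices: if (H₁ᶜ, ∅, H₁) is not admissible, then F ⊄ H₁
or q ≠ t + 2n, and `pushTo` vanishes. -/
lemma etaTri_c (m : (X.X (t + 2 * n)).obj F) (H₃ H₂ H₁ : Finset (Fin n)) (q : ℤ) :
    (etaTri m).c H₃ H₂ H₁ q =
      if H₂ = ∅ ∧ H₃ = H₁ᶜ then sg k (etaExp t H₁) • pushTo m q H₁ else 0 := by
  unfold Tri.c
  split_ifs with h h'
  · exact (etaTri_apply _ _).trans (if_pos h')
  · exact (etaTri_apply _ _).trans (if_neg h')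
  · rename_i h'
    obtain ⟨rfl, rfl⟩ := h'
    by_cases hF : F ⊆ H₁
    · rw [pushTo_of_ne m, smul_zero]
      intro hq
      refine h ⟨?_, Finset.disjoint_empty_left _, Finset.disjoint_empty_right _, ?_⟩
      · exact (Finset.disjoint_left.2 fun i hi hi' => Finset.mem_compl.1 hi (hF hi'))
      · rw [card_compl_int, Finset.card_empty]
        push_cast
        lia
    · rw [pushTo_of_not_subset m _ hF, smul_zero]
  · rfl

/-- Only the internal differential survives. A term that adds j to H₂ needs H₃ = H₁ᶜ, but j lies in
neither H₁ nor H₃. A term that adds j to H₁ or to H₃ is nonzero only if H₁ and H₃ cover [n] and meet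
exactly in j; then both kinds occur, with opposite signs. -/
lemma d_etaTri {t' : ℤ} (ht : t + 1 = t') (m : (X.X (t + 2 * n)).obj F) :
    Tri.d ht (etaTri m) = etaTri ((X.d (t + 2 * n) (t' + 2 * n)).app F m) := by
  subst ht
  funext ⟨H₃, H₂, H₁, q, h₃, h₂, h₁, h⟩
  rw [etaTri_apply]
  dsimp only [Tri.d, LinearMap.coe_mk, AddHom.coe_mk]
  simp only [etaTri_c]
  have hH₂ : ∑ j ∈ H₂, sg k (t + 1 + beta j H₂) • (if H₂.erase j = ∅ ∧ H₃ = H₁ᶜ then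
      sg k (etaExp t H₁) • pushTo m q H₁ else 0) = 0 := by
    refine Finset.sum_eq_zero fun j hj => ?_
    rw [if_neg, smul_zero]
    rintro ⟨-, rfl⟩
    have h2 := Finset.disjoint_left.1 h₂ hj
    exact h2 (Finset.mem_compl.2 (Finset.disjoint_right.1 h₁ hj))
  have hH : ∑ j ∈ H₁, sg k (n + H₃.card + beta j H₁) •
        (X.X q).map (homOfLE (Finset.erase_subset j H₁)) (if H₂ = ∅ ∧ H₃ = (H₁.erase j)ᶜ then
          sg k (etaExp t (H₁.erase j)) • pushTo m q (H₁.erase j) else 0) +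
      ∑ j ∈ H₃, sg k (beta j H₃) • (if H₂ = ∅ ∧ H₃.erase j = H₁ᶜ then
          sg k (etaExp t H₁) • pushTo m q H₁ else 0) = 0 := by
    rw [← Finset.sum_filter_add_sum_filter_not H₁ (fun j => j ∈ H₃),
      ← Finset.sum_filter_add_sum_filter_not H₃ (fun j => j ∈ H₁)]
    have z1 : ∑ j ∈ H₁.filter (fun j => j ∉ H₃), sg k (n + H₃.card + beta j H₁) •
        (X.X q).map (homOfLE (Finset.erase_subset j H₁)) (if H₂ = ∅ ∧ H₃ = (H₁.erase j)ᶜ then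
          sg k (etaExp t (H₁.erase j)) • pushTo m q (H₁.erase j) else 0) = 0 := by
      refine Finset.sum_eq_zero fun j hj => ?_
      rw [if_neg, map_zero, smul_zero]
      rintro ⟨-, rfl⟩
      simp at hj
    have z2 : ∑ j ∈ H₃.filter (fun j => j ∉ H₁), sg k (beta j H₃) •
        (if H₂ = ∅ ∧ H₃.erase j = H₁ᶜ then sg k (etaExp t H₁) • pushTo m q H₁ else 0) = 0 := by
      refine Finset.sum_eq_zero fun j hj => ?_
      rw [if_neg, smul_zero]
      rintro ⟨-, e⟩
      have := (Finset.mem_filter.1 hj).2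
      rw [← Finset.mem_compl, ← e] at this
      exact Finset.notMem_erase j H₃ this
    have z3 : H₃.filter (fun j => j ∈ H₁) = H₁.filter (fun j => j ∈ H₃) := by
      ext j; simp [and_comm]
    rw [z1, z2, z3, add_zero, add_zero, ← Finset.sum_add_distrib]
    refine Finset.sum_eq_zero fun j hj => ?_
    obtain ⟨hj₁, hj₃⟩ := Finset.mem_filter.1 hj
    have hiff : H₃.erase j = H₁ᶜ ↔ H₃ = (H₁.erase j)ᶜ := by
      rw [Finset.compl_erase]
      constructor
      · intro e
        rw [← e, Finset.insert_erase hj₃]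
      · intro e
        rw [e, Finset.erase_insert (by simpa using hj₁)]
    simp only [hiff]
    split_ifs with hc
    · have hF : F ⊆ H₁.erase j := by
        intro i hi
        have h5 := Finset.disjoint_right.1 h₃ hi
        rw [hc.2, Finset.mem_compl, not_not] at h5
        exact h5
      rw [map_smul, map_pushTo m q hF, sg_smul_sg_smul, sg_smul_sg_smul, ← add_smul,
        etaExp_erase t hj₁]
      -- Since H₃ is the complement of H₁ ∖ {j}, the two counts together run over all positions
      -- below j.
      have hβ : beta j H₃ + beta j H₁ = j.1 := by
        rw [hc.2, beta, compl_compl, alpha_erase_self, alpha_add_beta]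
      have hcard : (H₃.card : ℤ) = n - H₁.card + 1 := by
        rw [hc.2, card_compl_int, card_erase_int hj₁]; ring
      rw [sg_eq_neg (k := k) (a := n + H₃.card + beta j H₁ + etaExp t (H₁.erase j))
        (b := beta j H₃ + (etaExp t (H₁.erase j) + j.1 + H₁.card))
        ⟨n - H₁.card + 1 - beta j H₃, by rw [hcard, ← hβ]; ring⟩, neg_add_cancel, zero_smul]
    · rw [map_zero, smul_zero, smul_zero, add_zero]
  rw [hH₂, add_zero, add_assoc, hH, add_zero]
  split_ifs with hc
  · rw [map_smul, d_pushTo m (s' := t + 1 + 2 * n) (by ring) (by ring), sg_smul_sg_smul,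
      etaExp_succ]
    have hcard : (H₂.card : ℤ) = 0 := by rw [hc.1]; rfl
    congr 1
    exact sg_congr ⟨0, by rw [hcard]; ring⟩
  · rw [map_zero, smul_zero]

variable (k n) in
/-- The natural morphism `X[2n] → psi (psi (psi X))`. -/
def eta : shiftFunctor (CochainComplex (Cube k n) ℤ) (2 * (n : ℤ)) ⟶
    psi k n ⋙ psi k n ⋙ psi k n where
  app X :=
    { f t :=
        { app F := ModuleCat.ofHom (tri.symm.toLinearMap.comp (etaTri (X := X) (t := t) (F := F)))
          naturality F F' h := by
            ext m : 2
            refine (tri (X := X) (t := t) (F := F')).injective ?_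
            refine ((tri (X := X) (t := t) (F := F')).apply_symm_apply
              (etaTri ((X.X (t + 2 * n)).map (homOfLE (leOfHom h)) m))).trans ?_
            funext p
            change (if p.H₂ = ∅ ∧ p.H₃ = p.H₁ᶜ then sg k (etaExp t p.H₁) •
              pushTo ((X.X (t + 2 * n)).map (homOfLE (leOfHom h)) m) p.q p.H₁ else 0) =
              if p.H₂ = ∅ ∧ p.H₃ = p.H₁ᶜ then sg k (etaExp t p.H₁) •
                pushTo (show (X.X (t + 2 * n)).obj F from m) p.q p.H₁ else 0
            split_ifs with hc
            · refine congr_arg (sg k (etaExp t p.H₁) • ·)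
                (pushTo_map (leOfHom h) (show (X.X (t + 2 * n)).obj F from m) p.q fun i hi => ?_)
              have h5 := Finset.disjoint_right.1 p.disj₃ hi
              rw [hc.2, Finset.mem_compl, not_not] at h5
              exact h5
            · rfl }
      comm' t t' ht := by
        ext F m : 4
        refine (tri (X := X) (t := t') (F := F)).injective ?_
        refine ((congr_arg (tri (X := X) (t := t') (F := F)) (congr($(psiObj_d_app (psiObj (psiObj X)) ht F) _))).trans
          ((tri_d ht _).trans ?_))
        refine (congr_arg (Tri.d ht)
          ((tri (X := X) (t := t) (F := F)).apply_symm_apply (etaTri m))).trans ?_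
        refine (d_etaTri ht m).trans ?_
        refine Eq.trans ?_ ((tri (X := X) (t := t') (F := F)).apply_symm_apply (etaTri
          ((((shiftFunctor _ (2 * (n : ℤ))).obj X).d t t').app F m))).symm
        refine congr_arg (etaTri (X := X) (t := t') (F := F)) ?_
        rw [CochainComplex.shiftFunctor_obj_d', Int.negOnePow_even _ (even_two_mul _), one_smul]
        rfl }
  naturality X Y f := by
    ext t F m : 5
    refine (tri (X := Y) (t := t) (F := F)).injective ?_
    refine ((tri (X := Y) (t := t) (F := F)).apply_symm_apply
      (etaTri ((f.f (t + 2 * n)).app F m))).trans ?_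
    funext p
    change (if p.H₂ = ∅ ∧ p.H₃ = p.H₁ᶜ then sg k (etaExp t p.H₁) •
      pushTo ((f.f (t + 2 * n)).app F m) p.q p.H₁ else 0) =
      (f.f p.q).app p.H₁ (if p.H₂ = ∅ ∧ p.H₃ = p.H₁ᶜ then
        sg k (etaExp t p.H₁) • pushTo (show (X.X (t + 2 * n)).obj F from m) p.q p.H₁ else 0)
    split_ifs with hc
    · refine Eq.trans ?_ (map_smul ((f.f p.q).app p.H₁).hom _ _).symm
      exact congr_arg (sg k (etaExp t p.H₁) • ·) (map_f_pushTo f _ _ _).symm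
    · exact (map_zero ((f.f p.q).app p.H₁).hom).symm

end Eta

/-! ### A filtered criterion for exactness of the cone -/

section Filtration

variable {k : Type u} [Field k] {X Y : ℤ → Type u} [∀ i, AddCommGroup (X i)] [∀ i, Module k (X i)]
  [∀ i, AddCommGroup (Y i)] [∀ i, Module k (Y i)] {dX : ∀ i j, X i →ₗ[k] X j}
  {dY : ∀ i j, Y i →ₗ[k] Y j} {f : ∀ i, X i →ₗ[k] Y i}

/-- A degreewise injective morphism is a quasi-isomorphism if it has an inverse up to homotopy
modulo terms of higher order for a finite filtration. -/
lemma coneExact_of_filtration (hf : ∀ i j, i + 1 = j → ∀ x, f j (dX i j x) = dY i j (f i x))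
    (hd : ∀ h i j, h + 1 = i → i + 1 = j → ∀ y, dY i j (dY h i y) = 0)
    (hinj : ∀ i, Function.Injective (f i)) (Fil : ℕ → ∀ i, Submodule k (Y i))
    (hF : ∀ i, Fil 0 i = ⊤) (N : ℕ) (hN : ∀ i, Fil N i = ⊥) (σ : ∀ i j, Y j →ₗ[k] Y i)
    (π : ∀ i, Y i →ₗ[k] X i) (hσ : ∀ i j, i + 1 = j → ∀ x, σ i j (f j x) = 0)
    (step : ∀ s h i j, h + 1 = i → i + 1 = j → ∀ y ∈ Fil s i,
      y - dY h i (σ h i y) - σ i j (dY i j y) - f i (π i y) ∈ Fil (s + 1) i) :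
    ConeExact dX dY f := by
  -- Induction on the number r of filtration steps left. Because d y = f x and σ f = 0, the element
  -- y - d σ y - f π y lies one step deeper, and it satisfies the same equation with x - d π y in
  -- place of x.
  have key (r : ℕ) : ∀ s : ℕ, s + r = N → ∀ h i j : ℤ, h + 1 = i → i + 1 = j →
      ∀ (x : X j) (y : Y i), y ∈ Fil s i → f j x = dY i j y →
      ∃ (x' : X i) (y' : Y h), f i x' + dY h i y' = y := by
    induction r with
    | zero =>
      rintro s rfl h i j hi hj x y hy -
      rw [add_zero] at hN
      rw [hN, Submodule.mem_bot] at hy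
      exact ⟨0, 0, by rw [hy, map_zero, map_zero, add_zero]⟩
    | succ r ih =>
      intro s hs h i j hi hj x y hy hxy
      have h1 := step s h i j hi hj y hy
      rw [← hxy, hσ i j hj, sub_zero] at h1
      obtain ⟨x', y', e⟩ := ih (s + 1) (by lia) h i j hi hj (x - dX i j (π i y)) _ h1 (by
        rw [map_sub, map_sub, map_sub, hd h i j hi hj, sub_zero, hxy, hf i j hj])
      refine ⟨x' + π i y, y' + σ h i y, ?_⟩
      rw [map_add, map_add, add_add_add_comm, e]
      abel
  intro h i j l hi hj hl x y hx hy
  obtain ⟨x', y', e⟩ := key N 0 (zero_add N) h i j hi hj x y (by rw [hF]; trivial) hy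
  -- The equation d x' = x was not carried along; it follows from injectivity, both sides having the
  -- image d y under f.
  refine ⟨x', y', hinj j ?_, e⟩
  rw [hf i j hj, hy, ← e, map_add, hd h i j hi hj, add_zero]

end Filtration

/-! ### Free positions, pivots and ranks -/

section Pivot

variable {n : ℕ} (F H₃ H₂ H₁ : Finset (Fin n))

/-- The positions at which the index `(H₃, H₂, H₁)` can be altered without changing `H₁`. -/
def IsFree (i : Fin n) : Prop := (i ∉ H₁ ∧ i ∉ H₃) ∨ (i ∈ H₁ ∧ i ∉ F)

/-- The smallest free position. -/
def IsPivot (i : Fin n) : Prop := IsFree F H₃ H₁ i ∧ ∀ l, IsFree F H₃ H₁ l → i ≤ l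

/-- The free positions which are occupied. -/
def occupied : Finset (Fin n) := H₂ ∪ (H₁ ∩ H₃)

open scoped Classical in
/-- The order of the index `(H₃, H₂, H₁)` in the filtration. -/
def rank : ℕ := (2 * H₁.card + (H₃ \ H₁).card) * (n + 1) +
  ((occupied H₃ H₂ H₁).filter fun i => ¬ IsPivot F H₃ H₁ i).card

/-- The third component after occupying the position `i`. -/
def up₃ (i : Fin n) : Finset (Fin n) := if i ∈ H₁ then insert i H₃ else H₃

/-- The second component after occupying the position `i`. -/
def up₂ (i : Fin n) : Finset (Fin n) := if i ∈ H₁ then H₂ else insert i H₂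

/-- The third component after freeing the position `i`. -/
def down₃ (i : Fin n) : Finset (Fin n) := if i ∈ H₁ then H₃.erase i else H₃

/-- The second component after freeing the position `i`. -/
def down₂ (i : Fin n) : Finset (Fin n) := if i ∈ H₁ then H₂ else H₂.erase i

/-- The exponent of the sign of the component of the differential that occupies `i`. -/
def pivotExp (t : ℤ) (i : Fin n) : ℤ := if i ∈ H₁ then beta i H₃ else t + beta i H₂

variable {F H₃ H₂ H₁}

lemma exists_isPivot {i : Fin n} (h : IsFree F H₃ H₁ i) : ∃ i, IsPivot F H₃ H₁ i := by
  classical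
  have hne : (Finset.univ.filter (IsFree F H₃ H₁)).Nonempty := ⟨i, by simpa using h⟩
  refine ⟨_, (Finset.mem_filter.1 (Finset.min'_mem _ hne)).2, fun l hl => ?_⟩
  exact Finset.min'_le _ _ (by simpa using hl)

lemma IsPivot.unique {i j : Fin n} (hi : IsPivot F H₃ H₁ i) (hj : IsPivot F H₃ H₁ j) : i = j :=
  le_antisymm (hi.2 j hj.1) (hj.2 i hi.1)

/-- Freeness of a position of H₁ does not involve H₃, and H₃ is altered only inside H₁. So occupying
or freeing a position leaves the pivot where it was. -/
lemma isFree_up₃ (i : Fin n) : IsFree F (up₃ H₃ H₁ i) H₁ = IsFree F H₃ H₁ := by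
  funext l
  unfold IsFree up₃
  split_ifs with h
  · rw [Finset.mem_insert]
    by_cases hl : l = i
    · subst hl; simp [h]
    · simp [hl]
  · rfl

lemma isFree_down₃ (i : Fin n) : IsFree F (down₃ H₃ H₁ i) H₁ = IsFree F H₃ H₁ := by
  funext l
  unfold IsFree down₃
  split_ifs with h
  · rw [Finset.mem_erase]
    by_cases hl : l = i
    · subst hl; simp [h]
    · simp [hl]
  · rfl

lemma isPivot_up₃ (i : Fin n) : IsPivot F (up₃ H₃ H₁ i) H₁ = IsPivot F H₃ H₁ := by
  unfold IsPivot; rw [isFree_up₃]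

lemma isPivot_down₃ (i : Fin n) : IsPivot F (down₃ H₃ H₁ i) H₁ = IsPivot F H₃ H₁ := by
  unfold IsPivot; rw [isFree_down₃]

lemma beta_erase_self (i : Fin n) (H : Finset (Fin n)) : beta i (H.erase i) = beta i H := by
  by_cases h : i ∈ H
  · rw [beta_erase h, if_neg (lt_irrefl i), add_zero]
  · rw [Finset.erase_eq_of_notMem h]

lemma beta_insert_self (i : Fin n) (H : Finset (Fin n)) : beta i (insert i H) = beta i H := by
  rw [← beta_erase_self, Finset.erase_insert_eq_erase, beta_erase_self]

lemma pivotExp_up (t : ℤ) (i : Fin n) :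
    pivotExp (up₃ H₃ H₁ i) (up₂ H₂ H₁ i) H₁ t i = pivotExp H₃ H₂ H₁ t i := by
  unfold pivotExp up₃ up₂
  split_ifs <;> rw [beta_insert_self]

lemma pivotExp_down (t : ℤ) (i : Fin n) :
    pivotExp (down₃ H₃ H₁ i) (down₂ H₂ H₁ i) H₁ t i = pivotExp H₃ H₂ H₁ t i := by
  unfold pivotExp down₃ down₂
  split_ifs <;> rw [beta_erase_self]

lemma mem_occupied_iff {i : Fin n} (h₁ : Disjoint H₁ H₂) :
    i ∈ occupied H₃ H₂ H₁ ↔ if i ∈ H₁ then i ∈ H₃ else i ∈ H₂ := by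
  unfold occupied
  rw [Finset.mem_union, Finset.mem_inter]
  split_ifs with h
  · have := Finset.disjoint_left.1 h₁ h
    simp [h, this]
  · simp [h]

lemma up_down {i : Fin n} (h₁ : Disjoint H₁ H₂) (hi : i ∈ occupied H₃ H₂ H₁) :
    up₃ (down₃ H₃ H₁ i) H₁ i = H₃ ∧ up₂ (down₂ H₂ H₁ i) H₁ i = H₂ := by
  rw [mem_occupied_iff h₁] at hi
  unfold up₃ up₂ down₃ down₂
  split_ifs at hi ⊢
  · exact ⟨Finset.insert_erase hi, rfl⟩
  · exact ⟨rfl, Finset.insert_erase hi⟩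

lemma down_up {i : Fin n} (h₁ : Disjoint H₁ H₂) (hi : i ∉ occupied H₃ H₂ H₁) :
    down₃ (up₃ H₃ H₁ i) H₁ i = H₃ ∧ down₂ (up₂ H₂ H₁ i) H₁ i = H₂ := by
  rw [mem_occupied_iff h₁] at hi
  unfold up₃ up₂ down₃ down₂
  split_ifs at hi ⊢
  · exact ⟨Finset.erase_insert hi, rfl⟩
  · exact ⟨rfl, Finset.erase_insert hi⟩

lemma occupied_up (i : Fin n) : 
    occupied (up₃ H₃ H₁ i) (up₂ H₂ H₁ i) H₁ = insert i (occupied H₃ H₂ H₁) := by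
  unfold occupied up₃ up₂
  ext l
  split_ifs with h
  · simp only [Finset.mem_union, Finset.mem_inter, Finset.mem_insert]
    by_cases hl : l = i
    · subst hl; simp [h]
    · simp [hl]
  · simp only [Finset.mem_union, Finset.mem_inter, Finset.mem_insert]
    tauto

lemma up₃_sdiff (i : Fin n) : up₃ H₃ H₁ i \ H₁ = H₃ \ H₁ := by
  unfold up₃
  split_ifs with h
  · exact Finset.insert_sdiff_of_mem _ h
  · rfl

/-- The leading part of the rank ignores H₂ and H₁ ∩ H₃, and the second part does not count the
pivot. So the pivot component of the differential belongs to the associated graded complex and can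
be inverted there. -/
lemma rank_up {i : Fin n} (hi : IsPivot F H₃ H₁ i) :
    rank F (up₃ H₃ H₁ i) (up₂ H₂ H₁ i) H₁ = rank F H₃ H₂ H₁ := by
  unfold rank
  rw [up₃_sdiff, occupied_up, isPivot_up₃, Finset.filter_insert, if_neg (not_not.2 hi)]

/-- The second part of the rank is at most n, below the weight n + 1 of the first, so ranks compare
lexicographically. -/
lemma rank_lt_of_lt {F H₃ H₂ H₁ H₃' H₂' H₁' : Finset (Fin n)}
    (h : 2 * H₁.card + (H₃ \ H₁).card < 2 * H₁'.card + (H₃' \ H₁').card) :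
    rank F H₃ H₂ H₁ < rank F H₃' H₂' H₁' := by
  classical
  unfold rank
  have h1 : ((occupied H₃ H₂ H₁).filter fun i => ¬ IsPivot F H₃ H₁ i).card < n + 1 :=
    Nat.lt_succ_of_le ((Finset.card_le_univ _).trans (Fintype.card_fin n).le)
  have h2 := Nat.mul_le_mul_right (n + 1) (Nat.succ_le_of_lt h)
  rw [Nat.succ_mul] at h2
  lia

/-- Makes the rank filtration finite; 3n bounds 2 #H₁ + #(H₃ ∖ H₁). -/
lemma rank_lt_bound : rank F H₃ H₂ H₁ < (3 * n + 1) * (n + 1) := by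
  classical
  unfold rank
  have h1 : ((occupied H₃ H₂ H₁).filter fun i => ¬ IsPivot F H₃ H₁ i).card < n + 1 :=
    Nat.lt_succ_of_le ((Finset.card_le_univ _).trans (Fintype.card_fin n).le)
  have h2 : H₁.card ≤ n := (Finset.card_le_univ _).trans (Fintype.card_fin n).le
  have h3 : (H₃ \ H₁).card ≤ n := (Finset.card_le_univ _).trans (Fintype.card_fin n).le
  have h4 := Nat.mul_le_mul_right (n + 1) (show 2 * H₁.card + (H₃ \ H₁).card ≤ 3 * n by lia)
  rw [Nat.succ_mul]
  lia

/-- This is why #H₁ has weight 2: removing j from H₁ may enlarge H₃ ∖ H₁ by one element. -/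
lemma rank_erase₁ {j : Fin n} (hj : j ∈ H₁) : rank F H₃ H₂ (H₁.erase j) < rank F H₃ H₂ H₁ := by
  apply rank_lt_of_lt
  have h1 := Finset.card_erase_add_one hj
  have h2 : (H₃ \ H₁.erase j).card ≤ (H₃ \ H₁).card + 1 := by
    refine (Finset.card_le_card ?_).trans (Finset.card_insert_le j _)
    intro l
    simp only [Finset.mem_sdiff, Finset.mem_erase, Finset.mem_insert]
    tauto
  lia

lemma rank_erase₂ {j : Fin n} (hj : j ∈ H₂) (h₂ : Disjoint H₂ H₃) (hp : ¬ IsPivot F H₃ H₁ j) :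
    rank F H₃ (H₂.erase j) H₁ < rank F H₃ H₂ H₁ := by
  classical
  unfold rank
  refine Nat.add_lt_add_left (Finset.card_lt_card ((Finset.ssubset_iff_of_subset ?_).2 ⟨j, ?_, ?_⟩)) _
  · refine Finset.filter_subset_filter _ ?_
    exact Finset.union_subset_union_left (Finset.erase_subset _ _)
  · exact Finset.mem_filter.2 ⟨Finset.mem_union_left _ hj, hp⟩
  · intro h
    have := (Finset.mem_filter.1 h).1
    have h3 := Finset.disjoint_left.1 h₂ hj
    simp [occupied, h3] at this

/-- If j ∈ H₁, the pivot stays and j drops out of the occupied non-pivot positions. If j ∉ H₁, the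
pivot may move, but H₃ ∖ H₁ shrinks, and this outweighs any change in the second part. -/
lemma rank_erase₃ {j : Fin n} (hj : j ∈ H₃) (h₂ : Disjoint H₂ H₃)
    (hp : j ∈ H₁ → ¬ IsPivot F H₃ H₁ j) : rank F (H₃.erase j) H₂ H₁ < rank F H₃ H₂ H₁ := by
  classical
  by_cases hj₁ : j ∈ H₁
  · have e1 : H₃.erase j \ H₁ = H₃ \ H₁ := by
      ext l
      simp only [Finset.mem_sdiff, Finset.mem_erase]
      constructor
      · tauto
      · rintro ⟨h, h'⟩
        exact ⟨⟨fun e => h' (e ▸ hj₁), h⟩, h'⟩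
    have e2 : IsPivot F (H₃.erase j) H₁ = IsPivot F H₃ H₁ := by
      have := isPivot_down₃ (F := F) (H₃ := H₃) (H₁ := H₁) j
      rwa [down₃, if_pos hj₁] at this
    unfold rank
    rw [e1, e2]
    refine Nat.add_lt_add_left
      (Finset.card_lt_card ((Finset.ssubset_iff_of_subset ?_).2 ⟨j, ?_, ?_⟩)) _
    · refine Finset.filter_subset_filter _ ?_
      exact Finset.union_subset_union_right (Finset.inter_subset_inter_left (Finset.erase_subset _ _))
    · exact Finset.mem_filter.2 ⟨Finset.mem_union_right _ (Finset.mem_inter.2 ⟨hj₁, hj⟩), hp hj₁⟩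
    · intro h
      have := (Finset.mem_filter.1 h).1
      have h3 := Finset.disjoint_right.1 h₂ hj
      simp [occupied, h3] at this
  · apply rank_lt_of_lt
    have : H₃.erase j \ H₁ ⊂ H₃ \ H₁ := by
      refine (Finset.ssubset_iff_of_subset ?_).2 ⟨j, by simp [hj, hj₁], by simp⟩
      exact Finset.sdiff_subset_sdiff (Finset.erase_subset _ _) subset_rfl
    exact Nat.add_lt_add_left (Finset.card_lt_card this) _

end Pivot

/-! ### The contracting homotopy on the threefold iterate -/

section Homotopy

variable {k : Type u} [Field k] {n : ℕ} {X : CochainComplex (Cube k n) ℤ} {t : ℤ}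
  {F : Finset (Fin n)}

/-- The elements of `Tri X t F` whose components of rank less than `s` vanish. -/
def triFil (X : CochainComplex (Cube k n) ℤ) (F : Finset (Fin n)) (s : ℕ) (t : ℤ) :
    Submodule k (Tri X t F) where
  carrier := {y | ∀ p : TriIdx n t F, rank F p.H₃ p.H₂ p.H₁ < s → y p = 0}
  add_mem' hx hy p hp := by rw [Pi.add_apply, hx p hp, hy p hp, add_zero]
  zero_mem' _ _ := rfl
  smul_mem' c x hx p hp := by rw [Pi.smul_apply, hx p hp, smul_zero]

lemma c_eq_zero {s : ℕ} {y : Tri X t F} (hy : y ∈ triFil X F s t) {H₃ H₂ H₁ : Finset (Fin n)}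
    (h : rank F H₃ H₂ H₁ < s) (q : ℤ) : y.c H₃ H₂ H₁ q = 0 := by
  unfold Tri.c
  split_ifs with h'
  · exact hy _ h
  · rfl

open scoped Classical in
/-- The homotopy that undoes the component of the differential occupying the pivot. -/
def Tri.σ (t t' : ℤ) : Tri X t' F →ₗ[k] Tri X t F where
  toFun y p := ∑ i, if IsPivot F p.H₃ p.H₁ i ∧ i ∉ occupied p.H₃ p.H₂ p.H₁ then
    sg k (pivotExp p.H₃ p.H₂ p.H₁ t' i) • y.c (up₃ p.H₃ p.H₁ i) (up₂ p.H₂ p.H₁ i) p.H₁ p.q else 0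
  map_add' x y := by
    funext p
    rw [Pi.add_apply, ← Finset.sum_add_distrib]
    refine Finset.sum_congr rfl fun i _ => ?_
    split_ifs
    · rw [Tri.c_add, smul_add]
    · exact (add_zero _).symm
  map_smul' a x := by
    funext p
    rw [Pi.smul_apply, RingHom.id_apply, Finset.smul_sum]
    refine Finset.sum_congr rfl fun i _ => ?_
    split_ifs
    · rw [Tri.c_smul, smul_comm]
    · exact (smul_zero _).symm

open scoped Classical in
lemma Tri.σ_apply {t t' : ℤ} (y : Tri X t' F) (p : TriIdx n t F) : Tri.σ t t' y p =
    ∑ i, if IsPivot F p.H₃ p.H₁ i ∧ i ∉ occupied p.H₃ p.H₂ p.H₁ then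
      sg k (pivotExp p.H₃ p.H₂ p.H₁ t' i) •
        y.c (up₃ p.H₃ p.H₁ i) (up₂ p.H₂ p.H₁ i) p.H₁ p.q else 0 := rfl

lemma Tri.σ_of_pivot {t t' : ℤ} (y : Tri X t' F) (p : TriIdx n t F) {i : Fin n}
    (hi : IsPivot F p.H₃ p.H₁ i) (hi' : i ∉ occupied p.H₃ p.H₂ p.H₁) :
    Tri.σ t t' y p = sg k (pivotExp p.H₃ p.H₂ p.H₁ t' i) •
      y.c (up₃ p.H₃ p.H₁ i) (up₂ p.H₂ p.H₁ i) p.H₁ p.q := by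
  refine (Finset.sum_eq_single i (fun j _ hj => if_neg fun h => hj (h.1.unique hi))
    (fun h => absurd (Finset.mem_univ i) h)).trans (if_pos ⟨hi, hi'⟩)

lemma Tri.σ_of_forall {t t' : ℤ} (y : Tri X t' F) (p : TriIdx n t F)
    (h : ∀ i, IsPivot F p.H₃ p.H₁ i → i ∈ occupied p.H₃ p.H₂ p.H₁) : Tri.σ t t' y p = 0 := by
  rw [Tri.σ_apply]
  exact Finset.sum_eq_zero fun i _ => if_neg fun h' => h'.2 (h i h'.1)

lemma Tri.σ_mem {t t' : ℤ} {s : ℕ} {y : Tri X t' F} (hy : y ∈ triFil X F s t') :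
    Tri.σ t t' y ∈ triFil X F s t := by
  intro p hp
  rw [Tri.σ_apply]
  refine Finset.sum_eq_zero fun i _ => ?_
  split_ifs with h
  · rw [c_eq_zero hy (by rwa [rank_up h.1]), smul_zero]
  · rfl

/-- The homotopy reads only components whose pivot is occupied, while nothing is occupied at the
indices (Kᶜ, ∅, K) supporting the image of `etaTri`. -/
lemma Tri.σ_etaTri {t t' : ℤ} (m : (X.X (t' + 2 * n)).obj F) : Tri.σ t t' (etaTri m) = 0 := by
  funext p
  rw [Tri.σ_apply]
  refine Finset.sum_eq_zero fun i _ => ?_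
  split_ifs with h
  · rw [etaTri_c, if_neg, smul_zero]
    unfold up₂ up₃
    split_ifs with hi
    · rintro ⟨-, e⟩
      have h1 := Finset.mem_insert_self i p.H₃
      rw [e, Finset.mem_compl] at h1
      exact h1 hi
    · rintro ⟨e, -⟩
      exact Finset.insert_ne_empty _ _ e
  · rfl

lemma Tri.d_apply {t' : ℤ} (ht : t + 1 = t') (y : Tri X t F) (p : TriIdx n t' F) :
    Tri.d ht y p = sg k (t' + n + p.H₂.card) •
      (X.d (p.q - 1) p.q).app p.H₁ (y.c p.H₃ p.H₂ p.H₁ (p.q - 1)) +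
    ∑ j ∈ p.H₁, sg k (n + p.H₃.card + beta j p.H₁) •
      (X.X p.q).map (homOfLE (Finset.erase_subset j p.H₁)) (y.c p.H₃ p.H₂ (p.H₁.erase j) p.q) +
    ∑ j ∈ p.H₂, sg k (t' + beta j p.H₂) • y.c p.H₃ (p.H₂.erase j) p.H₁ p.q +
    ∑ j ∈ p.H₃, sg k (beta j p.H₃) • y.c (p.H₃.erase j) p.H₂ p.H₁ p.q := rfl

section

variable {t' : ℤ} (ht : t + 1 = t') {s : ℕ} {z : Tri X t F} (hz : z ∈ triFil X F s t)
  (p : TriIdx n t' F) (hp : rank F p.H₃ p.H₂ p.H₁ ≤ s)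

include hz hp in
-- At an index of rank at most s, an element of the s-th filtration step contributes nothing through
-- the parts of the differential that strictly raise the rank. This and the next two lemmas treat
-- the three sums in turn.
lemma sum_erase₁_eq_zero : ∑ j ∈ p.H₁, sg k (n + p.H₃.card + beta j p.H₁) •
    (X.X p.q).map (homOfLE (Finset.erase_subset j p.H₁)) (z.c p.H₃ p.H₂ (p.H₁.erase j) p.q) = 0 :=
  Finset.sum_eq_zero fun j hj => by
    rw [c_eq_zero hz ((rank_erase₁ hj).trans_le hp), map_zero, smul_zero]

include hz hp in
lemma sum_erase₂_eq_zero (h : ∀ i, IsPivot F p.H₃ p.H₁ i → i ∉ p.H₂) :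
    ∑ j ∈ p.H₂, sg k (t' + beta j p.H₂) • z.c p.H₃ (p.H₂.erase j) p.H₁ p.q = 0 :=
  Finset.sum_eq_zero fun j hj => by
    rw [c_eq_zero hz ((rank_erase₂ hj p.disj₂ fun h' => h j h' hj).trans_le hp), smul_zero]

include hz hp in
lemma sum_erase₃_eq_zero (h : ∀ i, IsPivot F p.H₃ p.H₁ i → i ∈ p.H₁ → i ∉ p.H₃) :
    ∑ j ∈ p.H₃, sg k (beta j p.H₃) • z.c (p.H₃.erase j) p.H₂ p.H₁ p.q = 0 :=
  Finset.sum_eq_zero fun j hj => by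
    rw [c_eq_zero hz ((rank_erase₃ hj p.disj₂ fun h1 h' => h j h' h1 hj).trans_le hp), smul_zero]

include hz hp in
lemma d_of_forall (h : ∀ i, IsPivot F p.H₃ p.H₁ i → i ∉ occupied p.H₃ p.H₂ p.H₁) :
    Tri.d ht z p = sg k (t' + n + p.H₂.card) •
      (X.d (p.q - 1) p.q).app p.H₁ (z.c p.H₃ p.H₂ p.H₁ (p.q - 1)) := by
  rw [Tri.d_apply, sum_erase₁_eq_zero hz p hp, sum_erase₂_eq_zero hz p hp, sum_erase₃_eq_zero hz p hp,
    add_zero, add_zero, add_zero]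
  · intro i hi hi₁ hi₃
    exact h i hi (Finset.mem_union_right _ (Finset.mem_inter.2 ⟨hi₁, hi₃⟩))
  · intro i hi hi₂
    exact h i hi (Finset.mem_union_left _ hi₂)

include hz hp in
-- Among the terms that add an element to one of the sets, only the one that occupies the pivot
-- preserves the rank.
lemma d_of_pivot {i : Fin n} (hi : IsPivot F p.H₃ p.H₁ i) (hi' : i ∈ occupied p.H₃ p.H₂ p.H₁) :
    Tri.d ht z p = sg k (t' + n + p.H₂.card) •
      (X.d (p.q - 1) p.q).app p.H₁ (z.c p.H₃ p.H₂ p.H₁ (p.q - 1)) +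
    sg k (pivotExp p.H₃ p.H₂ p.H₁ t' i) • z.c (down₃ p.H₃ p.H₁ i) (down₂ p.H₂ p.H₁ i) p.H₁ p.q := by
  rw [mem_occupied_iff p.disj₁] at hi'
  rw [Tri.d_apply, sum_erase₁_eq_zero hz p hp, add_zero]
  unfold pivotExp down₃ down₂
  split_ifs at hi' ⊢ with hi₁
  · rw [sum_erase₂_eq_zero hz p hp, add_zero]
    · congr 1
      refine Finset.sum_eq_single i (fun j hj hji => ?_) (fun h => absurd hi' h)
      rw [c_eq_zero hz ((rank_erase₃ hj p.disj₂ fun _ h' => hji (h'.unique hi)).trans_le hp),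
        smul_zero]
    · intro j hj
      rw [hj.unique hi]
      exact Finset.disjoint_left.1 p.disj₁ hi₁
  · rw [sum_erase₃_eq_zero hz p hp, add_zero]
    · congr 1
      refine Finset.sum_eq_single i (fun j hj hji => ?_) (fun h => absurd hi' h)
      rw [c_eq_zero hz ((rank_erase₂ hj p.disj₂ fun h' => hji (h'.unique hi)).trans_le hp),
        smul_zero]
    · intro j hj hj₁
      rw [hj.unique hi] at hj₁
      exact absurd hj₁ hi₁

end

/-- The leading component. -/
def Tri.π (t : ℤ) : Tri X t F →ₗ[k] (X.X (t + 2 * n)).obj F where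
  toFun y := sg k (etaExp t F) • y.c Fᶜ ∅ F (t + 2 * n)
  map_add' x y := by rw [Tri.c_add, smul_add]
  map_smul' a x := by rw [Tri.c_smul, smul_comm]; rfl

lemma subset_of_compl {p : TriIdx n t F} (h : p.H₃ = p.H₁ᶜ) : F ⊆ p.H₁ := by
  intro i hi
  have h5 := Finset.disjoint_right.1 p.disj₃ hi
  rwa [h, Finset.mem_compl, not_not] at h5

/-- A pivot at (Kᶜ, ∅, K) forces F ⊊ K. The leading part of the rank is n + #F at (Fᶜ, ∅, F) and n +
#K at (Kᶜ, ∅, K), so the component read by `Tri.π` has rank below s and vanishes. -/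
lemma etaTri_π_eq_zero {s : ℕ} {y : Tri X t F} (hy : y ∈ triFil X F s t) (p : TriIdx n t F)
    (hp : rank F p.H₃ p.H₂ p.H₁ ≤ s) {i : Fin n} (hi : IsPivot F p.H₃ p.H₁ i) :
    etaTri (Tri.π t y) p = 0 := by
  rw [etaTri_apply]
  split_ifs with hc
  · have hF := subset_of_compl hc.2
    have hne : F ≠ p.H₁ := by
      intro e
      have h1 := hi.1
      unfold IsFree at h1
      rw [hc.2, ← e, Finset.mem_compl] at h1
      tauto
    have h0 : Tri.π t y = 0 := by
      have : rank F Fᶜ ∅ F < rank F p.H₃ p.H₂ p.H₁ := by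
        apply rank_lt_of_lt
        have h1 := Finset.card_lt_card (Finset.ssubset_iff_subset_ne.2 ⟨hF, hne⟩)
        have h2 : (Fᶜ \ F) = Fᶜ := Finset.sdiff_eq_self_of_disjoint disjoint_compl_left
        have h3 : (p.H₁ᶜ \ p.H₁) = p.H₁ᶜ := Finset.sdiff_eq_self_of_disjoint disjoint_compl_left
        have h4 := Finset.card_add_card_compl F
        have h5 := Finset.card_add_card_compl p.H₁
        rw [hc.2, h2, h3]
        lia
      change sg k (etaExp t F) • y.c Fᶜ ∅ F (t + 2 * n) = 0
      rw [c_eq_zero hy (this.trans_le hp), smul_zero]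
    rw [h0]
    have h1 : pushTo (0 : (X.X (t + 2 * n)).obj F) p.q p.H₁ = 0 := by
      have := pushTo_smul (0 : k) (0 : (X.X (t + 2 * n)).obj F) p.q p.H₁
      rwa [zero_smul, zero_smul] at this
    rw [h1, smul_zero]
  · rfl

/-- Without free positions H₁ ⊆ F, and everything outside H₁ lies in H₃, hence outside F. So H₁ = F,
H₃ = Fᶜ and H₂ = ∅, the single index that the contraction leaves over. -/
lemma etaTri_π_of_forall (y : Tri X t F) (p : TriIdx n t F) (hp : ∀ i, ¬ IsPivot F p.H₃ p.H₁ i) :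
    etaTri (Tri.π t y) p = y p := by
  obtain ⟨H₃, H₂, H₁, q, h₃, h₂, h₁, h⟩ := p
  have hfree : ∀ i, ¬ IsFree F H₃ H₁ i := fun i hi => by
    obtain ⟨j, hj⟩ := exists_isPivot hi
    exact hp j hj
  unfold IsFree at hfree
  have e₁ : H₁ = F := by
    ext i
    have h1 := hfree i
    have h2 : i ∈ H₃ → i ∉ F := fun h => Finset.disjoint_left.1 h₃ h
    tauto
  subst e₁
  have e₃ : H₃ = H₁ᶜ := by
    ext i
    have h1 := hfree i
    have h2 : i ∈ H₃ → i ∉ H₁ := fun h => Finset.disjoint_left.1 h₃ h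
    rw [Finset.mem_compl]
    tauto
  subst e₃
  have e₂ : H₂ = ∅ := by
    refine Finset.eq_empty_of_forall_notMem fun i hi => ?_
    have h1 := Finset.disjoint_left.1 h₂ hi
    rw [Finset.mem_compl, not_not] at h1
    exact Finset.disjoint_left.1 h₁ h1 hi
  subst e₂
  have e : q = t + 2 * n := by
    rw [card_compl_int, Finset.card_empty] at h
    push_cast at h
    lia
  subst e
  rw [etaTri_apply, if_pos ⟨rfl, rfl⟩]
  change sg k (etaExp t H₁) • pushTo (sg k (etaExp t H₁) • y.c H₁ᶜ ∅ H₁ (t + 2 * n)) _ _ = _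
  rw [pushTo_self, sg_smul_self, Tri.c_of y h₃ h₂ h₁ h]

lemma up_valid {p : TriIdx n t F} {i : Fin n} (hi : IsFree F p.H₃ p.H₁ i)
    (hi' : i ∉ occupied p.H₃ p.H₂ p.H₁) {t' : ℤ} (ht : t + 1 = t') :
    Disjoint (up₃ p.H₃ p.H₁ i) F ∧ Disjoint (up₂ p.H₂ p.H₁ i) (up₃ p.H₃ p.H₁ i) ∧
      Disjoint p.H₁ (up₂ p.H₂ p.H₁ i) ∧
      p.q + p.H₁.card + (up₂ p.H₂ p.H₁ i).card + (up₃ p.H₃ p.H₁ i).card = t' + n + n + n := by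
  have hdeg := p.deg
  rw [mem_occupied_iff p.disj₁] at hi'
  unfold IsFree at hi
  unfold up₂ up₃
  split_ifs at hi' ⊢ with h
  · refine ⟨?_, ?_, p.disj₁, ?_⟩
    · rw [Finset.disjoint_insert_left]
      exact ⟨by tauto, p.disj₃⟩
    · rw [Finset.disjoint_insert_right]
      exact ⟨Finset.disjoint_left.1 p.disj₁ h, p.disj₂⟩
    · rw [Finset.card_insert_of_notMem hi']
      push_cast
      lia
  · refine ⟨p.disj₃, ?_, ?_, ?_⟩
    · rw [Finset.disjoint_insert_left]
      exact ⟨by tauto, p.disj₂⟩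
    · rw [Finset.disjoint_insert_right]
      exact ⟨h, p.disj₁⟩
    · rw [Finset.card_insert_of_notMem hi']
      push_cast
      lia

lemma down_valid {p : TriIdx n t F} {i : Fin n}
    (hi' : i ∈ occupied p.H₃ p.H₂ p.H₁) {t' : ℤ} (ht : t' + 1 = t) :
    Disjoint (down₃ p.H₃ p.H₁ i) F ∧ Disjoint (down₂ p.H₂ p.H₁ i) (down₃ p.H₃ p.H₁ i) ∧
      Disjoint p.H₁ (down₂ p.H₂ p.H₁ i) ∧
      p.q + p.H₁.card + (down₂ p.H₂ p.H₁ i).card + (down₃ p.H₃ p.H₁ i).card = t' + n + n + n := by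
  have hdeg := p.deg
  rw [mem_occupied_iff p.disj₁] at hi'
  unfold down₂ down₃
  split_ifs at hi' ⊢ with h
  · refine ⟨disjoint_erase_left p.disj₃ _, disjoint_erase_right p.disj₂ _, p.disj₁, ?_⟩
    rw [card_erase_int hi']
    lia
  · refine ⟨p.disj₃, disjoint_erase_left p.disj₂ _, disjoint_erase_right p.disj₁ _, ?_⟩
    rw [card_erase_int hi']
    lia

lemma not_mem_occupied_down {H₃ H₂ H₁ : Finset (Fin n)} (h₁ : Disjoint H₁ H₂) (i : Fin n) :
    i ∉ occupied (down₃ H₃ H₁ i) (down₂ H₂ H₁ i) H₁ := by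
  unfold down₃ down₂ occupied
  split_ifs with h
  · have := Finset.disjoint_left.1 h₁ h
    simp [this]
  · simp [h]

lemma σ_c_of_mem {t t' : ℤ} (y : Tri X t' F) {H₃ H₂ H₁ : Finset (Fin n)} {q : ℤ}
    {i : Fin n} (hi : IsPivot F H₃ H₁ i) (hi' : i ∈ occupied H₃ H₂ H₁) :
    (Tri.σ t t' y).c H₃ H₂ H₁ q = 0 := by
  unfold Tri.c
  split_ifs with h
  · refine Tri.σ_of_forall _ _ fun j hj => ?_
    dsimp only at hj
    rwa [hj.unique hi]
  · rfl

lemma σ_c_of_forall {t t' : ℤ} (y : Tri X t' F) {H₃ H₂ H₁ : Finset (Fin n)} {q : ℤ}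
    (hi : ∀ i, ¬ IsPivot F H₃ H₁ i) : (Tri.σ t t' y).c H₃ H₂ H₁ q = 0 := by
  unfold Tri.c
  split_ifs with h
  · exact Tri.σ_of_forall _ _ fun j hj => absurd hj (hi j)
  · rfl

section

variable {s : ℕ} {t₀ t₁ t₂ : ℤ} (h₀ : t₀ + 1 = t₁) (h₁ : t₁ + 1 = t₂) {y : Tri X t₁ F}
  (hy : y ∈ triFil X F s t₁) (p : TriIdx n t₁ F) (hp : rank F p.H₃ p.H₂ p.H₁ ≤ s)

include hy hp in
-- Freeing the pivot and occupying it again returns to p with the same sign twice; the internal term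
-- drops out because σ y vanishes where the pivot is occupied.
lemma d_σ_of_mem {i : Fin n} (hi : IsPivot F p.H₃ p.H₁ i) (hi' : i ∈ occupied p.H₃ p.H₂ p.H₁) :
    Tri.d h₀ (Tri.σ t₀ t₁ y) p = y p := by
  have hd := down_valid hi' h₀
  have e : (Tri.σ t₀ t₁ y).c (down₃ p.H₃ p.H₁ i) (down₂ p.H₂ p.H₁ i) p.H₁ p.q =
      sg k (pivotExp p.H₃ p.H₂ p.H₁ t₁ i) • y p := by
    have hpi : IsPivot F (down₃ p.H₃ p.H₁ i) p.H₁ i := by rwa [isPivot_down₃]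
    rw [Tri.c_of _ hd.1 hd.2.1 hd.2.2.1 hd.2.2.2]
    refine (Tri.σ_of_pivot y ⟨down₃ p.H₃ p.H₁ i, down₂ p.H₂ p.H₁ i, p.H₁, p.q, hd.1, hd.2.1,
      hd.2.2.1, hd.2.2.2⟩ hpi (not_mem_occupied_down p.disj₁ i)).trans ?_
    dsimp only
    rw [pivotExp_down, (up_down p.disj₁ hi').1, (up_down p.disj₁ hi').2,
      Tri.c_of y p.disj₃ p.disj₂ p.disj₁ p.deg]
  rw [d_of_pivot h₀ (Tri.σ_mem hy) p hp hi hi', σ_c_of_mem y hi hi', map_zero, smul_zero, zero_add,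
    e, sg_smul_self]

include hy hp in
lemma d_σ_of_notMem {i : Fin n} (hi : IsPivot F p.H₃ p.H₁ i)
    (hi' : i ∉ occupied p.H₃ p.H₂ p.H₁) :
    Tri.d h₀ (Tri.σ t₀ t₁ y) p = sg k (t₁ + n + p.H₂.card + pivotExp p.H₃ p.H₂ p.H₁ t₁ i) •
      (X.d (p.q - 1) p.q).app p.H₁
        (y.c (up₃ p.H₃ p.H₁ i) (up₂ p.H₂ p.H₁ i) p.H₁ (p.q - 1)) := by
  have hdeg := p.deg
  have e : (Tri.σ t₀ t₁ y).c p.H₃ p.H₂ p.H₁ (p.q - 1) =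
      sg k (pivotExp p.H₃ p.H₂ p.H₁ t₁ i) •
        y.c (up₃ p.H₃ p.H₁ i) (up₂ p.H₂ p.H₁ i) p.H₁ (p.q - 1) := by
    rw [Tri.c_of _ p.disj₃ p.disj₂ p.disj₁ (by lia)]
    exact Tri.σ_of_pivot y _ hi hi'
  rw [d_of_forall h₀ (Tri.σ_mem hy) p hp fun j hj => by rwa [hj.unique hi], e, map_smul,
    sg_smul_sg_smul]

/-- The homotopy anticommutes with the internal differential, so the terms containing the
differential of X cancel between d σ and σ d. -/
lemma pivotExp_sign {i : Fin n} (hi' : i ∉ occupied p.H₃ p.H₂ p.H₁) :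
    sg k (pivotExp p.H₃ p.H₂ p.H₁ (t₁ + 1) i + (t₁ + 1 + n + (up₂ p.H₂ p.H₁ i).card)) =
      -sg k (t₁ + n + p.H₂.card + pivotExp p.H₃ p.H₂ p.H₁ t₁ i) := by
  rw [mem_occupied_iff p.disj₁] at hi'
  unfold pivotExp up₂
  split_ifs at hi' ⊢ with h
  · exact sg_eq_neg ⟨1, by ring⟩
  · rw [Finset.card_insert_of_notMem hi']
    exact sg_eq_neg ⟨2, by push_cast; ring⟩

include hy hp in
lemma σ_d_of_notMem {i : Fin n} (hi : IsPivot F p.H₃ p.H₁ i)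
    (hi' : i ∉ occupied p.H₃ p.H₂ p.H₁) :
    Tri.σ t₁ t₂ (Tri.d h₁ y) p = y p -
      sg k (t₁ + n + p.H₂.card + pivotExp p.H₃ p.H₂ p.H₁ t₁ i) • (X.d (p.q - 1) p.q).app p.H₁
        (y.c (up₃ p.H₃ p.H₁ i) (up₂ p.H₂ p.H₁ i) p.H₁ (p.q - 1)) := by
  have hu := up_valid hi.1 hi' h₁
  have e : (Tri.d h₁ y).c (up₃ p.H₃ p.H₁ i) (up₂ p.H₂ p.H₁ i) p.H₁ p.q =
      sg k (t₂ + n + (up₂ p.H₂ p.H₁ i).card) • (X.d (p.q - 1) p.q).app p.H₁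
        (y.c (up₃ p.H₃ p.H₁ i) (up₂ p.H₂ p.H₁ i) p.H₁ (p.q - 1)) +
      sg k (pivotExp p.H₃ p.H₂ p.H₁ t₂ i) • y p := by
    rw [Tri.c_of _ hu.1 hu.2.1 hu.2.2.1 hu.2.2.2]
    refine (d_of_pivot h₁ hy _ (by dsimp only; rwa [rank_up hi]) (i := i)
      (by dsimp only; rwa [isPivot_up₃])
      (by dsimp only; rw [occupied_up]; exact Finset.mem_insert_self _ _)).trans ?_
    dsimp only
    rw [pivotExp_up, (down_up p.disj₁ hi').1, (down_up p.disj₁ hi').2,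
      Tri.c_of y p.disj₃ p.disj₂ p.disj₁ p.deg]
  rw [Tri.σ_of_pivot _ p hi hi', e, smul_add, sg_smul_self, sg_smul_sg_smul]
  subst h₁
  rw [pivotExp_sign p hi', neg_smul, neg_add_eq_sub]

include hy in
-- Modulo higher rank, y is recovered by exactly one summand at each index: by d σ if the pivot is
-- occupied, by σ d if it is not (the internal term then cancels against d σ), and by the leading
-- component if there is no pivot.
lemma homotopy_step :
    y - Tri.d h₀ (Tri.σ t₀ t₁ y) - Tri.σ t₁ t₂ (Tri.d h₁ y) - etaTri (Tri.π t₁ y) ∈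
      triFil X F (s + 1) t₁ := by
  intro p hp
  replace hp : rank F p.H₃ p.H₂ p.H₁ ≤ s := Nat.le_of_lt_succ hp
  rw [Pi.sub_apply, Pi.sub_apply, Pi.sub_apply]
  by_cases hpiv : ∃ i, IsPivot F p.H₃ p.H₁ i
  · obtain ⟨i, hi⟩ := hpiv
    rw [etaTri_π_eq_zero hy p hp hi, sub_zero]
    by_cases hi' : i ∈ occupied p.H₃ p.H₂ p.H₁
    · rw [d_σ_of_mem h₀ hy p hp hi hi', Tri.σ_of_forall _ p fun j hj => by rwa [hj.unique hi],
        sub_zero, sub_self]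
    · rw [d_σ_of_notMem h₀ hy p hp hi hi', σ_d_of_notMem h₁ hy p hp hi hi', sub_self]
  · have hpiv' : ∀ i, ¬ IsPivot F p.H₃ p.H₁ i := fun i hi => hpiv ⟨i, hi⟩
    rw [etaTri_π_of_forall y p hpiv', Tri.σ_of_forall _ p fun i hi => absurd hi (hpiv' i),
      d_of_forall h₀ (Tri.σ_mem hy) p hp fun i hi => absurd hi (hpiv' i), σ_c_of_forall y hpiv',
      map_zero, smul_zero, sub_zero, sub_zero, sub_self]

end

/-- The component with K = F is the identity up to sign. -/
lemma etaTri_injective : Function.Injective (etaTri (X := X) (t := t) (F := F)) := by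
  rw [injective_iff_map_eq_zero]
  intro m hm
  let p : TriIdx n t F := ⟨Fᶜ, ∅, F, t + 2 * n, disjoint_compl_left, Finset.disjoint_empty_left _,
    Finset.disjoint_empty_right _, by rw [card_compl_int, Finset.card_empty]; push_cast; ring⟩
  have h1 : etaTri m p = 0 := congr_fun hm p
  rw [etaTri_apply, if_pos ⟨rfl, rfl⟩] at h1
  change sg k (etaExp t F) • pushTo m (t + 2 * n) F = 0 at h1
  rw [pushTo_self] at h1
  exact (smul_eq_zero.1 h1).resolve_left (sg_ne_zero _)

lemma coneExact_etaTri : ConeExact (k := k) (X := fun t => (X.X (t + 2 * n)).obj F)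
    (Y := fun t => Tri X t F) (fun t t' => ((X.d (t + 2 * n) (t' + 2 * n)).app F).hom)
    (fun t t' => if ht : t + 1 = t' then Tri.d ht else 0) (fun _ => etaTri) := by
  refine coneExact_of_filtration ?_ ?_ (fun i => etaTri_injective) (triFil X F) ?_
    ((3 * n + 1) * (n + 1)) ?_ Tri.σ Tri.π ?_ ?_
  · intro i j hj x
    rw [dif_pos hj]
    exact (d_etaTri hj x).symm
  · intro h i j hi hj y
    rw [dif_pos hi, dif_pos hj]
    exact Tri.d_d hi hj y
  · intro i
    exact eq_top_iff.2 fun y _ p hp => absurd hp (Nat.not_lt_zero _)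
  · intro i
    exact eq_bot_iff.2 fun y hy => funext fun p => hy p rank_lt_bound
  · intro i j _ x
    exact Tri.σ_etaTri x
  · intro s h i j hi hj y hy
    rw [dif_pos hi, dif_pos hj]
    exact homotopy_step hi hj hy

lemma quasiIso_eta (X : CochainComplex (Cube k n) ℤ) (F : Finset (Fin n)) :
    QuasiIso ((vertex k F).map ((eta k n).app X)) := by
  rw [quasiIso_iff_coneExact]
  refine (coneExact_etaTri (X := X) (F := F)).of_equiv
    (fun _ => LinearEquiv.refl k _) (fun t => tri (X := X) (t := t) (F := F)) ?_ ?_ ?_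
  · intro i j hj x
    change (((shiftFunctor _ (2 * (n : ℤ))).obj X).d i j).app F x = _
    rw [CochainComplex.shiftFunctor_obj_d', Int.negOnePow_even _ (even_two_mul _), one_smul]
    rfl
  · intro i j hj x
    rw [dif_pos hj]
    exact (congr_arg (tri (X := X) (t := j) (F := F))
      (congr($(psiObj_d_app (psiObj (psiObj X)) hj F) x))).trans (tri_d hj x)
  · intro i x
    exact (tri (X := X) (t := i) (F := F)).apply_symm_apply (etaTri x)

end Homotopy

/-! ### Coordinates of maps into the dualizing complex -/

section OmegaCoord

variable {k : Type u} [Field k] {n : ℕ}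

/-- In the degrees `a ∈ ℕⁿ` the module assembled from the `ℕⁿ`-graded part of a family `X` has the
component `X_a`. -/
def truncEquiv (X : Fam k n) {a : Deg n} (ha : 0 ≤ a) :
    X.obj a ≃ₗ[k] (GrMod.components.obj ((Fam.trunc ⋙ Fam.total).obj X)).obj a :=
  LinearEquiv.ofBijective (show X.obj a →ₗ[k] LinearMap.range ((Fam.trunc.obj X).incl a) from
    { toFun x := (⟨(Fam.trunc.obj X).incl a (⟨x, Or.inl ha⟩ : X.truncSubmodule a), _, rfl⟩ :
        LinearMap.range ((Fam.trunc.obj X).incl a))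
      map_add' x y := Subtype.ext (map_add ((Fam.trunc.obj X).incl a)
        (⟨x, Or.inl ha⟩ : X.truncSubmodule a) (⟨y, Or.inl ha⟩ : X.truncSubmodule a))
      map_smul' c x := Subtype.ext (((Fam.trunc.obj X).incl a).map_smul c
        (⟨x, Or.inl ha⟩ : X.truncSubmodule a)) })
    ⟨fun x y hxy => congr_arg Subtype.val (Fam.incl_injective _ _ (congr_arg Subtype.val hxy)), by
      rintro ⟨_, ⟨x, hx⟩, rfl⟩
      exact ⟨x, rfl⟩⟩

lemma truncEquiv_map (X : Fam k n) {a b : Deg n} (ha : 0 ≤ a) (hb : 0 ≤ b) (h : a ⟶ b)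
    (x : X.obj a) :
    (GrMod.components.obj ((Fam.trunc ⋙ Fam.total).obj X)).map h (truncEquiv X ha x) =
      truncEquiv X hb (X.map h x) :=
  Subtype.ext (Fam.mon_smul_incl (Fam.trunc.obj X) (expo a b) (add_toDeg_expo (leOfHom h)) h
    (⟨x, Or.inl ha⟩ : X.truncSubmodule a))

lemma truncEquiv_app {X Y : Fam k n} (f : X ⟶ Y) {a : Deg n} (ha : 0 ≤ a) (x : X.obj a) :
    (GrMod.components.map ((Fam.trunc ⋙ Fam.total).map f)).app a (truncEquiv X ha x) =
      truncEquiv Y ha (f.app a x) :=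
  Subtype.ext (Fam.sumMap_incl (Fam.trunc.map f) a (⟨x, Or.inl ha⟩ : X.truncSubmodule a))

/-- The coordinate of index `G` of the component of degree `c` of an element of `ω^q`. -/
def omegaCoord {q : ℤ} {c : Deg n} (G : OmegaIdx q c) : ((omega k n).X q).carrier →ₗ[k] k :=
  (LinearMap.proj (R := k) (φ := fun _ : OmegaIdx q c => k) G).comp
    (DirectSum.component k (Deg n) (fun a => (omegaFam k q).obj a) c)

lemma omegaCoord_incl {q : ℤ} {c : Deg n} (G : OmegaIdx q c) (φ : OmegaIdx q c → k) :
    omegaCoord G ((omegaFam k q).incl c φ) = φ G :=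
  congr_fun (DirectSum.component.lof_self (R := k) (M := fun a => (omegaFam k (n := n) q).obj a) c φ)
    G

lemma omegaCoord_mon_smul {q : ℤ} {c c' : Deg n} (h : c ≤ c') (b : Fin n →₀ ℕ)
    (hb : c + toDeg b = c') (G : OmegaIdx q c')
    {y : ((omega k n).X q).carrier} (hy : y ∈ ((omega k n).X q).gr c) :
    omegaCoord G (mon k b • y) =
      omegaCoord (⟨G.1, G.2.1, (supp_mono h).trans G.2.2⟩ : OmegaIdx q c) y := by
  obtain ⟨φ, rfl⟩ := hy
  refine (congr_arg (omegaCoord G) (Fam.mon_smul_incl (omegaFam k q) b hb (homOfLE h) φ)).trans ?_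
  exact (omegaCoord_incl G _).trans (omegaCoord_incl _ φ).symm

lemma eq_of_omegaCoord {q : ℤ} {c : Deg n} {y y' : ((omega k n).X q).carrier}
    (hy : y ∈ ((omega k n).X q).gr c) (hy' : y' ∈ ((omega k n).X q).gr c)
    (h : ∀ G : OmegaIdx q c, omegaCoord G y = omegaCoord G y') : y = y' := by
  obtain ⟨φ, rfl⟩ := hy
  obtain ⟨ψ, rfl⟩ := hy'
  have : φ = ψ := funext fun G =>
    (omegaCoord_incl G φ).symm.trans ((h G).trans (omegaCoord_incl G ψ))
  rw [this]

lemma omegaCoord_d {q q' : ℤ} (hq : q + 1 = q') {c : Deg n} (G : OmegaIdx q' c)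
    {y : ((omega k n).X q).carrier} (hy : y ∈ ((omega k n).X q).gr c) :
    omegaCoord G (GrMod.lin ((omega k n).d q q') y) = ∑ j : {j : Fin n // j ∉ G.1},
      (-1 : k) ^ alpha j.1 (insert j.1 G.1) * omegaCoord (OmegaIdx.insert hq G j) y := by
  obtain ⟨φ, rfl⟩ := hy
  have h1 : (omegaFamComplex k (n := n)).d q q' = omegaD k q q' hq := dif_pos hq
  have h2 : GrMod.lin ((omega k n).d q q') ((omegaFam k q).incl c φ) =
      (omegaFam k q').incl c (omegaDLin k q q' hq c φ) := by
    refine (Fam.sumMap_incl ((omegaFamComplex k (n := n)).d q q') c φ).trans ?_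
    rw [h1]
    rfl
  refine (congr_arg (omegaCoord G) h2).trans
    ((omegaCoord_incl G (omegaDLin k q q' hq c φ)).trans ?_)
  have h3 : omegaDLin k q q' hq c φ G = ∑ j : {j : Fin n // j ∉ G.1},
      (-1 : k) ^ alpha j.1 (insert j.1 G.1) * φ (OmegaIdx.insert hq G j) := rfl
  rw [h3]
  refine Finset.sum_congr rfl fun j _ => ?_
  exact congr_arg ((-1 : k) ^ alpha j.1 (insert j.1 G.1) * ·) (omegaCoord_incl _ φ).symm

lemma add_mono (a : Deg n) {b c : Deg n} (h : b ≤ c) : a + b ≤ a + c :=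
  fun i => add_le_add_right (h i) (a i)

/-- The index `G` of a component of `ω^q` that is nonzero in degree `F + b`. -/
def omegaIdx {q : ℤ} {F G : Finset (Fin n)} {b : Deg n} (hb : 0 ≤ b) (hc : (G.card : ℤ) = -q)
    (hF : F ⊆ G) (hG : supp b ⊆ G) : OmegaIdx q (sqf F + b) :=
  ⟨G, hc, by
    rw [add_comm, supp_add_sqf hb]
    exact Finset.union_subset hG hF⟩

/-- The functional on `M_G` defined by a morphism `M → ω^q(F)`, for `F ⊆ G` and `#G = -q`. -/
def homCoord {M : GrMod k n} {q : ℤ} {F : Finset (Fin n)}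
    (f : M ⟶ ((omega k n).X q).twist (sqf F)) {G : Finset (Fin n)} (hc : (G.card : ℤ) = -q)
    (hF : F ⊆ G) : Module.Dual k ((GrMod.components.obj M).obj (sqf G)) :=
  (omegaCoord (omegaIdx (sqf_nonneg G) hc hF (supp_sqf G).le)).comp
    (((GrMod.lin f).restrictScalars k).comp (M.gr (sqf G)).subtype)

lemma homCoord_apply {M : GrMod k n} {q : ℤ} {F : Finset (Fin n)}
    (f : M ⟶ ((omega k n).X q).twist (sqf F)) {G : Finset (Fin n)} (hc : (G.card : ℤ) = -q)
    (hF : F ⊆ G) (y : (GrMod.components.obj M).obj (sqf G)) :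
    homCoord f hc hF y =
      omegaCoord (omegaIdx (sqf_nonneg G) hc hF (supp_sqf G).le) (GrMod.lin f y.1) := rfl

/-- The degrees b and G are compared in their sum b + G: multiplication does not change the
coordinate G in ω, and in M it characterizes `retr`. Thus a map to ω^q(F) is determined by its
functionals on the spaces M_G with #G = -q. -/
lemma omegaCoord_lin {M : GrMod k n} (hM : IsSquarefree k n M) {q : ℤ} {F : Finset (Fin n)}
    (f : M ⟶ ((omega k n).X q).twist (sqf F)) {G : Finset (Fin n)} (hc : (G.card : ℤ) = -q)
    (hF : F ⊆ G) {b : Deg n} (hb : 0 ≤ b) (hG : supp b ⊆ G)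
    (y : (GrMod.components.obj M).obj b) :
    omegaCoord (omegaIdx hb hc hF hG) (GrMod.lin f y.1) = homCoord f hc hF (retr hM hb hG y) := by
  have h1 := congr_arg Subtype.val (congr($(retr_comp_map hM hb hG) y))
  have hbG : 0 ≤ b + sqf G := hb.trans (le_add_sqf b G)
  have hG' : supp (b + sqf G) ⊆ G := by
    rw [supp_add_sqf hb]
    exact Finset.union_subset hG subset_rfl
  have key (a : Deg n) (ha : 0 ≤ a) (hle : a ≤ b + sqf G) (hGa : supp a ⊆ G)
      (x : (GrMod.components.obj M).obj a) :
      omegaCoord (omegaIdx hbG hc hF hG') (GrMod.lin f (mon k (expo a (b + sqf G)) • x.1)) =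
        omegaCoord (omegaIdx ha hc hF hGa) (GrMod.lin f x.1) := by
    rw [map_smul]
    exact omegaCoord_mon_smul (add_mono (sqf F) hle) _
      (by rw [add_assoc, add_toDeg_expo hle]) _ (GrMod.lin_mem f x.2)
  rw [← key b hb (le_add_sqf b G), homCoord_apply,
    ← key (sqf G) (sqf_nonneg G) (sqf_le_add hb G)]
  exact congr_arg (fun z => omegaCoord (omegaIdx hbG hc hF hG') (GrMod.lin f z)) h1.symm

lemma subset_of_omegaIdx {q : ℤ} {F : Finset (Fin n)} {b : Deg n} (hb : 0 ≤ b)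
    (G : OmegaIdx q (sqf F + b)) : F ⊆ G.1 ∧ supp b ⊆ G.1 := by
  have e : supp (sqf F + b) = supp b ∪ F := by rw [add_comm, supp_add_sqf hb]
  have h := e.ge.trans G.2.2
  exact ⟨Finset.subset_union_right.trans h, Finset.subset_union_left.trans h⟩

lemma homCoord_injective {M : GrMod k n} (hM : IsSquarefree k n M) {q : ℤ} {F : Finset (Fin n)}
    {f g : M ⟶ ((omega k n).X q).twist (sqf F)}
    (h : ∀ (G : Finset (Fin n)) (hc : (G.card : ℤ) = -q) (hF : F ⊆ G),
      homCoord f hc hF = homCoord g hc hF) : f = g := by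
  refine GrMod.hom_ext_gr fun b y hy => ?_
  by_cases hb : 0 ≤ b
  · refine eq_of_omegaCoord (GrMod.lin_mem f hy) (GrMod.lin_mem g hy) fun G => ?_
    have hG := subset_of_omegaIdx hb G
    have h1 := omegaCoord_lin hM f G.2.1 hG.1 hb hG.2 ⟨y, hy⟩
    rw [h] at h1
    exact h1.trans (omegaCoord_lin hM g G.2.1 hG.1 hb hG.2 ⟨y, hy⟩).symm
  · rw [hM.eq_bot b hb] at hy
    rw [(Submodule.mem_bot k).1 hy, map_zero, map_zero]

/-- Arbitrary functionals on the M_G are extended to all degrees b ∈ ℕⁿ by composing with M_b → M_G;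
compatibility with multiplication is `map_comp_retr`. -/
lemma exists_homCoord {M : GrMod k n} (hM : IsSquarefree k n M) {q : ℤ} {F : Finset (Fin n)}
    (φ : ∀ G : Finset (Fin n), (G.card : ℤ) = -q → F ⊆ G →
      Module.Dual k ((GrMod.components.obj M).obj (sqf G))) :
    ∃ f : M ⟶ ((omega k n).X q).twist (sqf F),
      ∀ (G : Finset (Fin n)) (hc : (G.card : ℤ) = -q) (hF : F ⊆ G), homCoord f hc hF = φ G hc hF := by
  classical
  let g (b : Deg n) : (GrMod.components.obj M).obj b →ₗ[k] (OmegaIdx q (sqf F + b) → k) :=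
    if hb : 0 ≤ b then LinearMap.pi fun G => (φ G.1 G.2.1 (subset_of_omegaIdx hb G).1).comp
      (retr hM hb (subset_of_omegaIdx hb G).2).hom else 0
  let ψ : GrMod.components.obj M ⟶ GrMod.components.obj (((omega k n).X q).twist (sqf F)) :=
    { app b := ModuleCat.ofHom
        (((omegaFam k q).incl (sqf F + b)).rangeRestrict.comp (g b))
      naturality b b' h := by
        by_cases hb : 0 ≤ b
        · have hb' : 0 ≤ b' := hb.trans (leOfHom h)
          have hle : sqf F + b ≤ sqf F + b' := add_mono (sqf F) (leOfHom h)
          ext y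
          refine Subtype.ext ?_
          have h1 := Fam.mon_smul_incl (omegaFam k q) (expo b b') (a := sqf F + b)
            (c := sqf F + b') (by rw [add_assoc, add_toDeg_expo (leOfHom h)]) (homOfLE hle) (g b y)
          refine Eq.trans ?_ h1.symm
          refine congr_arg ((omegaFam k q).incl (sqf F + b')) ?_
          funext G
          have h2 : g b' ((GrMod.components.obj M).map h y) G = φ G.1 G.2.1
            (subset_of_omegaIdx hb' G).1 (retr hM hb' (subset_of_omegaIdx hb' G).2
              ((GrMod.components.obj M).map h y)) := by
            simp only [g, dif_pos hb']
            rfl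
          let G₀ : OmegaIdx q (sqf F + b) := ⟨G.1, G.2.1, (supp_mono hle).trans G.2.2⟩
          have h3 : g b y G₀ = φ G.1 G.2.1
            (subset_of_omegaIdx hb G₀).1 (retr hM hb (subset_of_omegaIdx hb G₀).2 y) := by
            simp only [g, dif_pos hb]
            rfl
          refine h2.trans (Eq.trans ?_ h3.symm)
          exact congr_arg (φ G.1 G.2.1 _)
            (congr($(map_comp_retr hM hb' (subset_of_omegaIdx hb' G).2 hb h) y))
        · have := subsingleton_components hM hb
          ext y
          rw [Subsingleton.elim y 0, map_zero, map_zero] }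
  obtain ⟨f, hf⟩ := GrMod.components.map_surjective ψ
  refine ⟨f, fun G hc hF => LinearMap.ext fun y => ?_⟩
  have h1 : GrMod.lin f y.1 = (omegaFam k q).incl (sqf F + sqf G) (g (sqf G) y) :=
    congr_arg Subtype.val (congr($(congr_app hf (sqf G)) y))
  rw [homCoord_apply]
  refine (congr_arg _ h1).trans ((omegaCoord_incl _ _).trans ?_)
  simp only [g, dif_pos (sqf_nonneg G)]
  change φ G hc hF (retr hM (sqf_nonneg G) (supp_sqf G).le y) = _
  rw [retr_sqf hM subset_rfl]
  exact congr_arg (φ G hc hF) (congr($((GrMod.components.obj M).map_id (sqf G)) y))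

end OmegaCoord

/-! ### The functor D in coordinates -/

section DualCoord

open CochainComplex HomComplex

variable {k : Type u} [Field k] {n : ℕ}

/-- The pairs `(G, p)` with `F ⊆ G` and `#G + p + t = 0`. -/
abbrev DualIdx (t : ℤ) (F : Finset (Fin n)) : Type :=
  {p : Finset (Fin n) × ℤ // F ⊆ p.1 ∧ (p.1.card : ℤ) + p.2 + t = 0}

/-- The functionals on the vector spaces `Y_G^p`, for the pairs `(G, p)` in `DualIdx t F`. -/
abbrev DualX (Y : CochainComplex (Cube k n) ℤ) (t : ℤ) (F : Finset (Fin n)) : Type u :=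
  ∀ p : DualIdx t F, Module.Dual k ((Y.X p.1.2).obj p.1.1)

namespace DualX

variable {Y : CochainComplex (Cube k n) ℤ} {t : ℤ} {F : Finset (Fin n)}

open scoped Classical in
/-- The functional on `Y_H` induced by the one on `Y_G`, for `H ⊆ G`. -/
def pull (φ : DualX Y t F) (p : ℤ) (H G : Finset (Fin n)) : Module.Dual k ((Y.X p).obj H) :=
  if h : H ⊆ G ∧ F ⊆ G ∧ (G.card : ℤ) + p + t = 0 then
    (φ ⟨(G, p), h.2⟩).comp ((Y.X p).map (homOfLE h.1)).hom else 0

lemma pull_of (φ : DualX Y t F) {p : ℤ} {H G : Finset (Fin n)} (h : H ⊆ G) (hF : F ⊆ G)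
    (hc : (G.card : ℤ) + p + t = 0) :
    φ.pull p H G = (φ ⟨(G, p), hF, hc⟩).comp ((Y.X p).map (homOfLE h)).hom := dif_pos ⟨h, hF, hc⟩

lemma pull_self (φ : DualX Y t F) {p : ℤ} {G : Finset (Fin n)} (hF : F ⊆ G)
    (hc : (G.card : ℤ) + p + t = 0) : φ.pull p G G = φ ⟨(G, p), hF, hc⟩ := by
  rw [pull_of φ subset_rfl hF hc]
  refine LinearMap.ext fun y => congr_arg (φ ⟨(G, p), hF, hc⟩) ?_
  exact congr($((Y.X p).map_id G) y)

end DualX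

variable (L : ComB k n) (t : ℤ) (F : Finset (Fin n))

/-- The coordinates of a cochain with values in `ω^•(F)`. -/
def cochainCoord :
    Cochain ((inclB k n).obj L) (twistC (omega k n) (sqf F)) t →ₗ[k] DualX ((cubes k n).obj L) t F where
  toFun z p := homCoord (M := (L.obj.X p.1.2).obj) (z.v p.1.2 (p.1.2 + t) rfl)
    (by have := p.2.2; lia) p.2.1
  map_add' z z' := by
    funext p
    refine LinearMap.ext fun y => ?_
    exact map_add (omegaCoord _) _ _
  map_smul' c z := by
    funext p
    refine LinearMap.ext fun y => ?_
    exact map_smul (omegaCoord _) c _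

variable {L t F}

lemma cochainCoord_apply (z : Cochain ((inclB k n).obj L) (twistC (omega k n) (sqf F)) t)
    {p q : ℤ} {G : Finset (Fin n)} (hpq : p + t = q) (h : F ⊆ G ∧ (G.card : ℤ) + p + t = 0)
    (hc : (G.card : ℤ) = -q) : cochainCoord L t F z ⟨(G, p), h⟩ =
      homCoord (M := (L.obj.X p).obj) (z.v p q hpq) hc h.1 := by
  subst hpq
  rfl

lemma cochainCoord_bijective : Function.Bijective (cochainCoord L t F) := by
  constructor
  · intro z z' hz
    refine Cochain.ext _ _ fun p q hpq => homCoord_injective (isSquarefree_obj (L.obj.X p)) ?_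
    intro G hc hF
    have h : F ⊆ G ∧ (G.card : ℤ) + p + t = 0 := ⟨hF, by lia⟩
    exact (cochainCoord_apply z hpq h hc).symm.trans
      ((congr_fun hz ⟨(G, p), h⟩).trans (cochainCoord_apply z' hpq h hc))
  · intro φ
    choose f hf using fun (p q : ℤ) (hpq : p + t = q) =>
      exists_homCoord (isSquarefree_obj (L.obj.X p)) (q := q) (F := F)
        fun G hc hF => φ ⟨(G, p), hF, by lia⟩
    refine ⟨Cochain.mk f, ?_⟩
    funext ⟨⟨G, p⟩, h⟩
    rw [cochainCoord_apply _ rfl h (by have := h.2; lia)]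
    exact hf p (p + t) rfl G _ _

lemma cochainCoord_mul {F' : Finset (Fin n)} (h : F ⊆ F')
    (z : Cochain ((inclB k n).obj L) (twistC (omega k n) (sqf F)) t) (p : DualIdx t F') :
    cochainCoord L t F' (z.comp (Cochain.ofHom (twistCMul (omega k n) (sqf_mono h))) (add_zero t)) p =
      cochainCoord L t F z ⟨p.1, h.trans p.2.1, p.2.2⟩ := by
  obtain ⟨⟨G, p⟩, hp⟩ := p
  have hc : (G.card : ℤ) = -(p + t) := by have := hp.2; lia
  rw [cochainCoord_apply _ rfl hp hc, cochainCoord_apply _ rfl ⟨h.trans hp.1, hp.2⟩ hc,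
    Cochain.comp_zero_cochain_v, Cochain.ofHom_v]
  refine LinearMap.ext fun y => ?_
  exact omegaCoord_mon_smul (y := GrMod.lin (z.v p (p + t) rfl) y.1)
    (add_sqf_mono (sqf_mono h) subset_rfl) (expo (sqf F) (sqf F'))
    (by rw [add_right_comm, add_toDeg_expo (sqf_mono h)]) _ (GrMod.lin_mem (z.v p (p + t) rfl) y.2)

/-- Up to sign, the coordinate G of the differential of ω is the sum of the coordinates G ∪ {j},
read in the same degree. Read on M_G, the functional for G ∪ {j} is therefore pulled back along M_G
→ M_{G∪{j}}. -/
lemma homCoord_comp_d {M : GrMod k n} (hM : IsSquarefree k n M) {q q' : ℤ} (hq : q + 1 = q')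
    (f : M ⟶ ((omega k n).X q).twist (sqf F)) {G : Finset (Fin n)} (hc : (G.card : ℤ) = -q')
    (hF : F ⊆ G) (y : (GrMod.components.obj M).obj (sqf G)) :
    homCoord (q := q') (f ≫ (GrMod.twistFunctor (sqf F)).map ((omega k n).d q q')) hc hF y =
      ∑ j : {j : Fin n // j ∉ G}, (-1 : k) ^ alpha j.1 (insert j.1 G) *
        homCoord f (G := insert j.1 G)
          (by rw [Finset.card_insert_of_notMem j.2]; push_cast; lia)
          (hF.trans (Finset.subset_insert _ _))
          ((GrMod.components.obj M).map (homOfLE (sqf_mono (Finset.subset_insert j.1 G))) y) := by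
  rw [homCoord_apply]
  refine (omegaCoord_d hq (omegaIdx (sqf_nonneg G) hc hF (supp_sqf G).le)
    (GrMod.lin_mem f y.2)).trans ?_
  refine Finset.sum_congr rfl fun (j : {j : Fin n // j ∉ G}) _ => congr_arg ((-1 : k) ^ alpha j.1 (insert j.1 G) * ·) ?_
  refine (omegaCoord_lin hM f (by rw [Finset.card_insert_of_notMem j.2]; push_cast; lia)
    (hF.trans (Finset.subset_insert _ _)) (sqf_nonneg G)
    ((supp_sqf G).le.trans (Finset.subset_insert j.1 G)) y).trans ?_
  rw [retr_sqf hM (Finset.subset_insert j.1 G)]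

lemma homCoord_add {M : GrMod k n} {q : ℤ} (f g : M ⟶ ((omega k n).X q).twist (sqf F))
    {G : Finset (Fin n)} (hc : (G.card : ℤ) = -q) (hF : F ⊆ G) :
    homCoord (f + g) hc hF = homCoord f hc hF + homCoord g hc hF :=
  LinearMap.ext fun _ => map_add (omegaCoord _) _ _

lemma homCoord_negOnePow_smul {M : GrMod k n} {q : ℤ} (m : ℤ)
    (f : M ⟶ ((omega k n).X q).twist (sqf F)) {G : Finset (Fin n)} (hc : (G.card : ℤ) = -q)
    (hF : F ⊆ G) : homCoord (m.negOnePow • f) hc hF = sg k m • homCoord f hc hF := by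
  rcases Int.even_or_odd m with hm | hm
  · rw [sg, Int.negOnePow_even _ hm, one_smul, Units.val_one, Int.cast_one, one_smul]
  · rw [sg, Int.negOnePow_odd _ hm, Units.neg_smul, one_smul, Units.val_neg, Units.val_one,
      Int.cast_neg, Int.cast_one]
    refine LinearMap.ext fun y => ?_
    rw [LinearMap.smul_apply, neg_one_smul]
    exact map_neg (omegaCoord _) _

lemma sg_natCast (m : ℕ) : sg k (m : ℤ) = (-1) ^ m := by
  induction m with
  | zero => simp
  | succ m ih => rw [Nat.cast_succ, sg_succ, ih, pow_succ, mul_neg_one]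

/-- Composition with the differential of ω gives the sum over j; precomposition with the
differential of L gives the term with sign (-1)^{t'}. -/
lemma cochainCoord_δ {t' : ℤ} (ht : t + 1 = t')
    (z : Cochain ((inclB k n).obj L) (twistC (omega k n) (sqf F)) t) (G : Finset (Fin n)) (p : ℤ)
    (h : F ⊆ G ∧ (G.card : ℤ) + p + t' = 0) :
    cochainCoord L t' F (δ t t' z) ⟨(G, p), h⟩ =
      sg k t' • ((cochainCoord L t F z).pull (p + 1) G G).comp
        ((((cubes k n).obj L).d p (p + 1)).app G).hom +
      ∑ j ∈ Gᶜ, sg k (alpha j (insert j G)) • (cochainCoord L t F z).pull p G (insert j G) := by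
  have hc : (G.card : ℤ) = -(p + t') := by have := h.2; lia
  let f₁ : (L.obj.X p).obj ⟶ ((omega k n).X (p + t' - 1)).twist (sqf F) :=
    z.v p (p + t' - 1) (by lia)
  let f₂ : (L.obj.X (p + 1)).obj ⟶ ((omega k n).X (p + t')).twist (sqf F) :=
    z.v (p + 1) (p + t') (by lia)
  have h1 : cochainCoord L t' F (δ t t' z) ⟨(G, p), h⟩ =
      homCoord ((show (L.obj.X p).obj ⟶ ((omega k n).X (p + t')).twist (sqf F) from f₁ ≫
        (GrMod.twistFunctor (sqf F)).map ((omega k n).d (p + t' - 1) (p + t'))) +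
        t'.negOnePow • ((L.obj.d p (p + 1)).hom ≫ f₂)) hc h.1 :=
    (cochainCoord_apply _ rfl h hc).trans (congr_arg (fun f => homCoord f hc h.1)
      (δ_v t t' ht z p (p + t') rfl (p + t' - 1) (p + 1) rfl rfl))
  have h2 : (cochainCoord L t F z).pull (p + 1) G G = homCoord f₂ hc h.1 :=
    (DualX.pull_self _ h.1 (by have := h.2; lia)).trans
      (cochainCoord_apply z (p := p + 1) (q := p + t') (by lia) ⟨h.1, by have := h.2; lia⟩ hc)
  rw [h1, homCoord_add, homCoord_negOnePow_smul, h2, add_comm]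
  congr 1
  refine LinearMap.ext fun (y : (((cubes k n).obj L).X p).obj G) => ?_
  rw [Finset.sum_subtype Gᶜ (p := fun j => j ∉ G) (fun j => Finset.mem_compl)]
  refine (homCoord_comp_d (isSquarefree_obj (L.obj.X p)) (by lia) f₁ hc h.1 y).trans
    (Eq.trans ?_ (LinearMap.sum_apply _ _ y).symm)
  refine Finset.sum_congr rfl fun j _ => ?_
  have hcj : ((insert j.1 G).card : ℤ) = -(p + t' - 1) := by
    rw [Finset.card_insert_of_notMem j.2]
    push_cast
    lia
  have hFj : F ⊆ insert j.1 G := h.1.trans (Finset.subset_insert _ _)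
  have h3 : (cochainCoord L t F z).pull p G (insert j.1 G) = (homCoord f₁ hcj hFj).comp
      ((((cubes k n).obj L).X p).map (homOfLE (Finset.subset_insert j.1 G))).hom := by
    rw [DualX.pull_of _ (Finset.subset_insert j.1 G) hFj (by lia)]
    exact congr_arg (fun φ : Module.Dual k ((((cubes k n).obj L).X p).obj (insert j.1 G)) =>
      φ.comp ((((cubes k n).obj L).X p).map (homOfLE (Finset.subset_insert j.1 G))).hom)
      (cochainCoord_apply z (by lia) ⟨hFj, by lia⟩ hcj)
  rw [h3, LinearMap.smul_apply, sg_natCast]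
  rfl

variable (L t F) in
/-- The component of degree `t` at the vertex `F` of `D(L)`. -/
def dualElt : Cochain ((inclB k n).obj L) (twistC (omega k n) (sqf F)) t ≃ₗ[k]
    (((cubes k n).obj ((dualB k n).obj (Opposite.op L))).X t).obj F :=
  truncEquiv (homFam ((inclB k n).obj L) (omega k n) t) (sqf_nonneg F)

lemma dualElt_map {F' : Finset (Fin n)} (h : F ⊆ F')
    (z : Cochain ((inclB k n).obj L) (twistC (omega k n) (sqf F)) t) :
    (((cubes k n).obj ((dualB k n).obj (Opposite.op L))).X t).map (homOfLE h) (dualElt L t F z) =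
      dualElt L t F'
        (z.comp (Cochain.ofHom (twistCMul (omega k n) (sqf_mono h))) (add_zero t)) :=
  truncEquiv_map (homFam ((inclB k n).obj L) (omega k n) t) (sqf_nonneg F) (sqf_nonneg F')
    (homOfLE (sqf_mono h)) z

lemma dualElt_d (t' : ℤ) (z : Cochain ((inclB k n).obj L) (twistC (omega k n) (sqf F)) t) :
    (((cubes k n).obj ((dualB k n).obj (Opposite.op L))).d t t').app F (dualElt L t F z) =
      dualElt L t' F (δ t t' z) :=
  truncEquiv_app ((homComplex ((inclB k n).obj L) (omega k n)).d t t') (sqf_nonneg F) z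

lemma dualElt_app {L' : ComB k n} (f : L ⟶ L')
    (z : Cochain ((inclB k n).obj L') (twistC (omega k n) (sqf F)) t) :
    (((cubes k n).map ((dualB k n).map f.op)).f t).app F (dualElt L' t F z) =
      dualElt L t F ((Cochain.ofHom ((inclB k n).map f)).comp z (zero_add t)) :=
  truncEquiv_app (((homComplexFunctor (omega k n)).map ((inclB k n).map f).op).f t)
    (sqf_nonneg F) z

variable (L t F) in
/-- The coordinates of the elements of the component of degree `t` at the vertex `F` of `D(L)`. -/
def dualCoord : (((cubes k n).obj ((dualB k n).obj (Opposite.op L))).X t).obj F ≃ₗ[k]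
    DualX ((cubes k n).obj L) t F :=
  (dualElt L t F).symm.trans (LinearEquiv.ofBijective (cochainCoord L t F) cochainCoord_bijective)

lemma dualCoord_dualElt (z : Cochain ((inclB k n).obj L) (twistC (omega k n) (sqf F)) t) :
    dualCoord L t F (dualElt L t F z) = cochainCoord L t F z :=
  congr_arg (cochainCoord L t F) ((dualElt L t F).symm_apply_apply z)

lemma dualCoord_map {F' : Finset (Fin n)} (h : F ⊆ F')
    (x : (((cubes k n).obj ((dualB k n).obj (Opposite.op L))).X t).obj F) (p : DualIdx t F') :
    dualCoord L t F' ((((cubes k n).obj ((dualB k n).obj (Opposite.op L))).X t).map (homOfLE h) x)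
      p = dualCoord L t F x ⟨p.1, h.trans p.2.1, p.2.2⟩ := by
  obtain ⟨z, rfl⟩ := (dualElt L t F).surjective x
  rw [dualElt_map, dualCoord_dualElt, dualCoord_dualElt, cochainCoord_mul h]

lemma dualCoord_d {t' : ℤ} (ht : t + 1 = t')
    (x : (((cubes k n).obj ((dualB k n).obj (Opposite.op L))).X t).obj F) (G : Finset (Fin n)) (p : ℤ)
    (h : F ⊆ G ∧ (G.card : ℤ) + p + t' = 0) :
    dualCoord L t' F ((((cubes k n).obj ((dualB k n).obj (Opposite.op L))).d t t').app F x)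
      ⟨(G, p), h⟩ =
      sg k t' • ((dualCoord L t F x).pull (p + 1) G G).comp
        ((((cubes k n).obj L).d p (p + 1)).app G).hom +
      ∑ j ∈ Gᶜ, sg k (alpha j (insert j G)) • (dualCoord L t F x).pull p G (insert j G) := by
  obtain ⟨z, rfl⟩ := (dualElt L t F).surjective x
  rw [dualElt_d, dualCoord_dualElt, dualCoord_dualElt, cochainCoord_δ ht]

lemma dualCoord_app {L' : ComB k n} (f : L ⟶ L')
    (x : (((cubes k n).obj ((dualB k n).obj (Opposite.op L'))).X t).obj F) (G : Finset (Fin n))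
    (p : ℤ) (h : F ⊆ G ∧ (G.card : ℤ) + p + t = 0) :
    dualCoord L t F ((((cubes k n).map ((dualB k n).map f.op)).f t).app F x) ⟨(G, p), h⟩ =
      (dualCoord L' t F x ⟨(G, p), h⟩).comp ((((cubes k n).map f).f p).app G).hom := by
  obtain ⟨z, rfl⟩ := (dualElt L' t F).surjective x
  have hc : (G.card : ℤ) = -(p + t) := by have := h.2; lia
  rw [dualElt_app, dualCoord_dualElt, dualCoord_dualElt, cochainCoord_apply _ rfl h hc,
    cochainCoord_apply _ rfl h hc, Cochain.zero_cochain_comp_v, Cochain.ofHom_v]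
  rfl

end DualCoord

/-! ### The functor A in coordinates -/

section AlexCoord

variable {k : Type u} [Field k] {n : ℕ}

/-- The identification of components with equal indices. -/
def cubeCast (X : CochainComplex (Cube k n) ℤ) {q q' : ℤ} (hq : q = q') {H H' : Finset (Fin n)}
    (hH : H = H') : (X.X q).obj H ≃ₗ[k] (X.X q').obj H' := by
  subst hq hH
  exact LinearEquiv.refl k _

section

variable {X Y : CochainComplex (Cube k n) ℤ}

lemma cubeCast_map {q q' : ℤ} (hq : q = q') {H H' G G' : Finset (Fin n)} (hH : H = H') (hG : G = G')
    (h : H ⊆ G) (h' : H' ⊆ G') (x : (X.X q).obj H) :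
    cubeCast X hq hG ((X.X q).map (homOfLE h) x) = (X.X q').map (homOfLE h') (cubeCast X hq hH x) := by
  subst hq hH hG
  rfl

lemma cubeCast_d {p p' q q' : ℤ} (hp : p = p') (hq : q = q') {H H' : Finset (Fin n)} (hH : H = H')
    (x : (X.X p).obj H) :
    cubeCast X hq hH ((X.d p q).app H x) = (X.d p' q').app H' (cubeCast X hp hH x) := by
  subst hp hq hH
  rfl

lemma cubeCast_app (f : X ⟶ Y) {q q' : ℤ} (hq : q = q') {H H' : Finset (Fin n)} (hH : H = H')
    (x : (X.X q).obj H) :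
    cubeCast Y hq hH ((f.f q).app H x) = (f.f q').app H' (cubeCast X hq hH x) := by
  subst hq hH
  rfl

end

variable {K L : ComB k n}

variable (K) in
/-- The component of degree `p` at the vertex `G` of `A(K)`, as a dual space. -/
def alexElt (p : ℤ) (G : Finset (Fin n)) :
    Module.Dual k ((((cubes k n).obj K).X (-p)).obj (supp (sqf G))ᶜ) ≃ₗ[k]
      (((cubes k n).obj ((alexB k n).obj (Opposite.op K))).X p).obj G :=
  truncEquiv (alexFam.obj (Opposite.op (GrMod.components.obj (K.obj.X (-p)).obj))) (sqf_nonneg G)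

lemma alexElt_map (p : ℤ) {G G' : Finset (Fin n)} (h : G ⊆ G')
    (ξ : Module.Dual k ((((cubes k n).obj K).X (-p)).obj (supp (sqf G))ᶜ)) :
    (((cubes k n).obj ((alexB k n).obj (Opposite.op K))).X p).map (homOfLE h) (alexElt K p G ξ) =
      alexElt K p G' (ξ.comp ((((cubes k n).obj K).X (-p)).map (homOfLE
        (Finset.compl_subset_compl.2 (supp_mono (sqf_mono h))))).hom) :=
  truncEquiv_map (alexFam.obj (Opposite.op (GrMod.components.obj (K.obj.X (-p)).obj)))
    (sqf_nonneg G) (sqf_nonneg G') (homOfLE (sqf_mono h)) ξ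

lemma alexElt_d (p p' : ℤ) (G : Finset (Fin n))
    (ξ : Module.Dual k ((((cubes k n).obj K).X (-p)).obj (supp (sqf G))ᶜ)) :
    (((cubes k n).obj ((alexB k n).obj (Opposite.op K))).d p p').app G (alexElt K p G ξ) =
      alexElt K p' G (ξ.comp ((((cubes k n).obj K).d (-p') (-p)).app (supp (sqf G))ᶜ).hom) :=
  truncEquiv_app (alexFam.map (GrMod.components.map (K.obj.d (-p') (-p)).hom).op) (sqf_nonneg G) ξ

lemma alexElt_app (f : K ⟶ L) (p : ℤ) (G : Finset (Fin n))
    (ξ : Module.Dual k ((((cubes k n).obj L).X (-p)).obj (supp (sqf G))ᶜ)) :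
    (((cubes k n).map ((alexB k n).map f.op)).f p).app G (alexElt L p G ξ) =
      alexElt K p G (ξ.comp ((((cubes k n).map f).f (-p)).app (supp (sqf G))ᶜ).hom) :=
  truncEquiv_app (alexFam.map (GrMod.components.map (f.hom.f (-p)).hom).op) (sqf_nonneg G) ξ

/-- The vertex produced by the definition of A is equal to Gᶜ only propositionally, so `alexEquiv`
takes the vertex and the degree as variables subject to equations. -/
lemma compl_supp_sqf {G H : Finset (Fin n)} (hH : H = Gᶜ) : (supp (sqf G))ᶜ = H := by
  rw [supp_sqf, hH]

variable (K) in
/-- The identification of the dual space of `K_H^q` with `A(K)_G^p`, for `q = -p` and `H = Gᶜ`. -/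
def alexEquiv {p q : ℤ} (hq : q = -p) {G H : Finset (Fin n)} (hH : H = Gᶜ) :
    Module.Dual k ((((cubes k n).obj K).X q).obj H) ≃ₗ[k]
      (((cubes k n).obj ((alexB k n).obj (Opposite.op K))).X p).obj G :=
  (cubeCast ((cubes k n).obj K) hq.symm (compl_supp_sqf hH)).dualMap.trans (alexElt K p G)

lemma alexEquiv_map {p q : ℤ} (hq : q = -p) {G H G' H' : Finset (Fin n)} (hH : H = Gᶜ)
    (hH' : H' = G'ᶜ) (h : G ⊆ G') (h' : H' ⊆ H)
    (ξ : Module.Dual k ((((cubes k n).obj K).X q).obj H)) :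
    (((cubes k n).obj ((alexB k n).obj (Opposite.op K))).X p).map (homOfLE h)
        (alexEquiv K hq hH ξ) =
      alexEquiv K hq hH' (ξ.comp ((((cubes k n).obj K).X q).map (homOfLE h')).hom) := by
  refine (alexElt_map p h _).trans (congr_arg (alexElt K p G') ?_)
  exact LinearMap.ext fun y => congr_arg ξ
    (cubeCast_map hq.symm (compl_supp_sqf hH') (compl_supp_sqf hH) _ h' y)

lemma alexEquiv_d {p q p' q' : ℤ} (hq : q = -p) (hq' : q' = -p') {G H : Finset (Fin n)}
    (hH : H = Gᶜ) (ξ : Module.Dual k ((((cubes k n).obj K).X q).obj H)) :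
    (((cubes k n).obj ((alexB k n).obj (Opposite.op K))).d p p').app G (alexEquiv K hq hH ξ) =
      alexEquiv K hq' hH (ξ.comp ((((cubes k n).obj K).d q' q).app H).hom) := by
  refine (alexElt_d p p' G _).trans (congr_arg (alexElt K p' G) ?_)
  exact LinearMap.ext fun y => congr_arg ξ
    (cubeCast_d hq'.symm hq.symm (compl_supp_sqf hH) y)

lemma alexEquiv_app (f : K ⟶ L) {p q : ℤ} (hq : q = -p) {G H : Finset (Fin n)}
    (hH : H = Gᶜ) (ξ : Module.Dual k ((((cubes k n).obj L).X q).obj H)) :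
    (((cubes k n).map ((alexB k n).map f.op)).f p).app G (alexEquiv L hq hH ξ) =
      alexEquiv K hq hH (ξ.comp ((((cubes k n).map f).f q).app H).hom) := by
  refine (alexElt_app f p G _).trans (congr_arg (alexElt K p G) ?_)
  exact LinearMap.ext fun y => congr_arg ξ
    (cubeCast_app ((cubes k n).map f) hq.symm (compl_supp_sqf hH) y)

lemma alexEquiv_symm_d {p q p' q' : ℤ} (hq : q = -p) (hq' : q' = -p') {G H : Finset (Fin n)}
    (hH : H = Gᶜ) (x : (((cubes k n).obj ((alexB k n).obj (Opposite.op K))).X p).obj G) :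
    (alexEquiv K hq' hH).symm
        ((((cubes k n).obj ((alexB k n).obj (Opposite.op K))).d p p').app G x) =
      ((alexEquiv K hq hH).symm x).comp ((((cubes k n).obj K).d q' q).app H).hom := by
  rw [LinearEquiv.symm_apply_eq, ← alexEquiv_d hq, LinearEquiv.apply_symm_apply]

lemma alexEquiv_symm_app (f : K ⟶ L) {p q : ℤ} (hq : q = -p) {G H : Finset (Fin n)} (hH : H = Gᶜ)
    (x : (((cubes k n).obj ((alexB k n).obj (Opposite.op L))).X p).obj G) :
    (alexEquiv K hq hH).symm ((((cubes k n).map ((alexB k n).map f.op)).f p).app G x) =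
      ((alexEquiv L hq hH).symm x).comp ((((cubes k n).map f).f q).app H).hom := by
  rw [LinearEquiv.symm_apply_eq, ← alexEquiv_app f hq, LinearEquiv.apply_symm_apply]

/-- At the vertex G, A is the k-dual of the vertex Gᶜ with degrees negated, and dualizing preserves
exactness of the cone. -/
lemma preservesQis_alexB : PreservesQis (alexB k n) := by
  intro K L f hf
  rw [qis_iff] at hf ⊢
  intro G
  have H := (quasiIso_iff_coneExact _).1 (hf Gᶜ)
  rw [quasiIso_iff_coneExact]
  have H' : ConeExact (k := k) (X := fun i => Module.Dual k ((((cubes k n).obj L).X (-i)).obj Gᶜ))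
      (Y := fun i => Module.Dual k ((((cubes k n).obj K).X (-i)).obj Gᶜ))
      (fun i j => ((((cubes k n).obj L).d (-j) (-i)).app Gᶜ).hom.dualMap)
      (fun i j => ((((cubes k n).obj K).d (-j) (-i)).app Gᶜ).hom.dualMap)
      (fun i => ((((cubes k n).map f).f (-i)).app Gᶜ).hom.dualMap) := by
    intro h i j l hi hj hl x y hx hy
    obtain ⟨ξ, ζ, h1, h2⟩ := H.exists_dual (h := -l) (i := -j) (j := -i) (l := -h) (by lia) (by lia)
      (by lia) x y hx hy
    exact ⟨ξ, ζ, h1, h2⟩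
  refine H'.of_equiv (fun i => (alexEquiv L (p := i) rfl (G := G) rfl).symm)
    (fun i => (alexEquiv K (p := i) rfl (G := G) rfl).symm) ?_ ?_ ?_
  · exact fun i j _ x => alexEquiv_symm_d rfl rfl rfl x
  · exact fun i j _ x => alexEquiv_symm_d rfl rfl rfl x
  · exact fun i x => alexEquiv_symm_app f rfl rfl x

end AlexCoord

/-! ### The functor D preserves quasi-isomorphisms -/

section DualQis

variable {k : Type u} [Field k] {n : ℕ} {K L : ComB k n} {F : Finset (Fin n)}

/-- The sum over j reads only coordinates at sets larger than G. On the top nonzero layer the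
differential is therefore the dual of the differential of L, up to sign. -/
lemma dualCoord_d_of_vanishing {t t' : ℤ} (ht : t + 1 = t')
    (x : (((cubes k n).obj ((dualB k n).obj (Opposite.op L))).X t).obj F) {G : Finset (Fin n)}
    {p p' : ℤ} (hp : p + 1 = p') (h : F ⊆ G ∧ (G.card : ℤ) + p + t' = 0)
    (hx : ∀ q : DualIdx t F, G.card < q.1.1.card → dualCoord L t F x q = 0) :
    dualCoord L t' F ((((cubes k n).obj ((dualB k n).obj (Opposite.op L))).d t t').app F x)
      ⟨(G, p), h⟩ =
      sg k t' • (dualCoord L t F x ⟨(G, p'), h.1, by have := h.2; lia⟩).comp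
        ((((cubes k n).obj L).d p p').app G).hom := by
  subst hp
  have hs : ∑ j ∈ Gᶜ, sg k (alpha j (insert j G)) •
      (dualCoord L t F x).pull p G (insert j G) = 0 := by
    refine Finset.sum_eq_zero fun j hj => ?_
    have hc := Finset.card_insert_of_notMem (Finset.mem_compl.1 hj)
    rw [DualX.pull_of _ (Finset.subset_insert j G) (h.1.trans (Finset.subset_insert j G))
      (by have := h.2; lia), hx _ (by dsimp only; lia), LinearMap.zero_comp, smul_zero]
  rw [dualCoord_d ht, hs, add_zero, DualX.pull_self _ h.1 (by have := h.2; lia)]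

lemma smul_smul_comp {V W : Type*} [AddCommGroup V] [Module k V] [AddCommGroup W] [Module k W]
    {c d : k} (h : c * d = 1) (ξ : W →ₗ[k] k) (g : V →ₗ[k] W) :
    c • ((d • ξ).comp g) = ξ.comp g := by
  rw [LinearMap.smul_comp, smul_smul, h, one_smul]

open scoped Classical in
/-- The part of a family of functionals on the sets `G` with `r` elements. -/
def DualX.layer {Y : CochainComplex (Cube k n) ℤ} {t : ℤ} (r : ℕ)
    (φ : ∀ (G : Finset (Fin n)) (p : ℤ), F ⊆ G → (G.card : ℤ) + p + t = 0 → G.card = r →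
      Module.Dual k ((Y.X p).obj G)) : DualX Y t F :=
  fun p => if h : p.1.1.card = r then φ p.1.1 p.1.2 p.2.1 p.2.2 h else 0

lemma DualX.layer_of_card_eq {Y : CochainComplex (Cube k n) ℤ} {t : ℤ} {r : ℕ}
    (φ : ∀ (G : Finset (Fin n)) (p : ℤ), F ⊆ G → (G.card : ℤ) + p + t = 0 → G.card = r →
      Module.Dual k ((Y.X p).obj G)) {G : Finset (Fin n)} {p : ℤ}
    (h : F ⊆ G ∧ (G.card : ℤ) + p + t = 0) (hr : G.card = r) :
    DualX.layer r φ ⟨(G, p), h⟩ = φ G p h.1 h.2 hr := dif_pos hr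

lemma DualX.layer_of_card_ne {Y : CochainComplex (Cube k n) ℤ} {t : ℤ} {r : ℕ}
    (φ : ∀ (G : Finset (Fin n)) (p : ℤ), F ⊆ G → (G.card : ℤ) + p + t = 0 → G.card = r →
      Module.Dual k ((Y.X p).obj G)) (q : DualIdx t F) (hr : q.1.1.card ≠ r) :
    DualX.layer r φ q = 0 := dif_neg hr

section

variable (f : K ⟶ L) (r : ℕ) {h i j l : ℤ} (hi : h + 1 = i) (hj : i + 1 = j) (hl : j + 1 = l)
  (x : (((cubes k n).obj ((dualB k n).obj (Opposite.op L))).X j).obj F)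
  (y : (((cubes k n).obj ((dualB k n).obj (Opposite.op K))).X i).obj F)
  (hx : ∀ q, r < q.1.1.card → dualCoord L j F x q = 0)
  (hy : ∀ q, r < q.1.1.card → dualCoord K i F y q = 0)

include hj hl hx hy in
-- Restricted to a top-layer set G, the cocycle conditions are those of the dual of the cone of f at
-- the vertex G; that dual is exact. The sign (-1)^j is moved onto y to match the convention of
-- `ConeExact`.
lemma exists_functionals
    (hf : ∀ G : Finset (Fin n), QuasiIso ((vertex k G).map ((cubes k n).map f)))
    (hdx : (((cubes k n).obj ((dualB k n).obj (Opposite.op L))).d j l).app F x = 0)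
    (hxy : (((cubes k n).map ((dualB k n).map f.op)).f j).app F x =
        (((cubes k n).obj ((dualB k n).obj (Opposite.op K))).d i j).app F y)
    (G : Finset (Fin n)) (p₀ p₁ p₂ : ℤ) (h₁ : p₀ + 1 = p₁) (h₂ : p₁ + 1 = p₂)
    (hc : F ⊆ G ∧ (G.card : ℤ) + p₀ + j = 0) (hc' : F ⊆ G ∧ (G.card : ℤ) + p₁ + i = 0)
    (hr : G.card = r) :
    ∃ (ξ : Module.Dual k ((((cubes k n).obj L).X p₁).obj G))
      (ζ : Module.Dual k ((((cubes k n).obj K).X p₂).obj G)),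
      ξ.comp ((((cubes k n).obj L).d p₀ p₁).app G).hom = dualCoord L j F x ⟨(G, p₀), hc⟩ ∧
      ξ.comp ((((cubes k n).map f).f p₁).app G).hom +
        ζ.comp ((((cubes k n).obj K).d p₁ p₂).app G).hom =
        sg k j • dualCoord K i F y ⟨(G, p₁), hc'⟩ := by
  have H := (quasiIso_iff_coneExact _).1 (hf G)
  refine H.exists_dual (sub_add_cancel p₀ 1) h₁ h₂ (dualCoord L j F x ⟨(G, p₀), hc⟩)
    (sg k j • dualCoord K i F y ⟨(G, p₁), hc'⟩) ?_ ?_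
  · have e := dualCoord_d_of_vanishing hl x (G := G) (sub_add_cancel p₀ 1)
      ⟨hc.1, by have := hc.2; lia⟩ fun q hq => hx q (hr ▸ hq)
    rw [hdx, map_zero] at e
    exact (smul_eq_zero.1 e.symm).resolve_left (sg_ne_zero _)
  · have e := dualCoord_d_of_vanishing hj y h₁ hc fun q hq => hy q (hr ▸ hq)
    rw [← hxy, dualCoord_app] at e
    exact e

include hi hj hx hy in
-- The functionals found for the sets of size r are assembled to elements supported on that layer,
-- whose coboundary agrees with (x, y) there and on all higher layers.
lemma exists_layer
    (H : ∀ (G : Finset (Fin n)) (p₀ p₁ p₂ : ℤ), p₀ + 1 = p₁ → p₁ + 1 = p₂ →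
      ∀ (hc : F ⊆ G ∧ (G.card : ℤ) + p₀ + j = 0) (hc' : F ⊆ G ∧ (G.card : ℤ) + p₁ + i = 0),
      G.card = r → ∃ (ξ : Module.Dual k ((((cubes k n).obj L).X p₁).obj G))
        (ζ : Module.Dual k ((((cubes k n).obj K).X p₂).obj G)),
        ξ.comp ((((cubes k n).obj L).d p₀ p₁).app G).hom = dualCoord L j F x ⟨(G, p₀), hc⟩ ∧
        ξ.comp ((((cubes k n).map f).f p₁).app G).hom +
          ζ.comp ((((cubes k n).obj K).d p₁ p₂).app G).hom =
          sg k j • dualCoord K i F y ⟨(G, p₁), hc'⟩) :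
    ∃ (x₁ : (((cubes k n).obj ((dualB k n).obj (Opposite.op L))).X i).obj F)
      (y₁ : (((cubes k n).obj ((dualB k n).obj (Opposite.op K))).X h).obj F),
      (∀ q, r ≤ q.1.1.card → dualCoord L j F
        ((((cubes k n).obj ((dualB k n).obj (Opposite.op L))).d i j).app F x₁) q =
          dualCoord L j F x q) ∧
      (∀ q, r ≤ q.1.1.card → dualCoord K i F
        ((((cubes k n).map ((dualB k n).map f.op)).f i).app F x₁ +
          (((cubes k n).obj ((dualB k n).obj (Opposite.op K))).d h i).app F y₁) q =
          dualCoord K i F y q) := by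
  choose ξ ζ hξ hζ using H
  -- The sign (-1)^j cancels the one in the differential into degree j. The sign (-1)^{i+j} below
  -- combines with (-1)^i from the differential into degree i to the common factor (-1)^j.
  let φ : DualX ((cubes k n).obj L) i F := DualX.layer r fun G p hF hc hr =>
    sg k j • ξ G (p - 1) p (p + 1) (sub_add_cancel p 1) rfl ⟨hF, by clear * - hc hj; lia⟩ ⟨hF, hc⟩ hr
  let ψ : DualX ((cubes k n).obj K) h F := DualX.layer r fun G p hF hc hr =>
    sg k (i + j) • ζ G (p - 1 - 1) (p - 1) p (sub_add_cancel (p - 1) 1) (sub_add_cancel p 1)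
      ⟨hF, by clear * - hc hj hi; lia⟩ ⟨hF, by clear * - hc hi; lia⟩ hr
  have hφ0 (q) (hq : r < q.1.1.card) : φ q = 0 := DualX.layer_of_card_ne _ _ hq.ne'
  have hψ0 (q) (hq : r < q.1.1.card) : ψ q = 0 := DualX.layer_of_card_ne _ _ hq.ne'
  have hφ (G : Finset (Fin n)) (p₀ p₁ p₂ : ℤ) (h₁ : p₀ + 1 = p₁) (h₂ : p₁ + 1 = p₂)
      (hc : F ⊆ G ∧ (G.card : ℤ) + p₀ + j = 0) (hc' : F ⊆ G ∧ (G.card : ℤ) + p₁ + i = 0)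
      (hr : G.card = r) : φ ⟨(G, p₁), hc'⟩ = sg k j • ξ G p₀ p₁ p₂ h₁ h₂ hc hc' hr := by
    obtain rfl : p₀ = p₁ - 1 := by clear * - h₁; lia
    subst h₂
    exact DualX.layer_of_card_eq _ hc' hr
  have hψ (G : Finset (Fin n)) (p₀ p₁ p₂ : ℤ) (h₁ : p₀ + 1 = p₁) (h₂ : p₁ + 1 = p₂)
      (hc : F ⊆ G ∧ (G.card : ℤ) + p₀ + j = 0) (hc' : F ⊆ G ∧ (G.card : ℤ) + p₁ + i = 0)
      (hc'' : F ⊆ G ∧ (G.card : ℤ) + p₂ + h = 0)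
      (hr : G.card = r) : ψ ⟨(G, p₂), hc''⟩ = sg k (i + j) • ζ G p₀ p₁ p₂ h₁ h₂ hc hc' hr := by
    obtain rfl : p₁ = p₂ - 1 := by clear * - h₂; lia
    obtain rfl : p₀ = p₂ - 1 - 1 := by clear * - h₁; lia
    exact DualX.layer_of_card_eq _ hc'' hr
  have ex := (dualCoord L i F).apply_symm_apply φ
  have ey := (dualCoord K h F).apply_symm_apply ψ
  refine ⟨(dualCoord L i F).symm φ, (dualCoord K h F).symm ψ, ?_, ?_⟩
  · rintro ⟨⟨G, p⟩, (hc : F ⊆ G ∧ (G.card : ℤ) + p + j = 0)⟩ hq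
    have hc' : F ⊆ G ∧ (G.card : ℤ) + (p + 1) + i = 0 := ⟨hc.1, by have := hc.2; lia⟩
    replace hq : r ≤ G.card := hq
    rw [dualCoord_d_of_vanishing hj _ rfl hc fun q hq' => by rw [ex]; exact hφ0 q (hq.trans_lt hq'),
      ex]
    rcases hq.eq_or_lt with hr | hr
    · rw [hφ G p (p + 1) (p + 1 + 1) rfl rfl hc hc' hr.symm, ← hξ G p (p + 1) (p + 1 + 1) rfl rfl hc
        hc' hr.symm]
      exact smul_smul_comp (sg_mul_self j) _ _
    · rw [hφ0 _ hr, LinearMap.zero_comp, smul_zero, hx _ hr]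
  · rintro ⟨⟨G, p⟩, (hc : F ⊆ G ∧ (G.card : ℤ) + p + i = 0)⟩ hq
    have hc' : F ⊆ G ∧ (G.card : ℤ) + (p - 1) + j = 0 := ⟨hc.1, by have := hc.2; lia⟩
    have hc'' : F ⊆ G ∧ (G.card : ℤ) + (p + 1) + h = 0 := ⟨hc.1, by have := hc.2; lia⟩
    replace hq : r ≤ G.card := hq
    rw [map_add, Pi.add_apply, dualCoord_app, dualCoord_d_of_vanishing hi _ rfl hc fun q hq' => by
      rw [ey]; exact hψ0 q (hq.trans_lt hq'), ex, ey]
    rcases hq.eq_or_lt with hr | hr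
    · rw [hφ G (p - 1) p (p + 1) (sub_add_cancel p 1) rfl hc' hc hr.symm,
        hψ G (p - 1) p (p + 1) (sub_add_cancel p 1) rfl hc' hc hc'' hr.symm,
        ← sg_smul_self (k := k) j (dualCoord K i F y ⟨(G, p), hc⟩),
        ← hζ G (p - 1) p (p + 1) (sub_add_cancel p 1) rfl hc' hc hr.symm, smul_add]
      refine congr_arg₂ (· + ·) (LinearMap.smul_comp _ _ _) ?_
      refine LinearMap.ext fun v => ?_
      change sg k i * (sg k (i + j) * _) = sg k j * _
      rw [← mul_assoc, ← sg_add, sg_congr (k := k) (a := i + (i + j)) (b := j) ⟨i, by ring⟩]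
      rfl
    · rw [hφ0 _ hr, hψ0 _ hr, LinearMap.zero_comp, LinearMap.zero_comp, smul_zero, add_zero,
        hy _ hr]

end

/-- Induction on the bound r for the nonzero layers: subtracting the coboundary supplied by
`exists_layer` clears the top layer, keeps the higher ones zero, and preserves the cocycle
conditions. -/
lemma exists_dual_of_vanishing (f : K ⟶ L)
    (hf : ∀ G : Finset (Fin n), QuasiIso ((vertex k G).map ((cubes k n).map f))) (r : ℕ)
    {h i j l : ℤ} (hi : h + 1 = i) (hj : i + 1 = j) (hl : j + 1 = l) :
    ∀ (x : (((cubes k n).obj ((dualB k n).obj (Opposite.op L))).X j).obj F)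
      (y : (((cubes k n).obj ((dualB k n).obj (Opposite.op K))).X i).obj F),
      (∀ q, r ≤ q.1.1.card → dualCoord L j F x q = 0) →
      (∀ q, r ≤ q.1.1.card → dualCoord K i F y q = 0) →
      (((cubes k n).obj ((dualB k n).obj (Opposite.op L))).d j l).app F x = 0 →
      (((cubes k n).map ((dualB k n).map f.op)).f j).app F x =
        (((cubes k n).obj ((dualB k n).obj (Opposite.op K))).d i j).app F y →
      ∃ (x' : (((cubes k n).obj ((dualB k n).obj (Opposite.op L))).X i).obj F)
        (y' : (((cubes k n).obj ((dualB k n).obj (Opposite.op K))).X h).obj F),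
        (((cubes k n).obj ((dualB k n).obj (Opposite.op L))).d i j).app F x' = x ∧
        (((cubes k n).map ((dualB k n).map f.op)).f i).app F x' +
          (((cubes k n).obj ((dualB k n).obj (Opposite.op K))).d h i).app F y' = y := by
  induction r with
  | zero =>
    intro x y hx hy _ _
    have hx0 : x = 0 := (dualCoord L j F).map_eq_zero_iff.1 (funext fun q => hx q (Nat.zero_le _))
    have hy0 : y = 0 := (dualCoord K i F).map_eq_zero_iff.1 (funext fun q => hy q (Nat.zero_le _))
    exact ⟨0, 0, by rw [map_zero, hx0], by rw [map_zero, map_zero, add_zero, hy0]⟩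
  | succ r ih =>
    intro x y hx hy hdx hxy
    obtain ⟨x₁, y₁, h1, h2⟩ := exists_layer f r hi hj x y hx hy
      (exists_functionals f r hj hl x y hx hy hf hdx hxy)
    have hd1 := congr($(congr_app (((cubes k n).obj ((dualB k n).obj (Opposite.op L))).d_comp_d i j l)
      F) x₁)
    have hd2 := congr($(congr_app (((cubes k n).obj ((dualB k n).obj (Opposite.op K))).d_comp_d h i j)
      F) y₁)
    have hc := congr($(congr_app (((cubes k n).map ((dualB k n).map f.op)).comm i j) F) x₁)
    obtain ⟨x', y', h3, h4⟩ := ih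
      (x - (((cubes k n).obj ((dualB k n).obj (Opposite.op L))).d i j).app F x₁)
      (y - ((((cubes k n).map ((dualB k n).map f.op)).f i).app F x₁ +
          (((cubes k n).obj ((dualB k n).obj (Opposite.op K))).d h i).app F y₁))
      (fun q hq => by rw [map_sub, Pi.sub_apply, h1 q hq, sub_self])
      (fun q hq => by rw [map_sub, Pi.sub_apply, h2 q hq, sub_self])
      (by
        rw [map_sub, hdx, zero_sub, neg_eq_zero]
        exact hd1)
      (by
        rw [map_sub, map_sub, map_add, hxy]
        congr 1
        exact hc.symm.trans ((add_zero _).symm.trans (congr_arg _ hd2.symm)))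
    refine ⟨x' + x₁, y' + y₁, ?_, ?_⟩
    · rw [map_add, h3, sub_add_cancel]
    · rw [map_add, map_add, add_add_add_comm, h4, sub_add_cancel]

lemma preservesQis_dualB : PreservesQis (dualB k n) := by
  intro K L f hf
  rw [qis_iff] at hf ⊢
  intro F
  rw [quasiIso_iff_coneExact]
  intro h i j l hi hj hl x y hx hy
  have hcard (G : Finset (Fin n)) : ¬ n + 1 ≤ G.card := by
    have := Finset.card_le_univ G
    rw [Fintype.card_fin] at this
    lia
  -- For the bound n + 1 the vanishing conditions are empty, as no subset of [n] has more than n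
  -- elements.
  exact exists_dual_of_vanishing f hf (n + 1) hi hj hl x y (fun q hq => absurd hq (hcard _))
    (fun q hq => absurd hq (hcard _)) hx hy

end DualQis

/-! ### Identification of D ∘ A with psi -/

section Model

variable {k : Type u} [Field k] {n : ℕ}

variable (k n) in
/-- The functor `D ∘ A` on `Com^b(Sq)`. -/
def dualAlexB : ComB k n ⥤ ComB k n := (alexB k n).rightOp ⋙ dualB k n

instance finite_cubes (K : ComB k n) (q : ℤ) (H : Finset (Fin n)) :
    Module.Finite k ((((cubes k n).obj K).X q).obj H) :=
  (isSquarefree_obj (K.obj.X q)).finite (sqf H) (sqf_nonneg H)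

lemma eq_of_forall_dual {V : Type*} [AddCommGroup V] [Module k V] {v w : V}
    (h : ∀ ξ : Module.Dual k V, ξ v = ξ w) : v = w := by
  rw [← sub_eq_zero, ← Module.forall_dual_apply_eq_zero_iff k]
  intro ξ
  rw [map_sub, h, sub_self]

lemma dualIdx_of_psiIdx {t p q : ℤ} {F G H : Finset (Fin n)} (hq : q = -p) (hH : H = Gᶜ)
    (h : Disjoint H F ∧ q + H.card = t + n) : F ⊆ G ∧ (G.card : ℤ) + p + t = 0 := by
  subst hH
  refine ⟨?_, ?_⟩
  · have := Finset.subset_compl_iff_disjoint_right.2 h.1.symm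
    rwa [compl_compl] at this
  · have := h.2
    rw [card_compl_int] at this
    lia

variable (K : ComB k n) (t : ℤ) (F : Finset (Fin n))

/-- The coordinates of the elements of the component of degree `t` at the vertex `F` of
`D(A(K))`. -/
def dualAlexCoord : (((cubes k n).obj ((dualAlexB k n).obj K)).X t).obj F ≃ₗ[k]
    DualX ((cubes k n).obj ((alexB k n).obj (Opposite.op K))) t F :=
  dualCoord ((alexB k n).obj (Opposite.op K)) t F

/-- The comparison of the component of degree `t` at the vertex `F` of `D(A(K))` with its model. -/
def modelMap : (((cubes k n).obj ((dualAlexB k n).obj K)).X t).obj F →ₗ[k]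
    PsiX ((cubes k n).obj K) t F where
  toFun x p := (Module.evalEquiv k ((((cubes k n).obj K).X p.1.2).obj p.1.1)).symm
    ((dualAlexCoord K t F x ⟨(p.1.1ᶜ, -p.1.2),
      dualIdx_of_psiIdx (neg_neg p.1.2).symm (compl_compl p.1.1).symm p.2⟩).comp
      (alexEquiv K (neg_neg p.1.2).symm (compl_compl p.1.1).symm).toLinearMap)
  map_add' x y := by
    funext p
    rw [map_add, Pi.add_apply, LinearMap.add_comp, map_add]
    rfl
  map_smul' c x := by
    funext p
    rw [map_smul, Pi.smul_apply, LinearMap.smul_comp, map_smul]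
    rfl

variable {K t F}

/-- Characterizes `modelMap` by pairing with functionals, so the inverse of the bidual isomorphism
is not needed again. Leaving p and G variable avoids casts along double negation and double
complement. -/
lemma dual_modelMap (x : (((cubes k n).obj ((dualAlexB k n).obj K)).X t).obj F) {p q : ℤ}
    {G H : Finset (Fin n)} (hq : q = -p) (hH : H = Gᶜ) (h : Disjoint H F ∧ q + H.card = t + n)
    (ξ : Module.Dual k ((((cubes k n).obj K).X q).obj H)) :
    ξ (modelMap K t F x ⟨(H, q), h⟩) = dualAlexCoord K t F x
      ⟨(G, p), dualIdx_of_psiIdx hq hH h⟩ (alexEquiv K hq hH ξ) := by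
  obtain rfl : p = -q := by lia
  obtain rfl : G = Hᶜ := by rw [hH, compl_compl]
  exact Module.apply_evalEquiv_symm_apply k _ ξ _

lemma modelMap_bijective : Function.Bijective (modelMap K t F) := by
  constructor
  · rw [injective_iff_map_eq_zero]
    intro x hx
    refine (dualAlexCoord K t F).map_eq_zero_iff.1 ?_
    funext ⟨⟨G, p⟩, hc⟩
    replace hc : F ⊆ G ∧ (G.card : ℤ) + p + t = 0 := hc
    have h : Disjoint Gᶜ F ∧ -p + Gᶜ.card = t + n := by
      refine ⟨(Finset.subset_compl_iff_disjoint_right.1 (by rw [compl_compl]; exact hc.1 : F ⊆ Gᶜᶜ)).symm, ?_⟩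
      have := hc.2
      rw [card_compl_int]
      lia
    refine LinearMap.ext fun y => ?_
    obtain ⟨ξ, rfl⟩ := (alexEquiv K (p := p) rfl (G := G) rfl).surjective y
    have e := dual_modelMap x rfl rfl h ξ
    rw [hx] at e
    exact e.symm.trans (map_zero ξ)
  · intro v
    let φ : DualX ((cubes k n).obj ((alexB k n).obj (Opposite.op K))) t F := fun p =>
      (Module.Dual.eval k ((((cubes k n).obj K).X (-p.1.2)).obj p.1.1ᶜ) (v ⟨(p.1.1ᶜ, -p.1.2), by
        have hc := p.2
        refine ⟨(Finset.subset_compl_iff_disjoint_right.1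
          (by rw [compl_compl]; exact hc.1 : F ⊆ p.1.1ᶜᶜ)).symm, ?_⟩
        dsimp only
        rw [card_compl_int]
        lia⟩)).comp (alexEquiv K (p := p.1.2) rfl (G := p.1.1) rfl).symm.toLinearMap
    have hφ {p q : ℤ} {G H : Finset (Fin n)} (hq : q = -p) (hH : H = Gᶜ)
        (h : Disjoint H F ∧ q + H.card = t + n)
        (ξ : Module.Dual k ((((cubes k n).obj K).X q).obj H)) :
        φ ⟨(G, p), dualIdx_of_psiIdx hq hH h⟩ (alexEquiv K hq hH ξ) = ξ (v ⟨(H, q), h⟩) := by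
      subst hq hH
      exact LinearMap.congr_fun ((alexEquiv K (p := p) rfl (G := G) rfl).symm_apply_apply ξ) _
    refine ⟨(dualAlexCoord K t F).symm φ, ?_⟩
    funext ⟨⟨H, q⟩, h⟩
    refine eq_of_forall_dual (k := k) (V := (((cubes k n).obj K).X q).obj H) fun ξ => ?_
    rw [dual_modelMap _ (neg_neg q).symm (compl_compl H).symm h ξ, LinearEquiv.apply_symm_apply]
    exact hφ _ _ h ξ

lemma modelMap_map {F' : Finset (Fin n)} (hF : F ⊆ F')
    (x : (((cubes k n).obj ((dualAlexB k n).obj K)).X t).obj F) :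
    modelMap K t F' ((((cubes k n).obj ((dualAlexB k n).obj K)).X t).map (homOfLE hF) x) =
      PsiX.res hF (modelMap K t F x) := by
  funext ⟨⟨H, q⟩, h⟩
  refine eq_of_forall_dual (k := k) (V := (((cubes k n).obj K).X q).obj H) fun ξ => ?_
  rw [dual_modelMap _ (neg_neg q).symm (compl_compl H).symm h ξ]
  refine Eq.trans ?_ (dual_modelMap x (neg_neg q).symm (compl_compl H).symm
    ⟨h.1.mono_right hF, h.2⟩ ξ).symm
  exact LinearMap.congr_fun (dualCoord_map (L := (alexB k n).obj (Opposite.op K)) hF x _) _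

lemma dualAlexCoord_app {L : ComB k n} (f : K ⟶ L)
    (x : (((cubes k n).obj ((dualAlexB k n).obj K)).X t).obj F) (G : Finset (Fin n)) (p : ℤ)
    (h : F ⊆ G ∧ (G.card : ℤ) + p + t = 0) :
    dualAlexCoord L t F ((((cubes k n).map ((dualAlexB k n).map f)).f t).app F x) ⟨(G, p), h⟩ =
      (dualAlexCoord K t F x ⟨(G, p), h⟩).comp
        ((((cubes k n).map ((alexB k n).map f.op)).f p).app G).hom :=
  dualCoord_app ((alexB k n).map f.op) x G p h

lemma modelMap_app {L : ComB k n} (f : K ⟶ L)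
    (x : (((cubes k n).obj ((dualAlexB k n).obj K)).X t).obj F) :
    modelMap L t F ((((cubes k n).map ((dualAlexB k n).map f)).f t).app F x) =
      PsiX.map ((cubes k n).map f) (modelMap K t F x) := by
  funext ⟨⟨H, q⟩, h⟩
  refine eq_of_forall_dual (k := k) (V := (((cubes k n).obj L).X q).obj H) fun ξ => ?_
  rw [dual_modelMap _ (neg_neg q).symm (compl_compl H).symm h ξ]
  refine Eq.trans ?_ (dual_modelMap x (neg_neg q).symm (compl_compl H).symm h
    (ξ.comp ((((cubes k n).map f).f q).app H).hom)).symm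
  rw [dualAlexCoord_app f x _ _
    (dualIdx_of_psiIdx (neg_neg q).symm (compl_compl H).symm h), LinearMap.comp_apply]
  exact congr_arg (dualAlexCoord K t F x ⟨(Hᶜ, -q), _⟩)
    (alexEquiv_app f (neg_neg q).symm (compl_compl H).symm ξ)

lemma dualAlexCoord_d {t' : ℤ} (ht : t + 1 = t')
    (x : (((cubes k n).obj ((dualAlexB k n).obj K)).X t).obj F) (G : Finset (Fin n)) (p : ℤ)
    (h : F ⊆ G ∧ (G.card : ℤ) + p + t' = 0) :
    dualAlexCoord K t' F ((((cubes k n).obj ((dualAlexB k n).obj K)).d t t').app F x) ⟨(G, p), h⟩ =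
      sg k t' • ((dualAlexCoord K t F x).pull (p + 1) G G).comp
        ((((cubes k n).obj ((alexB k n).obj (Opposite.op K))).d p (p + 1)).app G).hom +
      ∑ j ∈ Gᶜ, sg k (alpha j (insert j G)) • (dualAlexCoord K t F x).pull p G (insert j G) :=
  dualCoord_d ht x G p h

/-- Under A, the map from G to G' is dual to the map of K between the complementary vertices, from
H' to H; hence `pull` for D corresponds to `push` for psi. -/
lemma pull_alexEquiv (x : (((cubes k n).obj ((dualAlexB k n).obj K)).X t).obj F) {p q : ℤ}
    {G H G' H' : Finset (Fin n)} (hq : q = -p) (hH : H = Gᶜ) (hH' : H' = G'ᶜ) (hG : G ⊆ G')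
    (h : Disjoint H' F ∧ q + H'.card = t + n)
    (ξ : Module.Dual k ((((cubes k n).obj K).X q).obj H)) :
    (dualAlexCoord K t F x).pull p G G' (alexEquiv K hq hH ξ) =
      ξ ((modelMap K t F x).push q H H') := by
  have hHH' : H' ⊆ H := by
    rw [hH, hH']
    exact Finset.compl_subset_compl.2 hG
  have h' := dualIdx_of_psiIdx hq hH' h
  have e := dual_modelMap x hq hH' h
    (ξ.comp ((((cubes k n).obj K).X q).map (homOfLE hHH')).hom)
  rw [DualX.pull_of _ hG h'.1 h'.2, PsiX.push_of _ hHH' h.1 h.2]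
  refine Eq.trans ?_ e.symm
  rw [LinearMap.comp_apply]
  exact congr_arg (dualAlexCoord K t F x ⟨(G', p), h'⟩) (alexEquiv_map hq hH hH' hG hHH' ξ)

/-- Complementation turns the insertion of j into G into the deletion of j from H, and the exponent
α(j, G ∪ {j}) into β(j, H). -/
lemma modelMap_d {t' : ℤ} (ht : t + 1 = t')
    (x : (((cubes k n).obj ((dualAlexB k n).obj K)).X t).obj F) :
    modelMap K t' F ((((cubes k n).obj ((dualAlexB k n).obj K)).d t t').app F x) =
      PsiX.d ht (modelMap K t F x) := by
  funext ⟨⟨H, q⟩, h⟩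
  replace h : Disjoint H F ∧ q + H.card = t' + n := h
  refine eq_of_forall_dual (k := k) (V := (((cubes k n).obj K).X q).obj H) fun ξ => ?_
  rw [dual_modelMap _ (neg_neg q).symm (compl_compl H).symm h ξ, PsiX.d_apply, map_add, map_sum,
    map_smul]
  rw [dualAlexCoord_d ht x Hᶜ (-q) (dualIdx_of_psiIdx (neg_neg q).symm (compl_compl H).symm h),
    LinearMap.add_apply, LinearMap.sum_apply, LinearMap.smul_apply, LinearMap.comp_apply]
  have h₁ := alexEquiv_d (K := K) (p' := -q + 1) (q' := q - 1) (neg_neg q).symm (by lia)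
    (compl_compl H).symm ξ
  have h₂ := pull_alexEquiv x (p := -q + 1) (q := q - 1) (by lia) (compl_compl H).symm
    (compl_compl H).symm subset_rfl ⟨h.1, by have := h.2; lia⟩
    (ξ.comp ((((cubes k n).obj K).d (q - 1) q).app H).hom)
  refine congr_arg₂ (· + ·) (congr_arg (sg k t' • ·) ((congr_arg _ h₁).trans h₂))
    (Finset.sum_congr (compl_compl H) fun j hj => ?_)
  have hj' : Disjoint (H.erase j) F ∧ q + (H.erase j).card = t + n := by
    refine ⟨h.1.mono_left (Finset.erase_subset _ _), ?_⟩
    have := h.2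
    rw [card_erase_int hj]
    lia
  have hH : H.erase j = (insert j Hᶜ)ᶜ := by
    rw [Finset.compl_insert, compl_compl]
  have hs : sg k (alpha j (insert j Hᶜ)) = sg k (beta j H) := by
    rw [alpha_insert (by simpa using hj), if_neg (lt_irrefl j), add_zero, beta]
  rw [hs, map_smul, LinearMap.smul_apply, pull_alexEquiv x (neg_neg q).symm (compl_compl H).symm hH
    (Finset.subset_insert j Hᶜ) hj' ξ]

variable (k n) in
/-- The functor `psi` is a model for `D ∘ A`. -/
def modelIso : dualAlexB k n ⋙ cubes k n ≅ cubes k n ⋙ psi k n :=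
  NatIso.ofComponents
    (fun K => HomologicalComplex.Hom.isoOfComponents
      (fun t => NatIso.ofComponents
        (fun F => (LinearEquiv.ofBijective (modelMap K t F) modelMap_bijective).toModuleIso)
        fun {F F'} h => by
          ext x : 2
          exact modelMap_map (leOfHom h) x)
      fun t t' ht => by
        ext F x : 4
        exact (congr($(psiObj_d_app ((cubes k n).obj K) ht F) (modelMap K t F x))).trans
          (modelMap_d ht x).symm)
    fun {K L} f => by
      ext t F x : 5
      exact modelMap_app f x

end Model

/-! ### Passage to the derived category -/

section Derived

variable (k : Type u) [Field k] (n : ℕ)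

instance : (cubes k n).CommShift ℤ := inferInstanceAs
  (((bounded k n).ι ⋙ (cube k n).mapHomologicalComplex (ComplexShape.up ℤ)).CommShift ℤ)

/-- The functor `psi³` is a model for `(D ∘ A)³`. -/
def modelIsoCube : (dualAlexB k n ⋙ dualAlexB k n ⋙ dualAlexB k n) ⋙ cubes k n ≅
    cubes k n ⋙ psi k n ⋙ psi k n ⋙ psi k n :=
  Functor.isoWhiskerLeft (dualAlexB k n) (Functor.isoWhiskerLeft (dualAlexB k n) (modelIso k n)) ≪≫
    Functor.isoWhiskerLeft (dualAlexB k n) (Functor.isoWhiskerRight (modelIso k n) (psi k n)) ≪≫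
    Functor.isoWhiskerRight (modelIso k n) (psi k n ⋙ psi k n)

/-- The natural transformation `K[2n] → D A D A D A(K)`. -/
def shiftToDual : shiftFunctor (ComB k n) (2 * (n : ℤ)) ⟶
    dualAlexB k n ⋙ dualAlexB k n ⋙ dualAlexB k n :=
  ((Functor.FullyFaithful.ofFullyFaithful (cubes k n)).whiskeringRight (ComB k n)).preimage
    (((cubes k n).commShiftIso (2 * (n : ℤ))).hom ≫ Functor.whiskerLeft (cubes k n) (eta k n) ≫
      (modelIsoCube k n).inv)

lemma cubes_map_shiftToDual (K : ComB k n) : (cubes k n).map ((shiftToDual k n).app K) =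
    ((cubes k n).commShiftIso (2 * (n : ℤ))).hom.app K ≫ (eta k n).app ((cubes k n).obj K) ≫
      (modelIsoCube k n).inv.app K :=
  congr_app (((Functor.FullyFaithful.ofFullyFaithful (cubes k n)).whiskeringRight
    (ComB k n)).map_preimage (((cubes k n).commShiftIso (2 * (n : ℤ))).hom ≫
      Functor.whiskerLeft (cubes k n) (eta k n) ≫ (modelIsoCube k n).inv)) K

/-- Through `cubes` the map is `eta` composed with isomorphisms on both sides. -/
lemma qis_shiftToDual (K : ComB k n) : qis k n ((shiftToDual k n).app K) := by
  rw [qis_iff]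
  intro F
  have := quasiIso_eta ((cubes k n).obj K) F
  rw [cubes_map_shiftToDual, Functor.map_comp, Functor.map_comp]
  infer_instance

/-- The natural transformation `K[2n] → D A D A D A(K)` becomes invertible in `D^b(Sq)`. -/
def shiftIsoDual : (dualAlexB k n ⋙ dualAlexB k n ⋙ dualAlexB k n) ⋙ (qis k n).Q ≅
    shiftFunctor (ComB k n) (2 * (n : ℤ)) ⋙ (qis k n).Q :=
  haveI : IsIso (Functor.whiskerRight (shiftToDual k n) (qis k n).Q) :=
    (NatTrans.isIso_iff_isIso_app _).2 fun K =>
      Localization.inverts (qis k n).Q (qis k n) _ (qis_shiftToDual k n K)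
  (asIso (Functor.whiskerRight (shiftToDual k n) (qis k n).Q)).symm

variable {k n}

lemma isInvertedBy_Q_op (F : (ComB k n)ᵒᵖ ⥤ ComB k n) (hF : PreservesQis F) :
    (qis k n).IsInvertedBy (F.rightOp ⋙ (qis k n).Q.op) := fun K L f hf => by
  have := Localization.inverts (qis k n).Q (qis k n) _ (hF f hf)
  exact inferInstanceAs (IsIso ((qis k n).Q.map (F.map f.op)).op)

/-- The universal property of the constructed localization gives an equality of functors, so the
compatibility of (D ∘ A)³ with localization is obtained by rewriting. -/
lemma Q_op_comp_derive (F : (ComB k n)ᵒᵖ ⥤ ComB k n) (hF : PreservesQis F) :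
    (qis k n).Q.op ⋙ derive F hF = F ⋙ (qis k n).Q :=
  congr_arg (fun G : ComB k n ⥤ (Db k n)ᵒᵖ => G.leftOp)
    (Localization.Construction.fac (F.rightOp ⋙ (qis k n).Q.op) (isInvertedBy_Q_op F hF))

lemma comp_rightOp_comp {C D : Type*} [Category* C] [Category* D] {Q : C ⥤ D} {A B : Cᵒᵖ ⥤ C}
    {A' B' : Dᵒᵖ ⥤ D} (hA : Q.op ⋙ A' = A ⋙ Q) (hB : Q.op ⋙ B' = B ⋙ Q) :
    Q ⋙ A'.rightOp ⋙ B' = (A.rightOp ⋙ B) ⋙ Q := by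
  have hA' : Q ⋙ A'.rightOp = A.rightOp ⋙ Q.op := congr_arg Functor.rightOp hA
  rw [← Functor.assoc, hA', Functor.assoc, hB, Functor.assoc]

lemma comp_comp_comp {C D : Type*} [Category* C] [Category* D] {Q : C ⥤ D} {T : C ⥤ C} {S : D ⥤ D}
    (h : Q ⋙ S = T ⋙ Q) : Q ⋙ S ⋙ S ⋙ S = (T ⋙ T ⋙ T) ⋙ Q := by
  rw [← Functor.assoc, h, Functor.assoc, ← Functor.assoc Q, h, Functor.assoc, h, Functor.assoc,
    Functor.assoc]

lemma Q_comp_derivedDA (hA : PreservesQis (alexB k n)) (hD : PreservesQis (dualB k n)) :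
    (qis k n).Q ⋙ derivedDA hA hD = dualAlexB k n ⋙ (qis k n).Q :=
  comp_rightOp_comp (Q_op_comp_derive _ hA) (Q_op_comp_derive _ hD)

end Derived

end SquarefreeModules

end

theorem theorem3p10 (k : Type u) [Field k] (n : ℕ) :
    ∃ (hA : SquarefreeModules.PreservesQis (SquarefreeModules.alexB k n))
      (hD : SquarefreeModules.PreservesQis (SquarefreeModules.dualB k n)),
      Nonempty (SquarefreeModules.derivedDA hA hD ⋙ SquarefreeModules.derivedDA hA hD ⋙
          SquarefreeModules.derivedDA hA hD ≅
        CategoryTheory.shiftFunctor (SquarefreeModules.Db k n) (2 * (n : ℤ))) := by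
  refine ⟨SquarefreeModules.preservesQis_alexB, SquarefreeModules.preservesQis_dualB, ⟨?_⟩⟩
  let W := SquarefreeModules.qis k n
  let S := SquarefreeModules.derivedDA (SquarefreeModules.preservesQis_alexB (k := k) (n := n))
    SquarefreeModules.preservesQis_dualB
  let T := SquarefreeModules.dualAlexB k n
  -- Both functors on D^b(Sq) are lifts of functors on Com^b(Sq), so the isomorphism already found
  -- after localizing extends uniquely to them.
  letI : Localization.Lifting W.Q W ((T ⋙ T ⋙ T) ⋙ W.Q) (S ⋙ S ⋙ S) :=
    ⟨eqToIso (SquarefreeModules.comp_comp_comp (SquarefreeModules.Q_comp_derivedDA _ _))⟩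
  letI : Localization.Lifting W.Q W
      (shiftFunctor (SquarefreeModules.ComB k n) (2 * (n : ℤ)) ⋙ W.Q)
      (shiftFunctor (SquarefreeModules.Db k n) (2 * (n : ℤ))) :=
    ⟨(W.Q.commShiftIso (2 * (n : ℤ))).symm⟩
  exact Localization.liftNatIso W.Q W _ _ _ _ (SquarefreeModules.shiftIsoDual k n)
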